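/- Let $\kappa>0$, $\lambda=2\pi/\kappa$, $-\pi/2<\theta<\pi/2$, and $\epsilon,d>0$. Let $\mathbb R^2_+=\{x_2>0\}$, $D_\epsilon=(0,\epsilon)\times(-d,0)$, $\Gamma_0=\{x_2=0\}$, $\Gamma_\epsilon^+=(0,\epsilon)\times\{0\}$, $\Gamma_\epsilon^-=(0,\epsilon)\times\{-d\}$, and $\phi_0=1/\sqrt\epsilon$. Put $$u^{\rm inc}(x)=e^{i\kappa(x_1\sin\theta-x_2\cos\theta)},\qquad u^{\rm ref}(x)=e^{i\kappa(x_1\sin\theta+x_2\cos\theta)}.$$ For a function $v$ let $v_0^+=\int_0^\epsilon v(x_1,0)\,\phi_0\,dx_1$ and $v_0^-=\int_0^\epsilon v(x_1,-d)\,\phi_0\,dx_1$. Consider a function $v_\epsilon$ (the approximate single-mode PEC-PEC model) with the following two properties. (a) In $\mathbb R^2_+$ it is a solution of $$\Delta v_\epsilon+\kappa^2v_\epsilon=0\ \text{ in }\mathbb R^2_+,\qquad \partial_{x_2}v_\epsilon=0\ \text{ on }\Gamma_0\setminus\overline{\Gamma_\epsilon^+},\qquad \partial_{x_2}v_\epsilon=i\kappa\,\frac{e^{i\kappa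 d}-e^{-i\kappa d}}{e^{i\kappa d}+e^{-i\kappa d}}\,v_{\epsilon,0}^+\,\phi_0\ \text{ on }\Gamma_\epsilon^+ ,$$ where $v^{\rm sc}_\epsilon=v_\epsilon-(u^{\rm inc}+u^{\rm ref})$ satisfies $\lim_{r\to\infty}\sqrt r\,(\partial_rv^{\rm sc}_\epsilon-i\kappa v^{\rm sc}_\epsilon)=0$, $r=|x|$, uniformly in all directions in $\mathbb R^2_+$. Here $v_\epsilon$ is $C^2$ in $\mathbb R^2_+$, $C^1$ up to $\Gamma_0$ except at the points $(0,0)$ and $(\epsilon,0)$, and $v_\epsilon$ and $\nabla v_\epsilon$ are square integrable on bounded subsets of $\mathbb R^2_+$. (b) In $D_\epsilon\cup\Gamma_\epsilon^-$, $$v_\epsilon(x)=\bigl(\tilde\alpha_0^+e^{-i\kappa x_2}+\tilde\alpha_0^-e^{i\kappa(x_2+d)}\bigr)\phi_0,\qquad \tilde\alpha_0^+=\frac{e^{i\kappa d}v_{\epsilon,0}^--v_{\epsilon,0}^+}{e^{2i\kappa d}-1},\quad \tilde\alpha_0^-=\frac{e^{i\kappa d}v_{\epsilon,0}^+-v_{\epsilon,0}^-}{e^{2i\kappa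 d}-1},$$ and $\partial_{x_2}v_\epsilon=0$ on $\Gamma_\epsilon^-$. Then, in the regime $\epsilon\ll d\ll\lambda$, $\|\nabla v_\epsilon\|_{L^2(D_\epsilon)}$ is comparable to $\kappa^2\sqrt\epsilon\,d^{3/2}$. Precisely: there exist constants $\delta,C_1,C_2>0$, independent of $\lambda,\epsilon,d$ and $\theta$, such that whenever $\epsilon\le\delta d$ and $d\le\delta\lambda$, every such $v_\epsilon$ satisfies $$C_1\,\kappa^2\sqrt\epsilon\,d^{3/2}\ \le\ \|\nabla v_\epsilon\|_{L^2(D_\epsilon)}\ \le\ C_2\,\kappa^2\sqrt\epsilon\,d^{3/2}.$$ -/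

import Mathlib

open MeasureTheory Filter Topology

namespace OpenCavity

noncomputable section

/-- The plane `ℝ²` with its Euclidean norm and Lebesgue measure. -/
abbrev Plane := EuclideanSpace ℝ (Fin 2)

/-- The open upper half-plane `x₂ > 0`. -/
def upperHalf : Set Plane := {x | 0 < x 1}

/-- The closed upper half-plane `x₂ ≥ 0`. -/
def closedUpperHalf : Set Plane := {x | 0 ≤ x 1}

/-- The two end points of the aperture of width `ε`, where the Neumann datum jumps. -/
def corners (ε : ℝ) : Set Plane := {!₂[0, 0], !₂[ε, 0]}

/-- The cavity `(0, ε) × (-d, 0)`. -/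
def cavity (ε d : ℝ) : Set Plane := {x | 0 < x 0 ∧ x 0 < ε ∧ -d < x 1 ∧ x 1 < 0}

/-- The wavelength belonging to the wavenumber `κ`. -/
def wavelength (κ : ℝ) : ℝ := 2 * Real.pi / κ

/-- The gradient of a complex-valued function of two real variables, as a vector of `ℂ²`
with the Hermitian norm, so that `‖grad v x‖² = |∂₁ v x|² + |∂₂ v x|²`. -/
def grad (v : Plane → ℂ) (x : Plane) : EuclideanSpace ℂ (Fin 2) :=
  WithLp.toLp 2 fun j => fderiv ℝ v x (EuclideanSpace.single j 1)

/-- The incident plane wave, with direction `(sin θ, -cos θ)`. -/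
def uInc (κ θ : ℝ) (x : Plane) : ℂ :=
  Complex.exp (Complex.I * κ * ((x 0 * Real.sin θ - x 1 * Real.cos θ : ℝ) : ℂ))

/-- The plane wave reflected by the line `x₂ = 0`, with direction `(sin θ, cos θ)`. -/
def uRef (κ θ : ℝ) (x : Plane) : ℂ :=
  Complex.exp (Complex.I * κ * ((x 0 * Real.sin θ + x 1 * Real.cos θ : ℝ) : ℂ))

/-- The scattered part of a total field in the upper half-plane. -/
def scattered (κ θ : ℝ) (v : Plane → ℂ) (x : Plane) : ℂ := v x - (uInc κ θ x + uRef κ θ x)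

/-- The Sommerfeld radiation condition in the upper half-plane, uniformly in all directions. -/
def Radiating (κ : ℝ) (w : Plane → ℂ) : Prop :=
  Tendsto (fun x : Plane =>
      (Real.sqrt ‖x‖ : ℂ) * (fderiv ℝ w x (‖x‖⁻¹ • x) - Complex.I * κ * w x))
    (comap norm atTop ⊓ 𝓟 upperHalf) (𝓝 0)

/-- The constant waveguide mode `φ₀ = 1 / √ε`. -/
def phi0 (ε : ℝ) : ℂ := ((1 / Real.sqrt ε : ℝ) : ℂ)

/-- The zeroth Fourier coefficient `∫₀^ε v(x₁, h) φ₀ dx₁` on the segment at height `h`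
(`φ₀` is real). -/
def coeff0 (ε h : ℝ) (v : Plane → ℂ) : ℂ := ∫ x₁ in (0 : ℝ)..ε, v !₂[x₁, h] * phi0 ε

/-- The one-mode Dirichlet-to-Neumann map; its value is a constant function on the aperture. -/
def dtn0 (κ ε d : ℝ) (v : Plane → ℂ) : ℂ :=
  Complex.I * κ *
    ((Complex.exp (Complex.I * κ * d) - Complex.exp (-(Complex.I * κ * d))) /
      (Complex.exp (Complex.I * κ * d) + Complex.exp (-(Complex.I * κ * d)))) *
    coeff0 ε 0 v * phi0 ε

/-- `v` has the one-sided derivative `g` in the direction `x₂` at `(x₁, h)`, from above. -/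
def HasVerticalDeriv (v : Plane → ℂ) (g : ℂ) (x₁ h : ℝ) : Prop :=
  HasDerivWithinAt (fun t : ℝ => v !₂[x₁, t]) g (Set.Ici h) h

/-- `v` solves, in the upper half-plane, the scattering problem with the one-mode
Dirichlet-to-Neumann condition on the aperture: `v` is `C²` inside, `C¹` up to the boundary away
from the two end points of the aperture, and of locally finite energy (locally `H¹` up to the
boundary). -/
structure IsHalfPlaneSolution (κ θ ε d : ℝ) (v : Plane → ℂ) : Prop where
  contDiffOn_interior : ContDiffOn ℝ 2 v upperHalf
  contDiffOn_boundary : ContDiffOn ℝ 1 v (closedUpperHalf \ corners ε)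
  memLp_local : ∀ R : ℝ, MemLp v 2 (volume.restrict (upperHalf ∩ Metric.ball 0 R))
  memLp_grad_local : ∀ R : ℝ, MemLp (grad v) 2 (volume.restrict (upperHalf ∩ Metric.ball 0 R))
  helmholtz : ∀ x ∈ upperHalf, Laplacian.laplacian v x + (κ : ℂ) ^ 2 * v x = 0
  neumann : ∀ x₁ : ℝ, x₁ < 0 ∨ ε < x₁ → HasVerticalDeriv v 0 x₁ 0
  aperture : ∀ x₁ : ℝ, 0 < x₁ → x₁ < ε → HasVerticalDeriv v (dtn0 κ ε d v) x₁ 0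
  radiation : Radiating κ (scattered κ θ v)

/-- The coefficient `α⁺` of the mode `exp(-iκx₂)`, from the zeroth Fourier coefficients of `v` on
the aperture and on the bottom. -/
def alphaPlus (κ ε d : ℝ) (v : Plane → ℂ) : ℂ :=
  (Complex.exp (Complex.I * κ * d) * coeff0 ε (-d) v - coeff0 ε 0 v) /
    (Complex.exp (2 * Complex.I * κ * d) - 1)

/-- The coefficient `α⁻` of the mode `exp(iκ(x₂ + d))`. -/
def alphaMinus (κ ε d : ℝ) (v : Plane → ℂ) : ℂ :=
  (Complex.exp (Complex.I * κ * d) * coeff0 ε 0 v - coeff0 ε (-d) v) /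
    (Complex.exp (2 * Complex.I * κ * d) - 1)

/-- In the cavity and on its bottom, `v` is the single-mode field determined by its zeroth Fourier
coefficients on the aperture and on the bottom, and it satisfies the Neumann (PEC) condition on
the bottom. -/
structure IsSingleModeInCavity (κ ε d : ℝ) (v : Plane → ℂ) : Prop where
  single_mode : ∀ x₁ x₂ : ℝ, 0 < x₁ → x₁ < ε → -d ≤ x₂ → x₂ < 0 →
    v !₂[x₁, x₂] =
      (alphaPlus κ ε d v * Complex.exp (-(Complex.I * κ * x₂)) +
        alphaMinus κ ε d v * Complex.exp (Complex.I * κ * (x₂ + d))) * phi0 ε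
  bottom : ∀ x₁ : ℝ, 0 < x₁ → x₁ < ε → HasVerticalDeriv v 0 x₁ (-d)

end

end OpenCavity

/-! Cavity side. The Neumann condition on the bottom forces α⁺ e^{iκd} = α⁻ (`alphaPlus_mul_exp`),
so the field is 2α⁻φ₀ cos(κ(x₂ + d)) and |∇v| = 2|α⁻| ε^{-1/2} κ |sin κ(x₂ + d)|
(`norm_grad_cavity`). The aperture coefficient c of v equals 2α⁻ cos κd (`coeff0_eq_alphaMinus`).
Once |c| is known to be comparable to √ε, the gradient is at most a multiple of κ²d on a rectangle
of area εd, and at least such a multiple on its upper half; the L² norm is then of order κ²d √(εd).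

Half-plane side: |c| is comparable to √ε (`exists_coeff0_bounds`). On the aperture the incident plus
reflected wave is 2 up to an error 2κε, which contributes about 2√ε. The scattered field w has the
constant Neumann datum g₀ on the aperture and zero outside, with |g₀| ≤ 2κ²d |c| ε^{-1/2}. The
estimate |w| ≤ C |g₀| √(ε/κ) on the aperture (`exists_aperture_bound`) bounds its contribution by
2Cκd √(κε) |c| ≤ |c|/2 for small κd, so it is absorbed. This is an a priori estimate, with no appeal
to existence or uniqueness.

The aperture estimate is Green's representation of w(y). The Neumann Green's function with its pole
y on the boundary is a multiple of H₀⁽¹⁾(κ|x - y|). Green's second identity (`green_identity`,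
`flux_balance`) balances four terms: the flux at the pole, which yields w(y) (`tendsto_flux_pole`);
the fluxes at the two corners, which vanish because w has finite energy (`tendsto_flux_corner`); the
flux at infinity, which vanishes by a Rellich-type argument (`tendsto_flux_radiating`); and the
integral of g₀ against the Green's function. The crude bound √π (κ|x - y|)^{-1/2} for the latter is
integrable and suffices, because a factor κd is left to spare.

Circles are replaced throughout by smooth radial cutoffs, so that every flux is an area integral
over a half-annulus. The Hankel function is built from e^{ir} ∫ e^{-ru²} (2 + iu²)^{-1/2} du, which
displays its decay, its radiation behaviour and its singularity. -/

namespace OpenCavity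

/-! ### The Hankel function from its Laplace-type integral. -/

noncomputable section

/-- The amplitude `(2 + iu²)^(-1/2)` in the Laplace-type integral for the Hankel function. -/
def hankelAmp (u : ℝ) : ℂ := (2 + Complex.I * u ^ 2) ^ ((-(1 / 2) : ℝ) : ℂ)

/-- The moments `∫ u^(2k) exp(-ru²) (2 + iu²)^(-1/2) du`. -/
def hankelMoment (k : ℕ) (r : ℝ) : ℂ :=
  ∫ u : ℝ, ((u ^ (2 * k) * Real.exp (-r * u ^ 2) : ℝ) : ℂ) * hankelAmp u

lemma hankelBase_re (u : ℝ) : (2 + Complex.I * u ^ 2 : ℂ).re = 2 := by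
  simp [← Complex.ofReal_pow]

lemma hankelBase_mem_slitPlane (u : ℝ) : (2 + Complex.I * u ^ 2 : ℂ) ∈ Complex.slitPlane := by
  left; rw [hankelBase_re]; norm_num

lemma hankelBase_ne_zero (u : ℝ) : (2 + Complex.I * u ^ 2 : ℂ) ≠ 0 :=
  Complex.slitPlane_ne_zero (hankelBase_mem_slitPlane u)

lemma hankelAmp_eq (u : ℝ) : ‖hankelAmp u‖ = ‖(2 + Complex.I * u ^ 2 : ℂ)‖ ^ (-(1 / 2) : ℝ) := by
  rw [hankelAmp, Complex.norm_cpow_real]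

lemma norm_hankelAmp_le_one (u : ℝ) : ‖hankelAmp u‖ ≤ 1 := by
  rw [hankelAmp_eq]
  apply Real.rpow_le_one_of_one_le_of_nonpos _ (by norm_num)
  have := Complex.re_le_norm (2 + Complex.I * u ^ 2 : ℂ)
  rw [hankelBase_re] at this
  linarith

lemma hasDerivAt_hankelAmp (u : ℝ) :
    HasDerivAt hankelAmp (-(Complex.I * u) * hankelAmp u / (2 + Complex.I * u ^ 2)) u := by
  have h1 : HasDerivAt (fun u : ℝ => (2 + Complex.I * u ^ 2 : ℂ)) (Complex.I * (2 * u)) u := by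
    have := ((hasDerivAt_id u).ofReal_comp.pow 2).const_mul Complex.I |>.const_add 2
    simpa using this
  have h2 : HasDerivAt (fun z : ℂ => z ^ ((-(1 / 2) : ℝ) : ℂ)) _ (2 + Complex.I * u ^ 2 : ℂ) :=
    (hasDerivAt_id _).cpow_const (hankelBase_mem_slitPlane u)
  have h3 := h2.comp u h1
  refine h3.congr_deriv ?_
  have hne := hankelBase_ne_zero u
  simp only [id, hankelAmp]
  rw [Complex.cpow_sub _ _ hne, Complex.cpow_one]
  push_cast
  field_simp

lemma continuous_hankelAmp : Continuous hankelAmp :=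
  continuous_iff_continuousAt.2 fun u => (hasDerivAt_hankelAmp u).continuousAt

lemma integrable_pow_mul_gaussian (n : ℕ) {r : ℝ} (hr : 0 < r) :
    Integrable fun u : ℝ => u ^ n * Real.exp (-r * u ^ 2) := by
  have := integrable_rpow_mul_exp_neg_mul_sq hr (s := n) (by
    have : (0 : ℝ) ≤ n := n.cast_nonneg
    linarith)
  simpa using this

lemma integrable_hankelMoment (k : ℕ) {r : ℝ} (hr : 0 < r) :
    Integrable fun u : ℝ => ((u ^ k * Real.exp (-r * u ^ 2) : ℝ) : ℂ) * hankelAmp u := by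
  have h := (integrable_pow_mul_gaussian k hr).ofReal (𝕜 := ℂ)
  refine h.mul_bdd (c := 1) continuous_hankelAmp.aestronglyMeasurable ?_
  exact ae_of_all _ norm_hankelAmp_le_one

lemma hasDerivAt_hankelMoment (k : ℕ) {r : ℝ} (hr : 0 < r) :
    HasDerivAt (hankelMoment k) (-hankelMoment (k + 1) r) r := by
  have key := hasDerivAt_integral_of_dominated_loc_of_deriv_le (μ := volume)
    (F := fun (r : ℝ) (u : ℝ) => ((u ^ (2 * k) * Real.exp (-r * u ^ 2) : ℝ) : ℂ) * hankelAmp u)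
    (F' := fun r u => -(((u ^ (2 * (k + 1)) * Real.exp (-r * u ^ 2) : ℝ) : ℂ) * hankelAmp u))
    (bound := fun u => u ^ (2 * (k + 1)) * Real.exp (-(r / 2) * u ^ 2))
    (x₀ := r) (s := Set.Ioi (r / 2)) (Ioi_mem_nhds (by linarith))
    ?_ (integrable_hankelMoment _ hr) ?_ ?_ (integrable_pow_mul_gaussian _ (by linarith)) ?_
  · have := key.2
    rwa [integral_neg] at this
  · filter_upwards [Ioi_mem_nhds hr] with s hs
    exact (integrable_hankelMoment _ hs).aestronglyMeasurable
  · exact (integrable_hankelMoment _ hr).aestronglyMeasurable.neg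
  · refine ae_of_all _ fun u s hs => ?_
    have hs : r / 2 < s := hs
    have hp : 0 ≤ u ^ (2 * (k + 1)) := by rw [pow_mul]; positivity
    rw [norm_neg, norm_mul, Complex.norm_real, Real.norm_of_nonneg (by positivity)]
    calc _ ≤ u ^ (2 * (k + 1)) * Real.exp (-s * u ^ 2) * 1 := by
          gcongr; exact norm_hankelAmp_le_one u
      _ ≤ _ := by rw [mul_one]; gcongr
  · refine ae_of_all _ fun u s hs => ?_
    have h1 : HasDerivAt (fun s : ℝ => u ^ (2 * k) * Real.exp (-s * u ^ 2))
        (u ^ (2 * k) * (Real.exp (-s * u ^ 2) * (-1 * u ^ 2))) s :=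
      (((hasDerivAt_id s).neg.mul_const (u ^ 2)).exp).const_mul _
    have h2 := (h1.ofReal_comp).mul_const (hankelAmp u)
    refine h2.congr_deriv ?_
    push_cast; ring

lemma gaussian_moment_nonneg (k : ℕ) (r u : ℝ) : 0 ≤ u ^ (2 * k) * Real.exp (-r * u ^ 2) :=
  mul_nonneg ((even_two_mul k).pow_nonneg u) (Real.exp_pos _).le

lemma norm_hankelMoment_zero_le {r : ℝ} (hr : 0 < r) :
    ‖hankelMoment 0 r‖ ≤ √(Real.pi / r) := by
  rw [← integral_gaussian r]
  refine norm_integral_le_of_norm_le (by simpa using integrable_pow_mul_gaussian 0 hr) ?_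
  refine ae_of_all _ fun u => ?_
  rw [norm_mul, Complex.norm_real, Real.norm_of_nonneg (gaussian_moment_nonneg _ _ _)]
  simpa [-neg_mul] using mul_le_mul_of_nonneg_left (norm_hankelAmp_le_one u) (Real.exp_pos (-r * u ^ 2)).le

/-- Half of the Gaussian absorbs the factor u², since (r/2)u² ≤ e^{(r/2)u²}. The gain of 1/r over
the zeroth moment is what makes the radiation defect of the Hankel function small. -/
lemma norm_hankelMoment_one_le {r : ℝ} (hr : 0 < r) :
    ‖hankelMoment 1 r‖ ≤ 2 / r * √(Real.pi / (r / 2)) := by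
  rw [← integral_gaussian (r / 2), ← integral_const_mul]
  refine norm_integral_le_of_norm_le
    (by simpa using (integrable_pow_mul_gaussian 0 (half_pos hr)).const_mul (2 / r)) ?_
  refine ae_of_all _ fun u => ?_
  rw [norm_mul, Complex.norm_real, Real.norm_of_nonneg (gaussian_moment_nonneg _ _ _)]
  have h1 : r / 2 * u ^ 2 ≤ Real.exp (r / 2 * u ^ 2) :=
    (by linarith : r / 2 * u ^ 2 ≤ r / 2 * u ^ 2 + 1).trans (Real.add_one_le_exp _)
  have h2 : Real.exp (-r * u ^ 2) = Real.exp (-(r / 2) * u ^ 2) * Real.exp (-(r / 2) * u ^ 2) := by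
    rw [← Real.exp_add]; ring_nf
  have h3 : Real.exp (r / 2 * u ^ 2) * Real.exp (-(r / 2) * u ^ 2) = 1 := by
    rw [← Real.exp_add]; simp
  calc u ^ (2 * 1) * Real.exp (-r * u ^ 2) * ‖hankelAmp u‖
      ≤ u ^ (2 * 1) * Real.exp (-r * u ^ 2) * 1 := by
        gcongr
        · exact gaussian_moment_nonneg _ _ _
        · exact norm_hankelAmp_le_one u
    _ = 2 / r * ((r / 2 * u ^ 2) * Real.exp (-(r / 2) * u ^ 2)) * Real.exp (-(r / 2) * u ^ 2) := by
        rw [h2]; field_simp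
    _ ≤ 2 / r * (Real.exp (r / 2 * u ^ 2) * Real.exp (-(r / 2) * u ^ 2)) *
          Real.exp (-(r / 2) * u ^ 2) := by gcongr
    _ = _ := by rw [h3, mul_one]

/-- The first-order relation between the moments that is equivalent to Bessel's equation. -/
lemma hankelMoment_relation {r : ℝ} (hr : 0 < r) :
    r * (hankelMoment 2 r - 2 * Complex.I * hankelMoment 1 r) + Complex.I * hankelMoment 0 r -
      hankelMoment 1 r = 0 := by
  have i0 := integrable_hankelMoment 0 hr
  have i1 := integrable_hankelMoment 1 hr
  have i2 := integrable_hankelMoment 2 hr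
  have i3 := integrable_hankelMoment 3 hr
  have i4 := integrable_hankelMoment 4 hr
  -- The relation is the vanishing integral of the derivative of (i/2) u (2 + iu²)^{1/2} e^{-ru²}.
  -- The square root is written as (2 + iu²) times the amplitude, so that only moments occur.
  have key := integral_eq_zero_of_hasDerivAt_of_integrable
    (f := fun u : ℝ => Complex.I / 2 * (((u ^ 1 * Real.exp (-r * u ^ 2) : ℝ) : ℂ) * hankelAmp u) * 2
      + Complex.I / 2 * (((u ^ 3 * Real.exp (-r * u ^ 2) : ℝ) : ℂ) * hankelAmp u) * Complex.I)
    (f' := fun u : ℝ => r * ((((u ^ 4 * Real.exp (-r * u ^ 2) : ℝ) : ℂ) * hankelAmp u)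
      - 2 * Complex.I * (((u ^ 2 * Real.exp (-r * u ^ 2) : ℝ) : ℂ) * hankelAmp u))
      + Complex.I * (((u ^ 0 * Real.exp (-r * u ^ 2) : ℝ) : ℂ) * hankelAmp u)
      - (((u ^ 2 * Real.exp (-r * u ^ 2) : ℝ) : ℂ) * hankelAmp u)) ?_ ?_ ?_
  · rw [integral_sub, integral_add, integral_const_mul, integral_sub, integral_const_mul,
      integral_const_mul] at key
    · exact key
    · exact i4
    · exact i2.const_mul _
    · exact (i4.sub (i2.const_mul _)).const_mul _
    · exact i0.const_mul _
    · exact ((i4.sub (i2.const_mul _)).const_mul _).add (i0.const_mul _)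
    · exact i2
  · intro u
    have hp : ∀ n : ℕ, HasDerivAt (fun u : ℝ => u ^ n * Real.exp (-r * u ^ 2))
        ((n * u ^ (n - 1)) * Real.exp (-r * u ^ 2) +
          u ^ n * (Real.exp (-r * u ^ 2) * (-r * (2 * u)))) u := by
      intro n
      have h1 := ((hasDerivAt_pow 2 u).const_mul (-r)).exp
      exact ((hasDerivAt_pow n u).mul h1).congr_deriv (by simp)
    have e1 := ((((hp 1).ofReal_comp).mul (hasDerivAt_hankelAmp u)).const_mul
      (Complex.I / 2)).mul_const 2
    have e3 := ((((hp 3).ofReal_comp).mul (hasDerivAt_hankelAmp u)).const_mul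
      (Complex.I / 2)).mul_const Complex.I
    refine (e1.add e3).congr_deriv ?_
    have hne := hankelBase_ne_zero u
    push_cast
    generalize Complex.exp _ = E
    field_simp
    ring_nf
    simp only [Complex.I_sq, Complex.I_pow_three]
    ring
  · exact ((((i4.sub (i2.const_mul _)).const_mul _).add (i0.const_mul _)).sub i2)
  · exact ((i1.const_mul _).mul_const _).add ((i3.const_mul _).mul_const _)

/-- A positive factor does not change the argument, so the principal branch is multiplicative here.
-/
lemma ofReal_mul_cpow {a : ℝ} (ha : 0 < a) {z : ℂ} (hz : z ≠ 0) (w : ℂ) :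
    ((a : ℂ) * z) ^ w = (a : ℂ) ^ w * z ^ w := by
  have hac : (a : ℂ) ≠ 0 := by exact_mod_cast ha.ne'
  rw [Complex.cpow_def_of_ne_zero (mul_ne_zero hac hz), Complex.cpow_def_of_ne_zero hac,
    Complex.cpow_def_of_ne_zero hz, Complex.log_ofReal_mul ha hz, ← Complex.exp_add,
    ← Complex.ofReal_log ha.le, add_mul]

lemma hankelAmp_scaled {n t : ℝ} (hn : 0 < n) :
    n * hankelAmp (n * t) = (2 / n ^ 2 + Complex.I * t ^ 2 : ℂ) ^ ((-(1 / 2) : ℝ) : ℂ) := by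
  have h1 : (2 + Complex.I * (n * t : ℝ) ^ 2 : ℂ) =
      ((n ^ 2 : ℝ) : ℂ) * (2 / n ^ 2 + Complex.I * t ^ 2) := by
    have : (n : ℂ) ≠ 0 := by exact_mod_cast hn.ne'
    push_cast; field_simp
  have h2 : ((n ^ 2 : ℝ) : ℂ) ^ ((-(1 / 2) : ℝ) : ℂ) = ((n⁻¹ : ℝ) : ℂ) := by
    rw [← Complex.ofReal_cpow (by positivity), ← Real.rpow_natCast, ← Real.rpow_mul hn.le]
    norm_num [Real.rpow_neg_one]
  have h3 : (2 / n ^ 2 + Complex.I * t ^ 2 : ℂ) ≠ 0 := by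
    intro h0
    rw [h0, mul_zero] at h1
    exact hankelBase_ne_zero _ h1
  rw [hankelAmp, h1, ofReal_mul_cpow (by positivity) h3, h2, ← mul_assoc,
    ← Complex.ofReal_mul, mul_inv_cancel₀ hn.ne', Complex.ofReal_one, one_mul]

/-- The base 2/n² + it² has imaginary part t², hence modulus at least t², uniformly in n. This is
the domination for the limit r → 0, where n = 1/√r. -/
lemma norm_hankelAmp_scaled_le {n t : ℝ} (hn : 0 < n) (ht : t ≠ 0) :
    ‖n * hankelAmp (n * t)‖ ≤ |t|⁻¹ := by
  rw [hankelAmp_scaled hn, Complex.norm_cpow_real, ← Real.rpow_neg_one |t|,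
    show (-1 : ℝ) = 2 * (-(1 / 2)) by norm_num, Real.rpow_mul (abs_nonneg t)]
  have hpos : 0 < |t| ^ (2 : ℝ) := Real.rpow_pos_of_pos (abs_pos.2 ht) _
  refine Real.rpow_le_rpow_of_nonpos hpos ?_ (by norm_num)
  refine le_trans ?_ (Complex.abs_im_le_norm _)
  have : (2 / n ^ 2 + Complex.I * t ^ 2 : ℂ).im = t ^ 2 := by
    simp [← Complex.ofReal_pow, ← Complex.ofReal_ofNat, ← Complex.ofReal_div]
  rw [this]
  simp

/-- The limit of `r ∫ u² exp(-ru²) (2 + iu²)^(-1/2) du` at `r = 0`. -/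
def hankelResidue : ℂ := Complex.I ^ ((-(1 / 2) : ℝ) : ℂ)

lemma hankelResidue_ne_zero : hankelResidue ≠ 0 := by
  simp [hankelResidue]

/-- Substitution u = t/√r, which moves the dependence on r from the Gaussian into the amplitude. -/
lemma hankelMoment_one_scaled {r : ℝ} (hr : 0 < r) :
    r * hankelMoment 1 r =
      ∫ t : ℝ, ((t ^ 2 * Real.exp (-t ^ 2) : ℝ) : ℂ) *
        (((√r)⁻¹ : ℝ) * hankelAmp ((√r)⁻¹ * t)) := by
  have hs : 0 < √r := Real.sqrt_pos.2 hr
  have h := Measure.integral_comp_mul_left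
    (fun u : ℝ => ((u ^ (2 * 1) * Real.exp (-r * u ^ 2) : ℝ) : ℂ) * hankelAmp u) (√r)⁻¹
  rw [inv_inv, abs_of_pos hs] at h
  have h' : hankelMoment 1 r = ((√r)⁻¹ : ℝ) • ((√r) • hankelMoment 1 r) := by
    rw [smul_smul, inv_mul_cancel₀ hs.ne', one_smul]
  rw [h', hankelMoment, ← h, Complex.real_smul, ← mul_assoc, ← integral_const_mul]
  congr 1 with t
  have hrr : (√r)⁻¹ ^ 2 = r⁻¹ := by rw [inv_pow, Real.sq_sqrt hr.le]
  have e1 : -r * ((√r)⁻¹ * t) ^ 2 = -t ^ 2 := by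
    rw [mul_pow, hrr]; field_simp
  have e2 : ((√r)⁻¹ * t) ^ (2 * 1) = r⁻¹ * t ^ 2 := by
    rw [mul_one, mul_pow, hrr]
  have hrc : (r : ℂ) ≠ 0 := by exact_mod_cast hr.ne'
  rw [e1, e2]
  push_cast
  field_simp

/-- Dominated convergence in the rescaled integral: the scaled amplitude tends to (it²)^{-1/2} =
i^{-1/2}/|t| and the integrands are bounded by |t| e^{-t²}, whose integral is 1. -/
lemma tendsto_mul_hankelMoment_one :
    Tendsto (fun r : ℝ => r * hankelMoment 1 r) (𝓝[>] 0) (𝓝 hankelResidue) := by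
  have hint : Integrable fun t : ℝ => |t| * Real.exp (-t ^ 2) := by
    have := (integrable_pow_mul_gaussian 1 one_pos).abs
    refine this.congr (ae_of_all _ fun t => ?_)
    simp [abs_mul]
  have hval : ∫ t : ℝ, |t| * Real.exp (-t ^ 2) = 1 := by
    have h1 := integral_comp_abs (f := fun t : ℝ => t * Real.exp (-t ^ 2))
    simp only [sq_abs] at h1
    have h2 := integral_mul_cexp_neg_mul_sq (b := 1) (by simp)
    rw [h1]
    have h3 : ∫ t in Set.Ioi (0 : ℝ), (t * Real.exp (-t ^ 2)) = 1 / 2 := by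
      have : ((∫ t in Set.Ioi (0 : ℝ), (t * Real.exp (-t ^ 2)) : ℝ) : ℂ) = ((1 / 2 : ℝ) : ℂ) := by
        rw [← integral_complex_ofReal]
        push_cast
        simpa using h2
      exact_mod_cast this
    rw [h3]; norm_num
  have hlim : ∫ t : ℝ, ((|t| * Real.exp (-t ^ 2) : ℝ) : ℂ) * hankelResidue = hankelResidue := by
    rw [integral_mul_const, integral_complex_ofReal, hval, Complex.ofReal_one, one_mul]
  rw [← hlim]
  have main : Tendsto (fun r : ℝ => ∫ t : ℝ, ((t ^ 2 * Real.exp (-t ^ 2) : ℝ) : ℂ) *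
        (((√r)⁻¹ : ℝ) * hankelAmp ((√r)⁻¹ * t))) (𝓝[>] 0)
      (𝓝 (∫ t : ℝ, ((|t| * Real.exp (-t ^ 2) : ℝ) : ℂ) * hankelResidue)) := by
    refine tendsto_integral_filter_of_dominated_convergence
      (fun t => |t| * Real.exp (-t ^ 2)) ?_ ?_ hint ?_
    · refine Eventually.of_forall fun r => Continuous.aestronglyMeasurable ?_
      have := continuous_hankelAmp
      fun_prop
    · filter_upwards [self_mem_nhdsWithin] with r hr
      have hs : 0 < (√r)⁻¹ := inv_pos.2 (Real.sqrt_pos.2 hr)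
      refine ae_of_all _ fun t => ?_
      rw [norm_mul, Complex.norm_real, Real.norm_of_nonneg (by positivity)]
      rcases eq_or_ne t 0 with rfl | ht
      · simp
      calc _ ≤ t ^ 2 * Real.exp (-t ^ 2) * |t|⁻¹ := by
            gcongr; exact norm_hankelAmp_scaled_le hs ht
        _ = _ := by
            rw [← sq_abs]
            have : |t| ≠ 0 := abs_ne_zero.2 ht
            field_simp
    · have hne : ∀ᵐ t : ℝ, t ≠ 0 := by simp [ae_iff, measure_singleton]
      filter_upwards [hne] with t ht
      have e : ((|t| * Real.exp (-t ^ 2) : ℝ) : ℂ) * hankelResidue =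
          ((t ^ 2 * Real.exp (-t ^ 2) : ℝ) : ℂ) *
            (0 + Complex.I * t ^ 2 : ℂ) ^ ((-(1 / 2) : ℝ) : ℂ) := by
        have h2 : ((t ^ 2 : ℝ) : ℂ) ^ ((-(1 / 2) : ℝ) : ℂ) = ((|t|⁻¹ : ℝ) : ℂ) := by
          rw [← Complex.ofReal_cpow (by positivity), ← sq_abs, ← Real.rpow_natCast,
            ← Real.rpow_mul (abs_nonneg t)]
          norm_num [Real.rpow_neg_one]
        have h3 : (0 + Complex.I * t ^ 2 : ℂ) = ((t ^ 2 : ℝ) : ℂ) * Complex.I := by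
          push_cast; ring
        rw [h3, ofReal_mul_cpow (by positivity) Complex.I_ne_zero, h2, hankelResidue, ← mul_assoc,
          ← Complex.ofReal_mul]
        congr 2
        rw [← sq_abs t]
        have : |t| ≠ 0 := abs_ne_zero.2 ht
        field_simp
      rw [e]
      refine Tendsto.const_mul _ ?_
      have hs : Tendsto (fun r : ℝ => (2 * r + Complex.I * t ^ 2 : ℂ) ^ ((-(1 / 2) : ℝ) : ℂ))
          (𝓝[>] 0) (𝓝 ((0 + Complex.I * t ^ 2 : ℂ) ^ ((-(1 / 2) : ℝ) : ℂ))) := by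
        refine Tendsto.mono_left ?_ nhdsWithin_le_nhds
        have hc : ContinuousAt (fun r : ℝ => (2 * r + Complex.I * t ^ 2 : ℂ)) 0 := by fun_prop
        have := hc.cpow (continuousAt_const (y := ((-(1 / 2) : ℝ) : ℂ))) (by
          right
          simp [← Complex.ofReal_pow, ht])
        simpa [ContinuousAt] using this
      refine hs.congr' ?_
      filter_upwards [self_mem_nhdsWithin] with r hr
      have hr : 0 < r := hr
      rw [hankelAmp_scaled (inv_pos.2 (Real.sqrt_pos.2 hr))]
      congr 2
      rw [← Complex.ofReal_pow, inv_pow, Real.sq_sqrt hr.le]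
      push_cast
      rw [div_inv_eq_mul]
  refine main.congr' ?_
  filter_upwards [self_mem_nhdsWithin] with r hr
  exact (hankelMoment_one_scaled hr).symm

/-- A multiple of the Hankel function `H₀⁽¹⁾`. -/
def hankel (r : ℝ) : ℂ := Complex.exp (Complex.I * r) * hankelMoment 0 r

/-- The derivative of `hankel`. -/
def hankel' (r : ℝ) : ℂ :=
  Complex.exp (Complex.I * r) * (Complex.I * hankelMoment 0 r - hankelMoment 1 r)

lemma hasDerivAt_cexp_I_mul (r : ℝ) :
    HasDerivAt (fun r : ℝ => Complex.exp (Complex.I * r))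
      (Complex.exp (Complex.I * r) * Complex.I) r := by
  simpa using ((hasDerivAt_id r).ofReal_comp.const_mul Complex.I).cexp

lemma hasDerivAt_hankel {r : ℝ} (hr : 0 < r) : HasDerivAt hankel (hankel' r) r := by
  refine ((hasDerivAt_cexp_I_mul r).mul (hasDerivAt_hankelMoment 0 hr)).congr_deriv ?_
  simp only [hankel']; ring

/-- Bessel's equation of order zero, from `hankelMoment_relation` after factoring out e^{ir}. -/
lemma hasDerivAt_hankel' {r : ℝ} (hr : 0 < r) :
    HasDerivAt hankel' (-(hankel' r / r) - hankel r) r := by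
  have hd : HasDerivAt (fun r => Complex.I * hankelMoment 0 r - hankelMoment 1 r)
      (Complex.I * -hankelMoment 1 r - -hankelMoment 2 r) r :=
    ((hasDerivAt_hankelMoment 0 hr).const_mul Complex.I).sub (hasDerivAt_hankelMoment 1 hr)
  refine ((hasDerivAt_cexp_I_mul r).mul hd).congr_deriv ?_
  have hrc : (r : ℂ) ≠ 0 := by exact_mod_cast hr.ne'
  have hrel := hankelMoment_relation hr
  simp only [hankel', hankel]
  field_simp
  linear_combination hrel + r * hankelMoment 0 r * Complex.I_sq

lemma norm_cexp_I_mul (r : ℝ) : ‖Complex.exp (Complex.I * r)‖ = 1 := by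
  rw [mul_comm]; exact Complex.norm_exp_ofReal_mul_I r

/-- Valid for every r > 0, so the same bound gives the decay at infinity and an integrable majorant
of the logarithmic singularity at zero. -/
lemma norm_hankel_le {r : ℝ} (hr : 0 < r) : ‖hankel r‖ ≤ √Real.pi / √r := by
  rw [hankel, norm_mul, norm_cexp_I_mul, one_mul, ← Real.sqrt_div Real.pi_pos.le]
  exact norm_hankelMoment_zero_le hr

lemma norm_hankel'_sub_le {r : ℝ} (hr : 0 < r) :
    ‖hankel' r - Complex.I * hankel r‖ ≤ 2 * √(2 * Real.pi) / (r * √r) := by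
  have : hankel' r - Complex.I * hankel r = -(Complex.exp (Complex.I * r) * hankelMoment 1 r) := by
    simp only [hankel', hankel]; ring
  rw [this, norm_neg, norm_mul, norm_cexp_I_mul, one_mul]
  refine (norm_hankelMoment_one_le hr).trans_eq ?_
  rw [show Real.pi / (r / 2) = 2 * Real.pi / r by field_simp,
    Real.sqrt_div (by positivity), div_mul_div_comm]

lemma tendsto_mul_hankel_zero : Tendsto (fun r : ℝ => (r : ℂ) * hankel r) (𝓝[>] 0) (𝓝 0) := by
  rw [tendsto_zero_iff_norm_tendsto_zero]
  have h : Tendsto (fun r : ℝ => √Real.pi * √r) (𝓝[>] 0) (𝓝 0) := by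
    refine Tendsto.mono_left ?_ nhdsWithin_le_nhds
    have : Continuous fun r : ℝ => √Real.pi * √r := by fun_prop
    simpa using this.tendsto 0
  refine squeeze_zero' (Eventually.of_forall fun _ => norm_nonneg _) ?_ h
  filter_upwards [self_mem_nhdsWithin] with r hr
  have hr : 0 < r := hr
  rw [norm_mul, Complex.norm_real, Real.norm_of_nonneg hr.le]
  refine (mul_le_mul_of_nonneg_left (norm_hankel_le hr) hr.le).trans_eq ?_
  have := Real.mul_self_sqrt hr.le
  have hs : √r ≠ 0 := (Real.sqrt_pos.2 hr).ne'
  field_simp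
  nlinarith

/-- The strength of the logarithmic singularity. It becomes the factor in front of the point value
in Green's representation, so it matters that `hankelResidue` is nonzero. -/
lemma tendsto_mul_hankel' :
    Tendsto (fun r : ℝ => (r : ℂ) * hankel' r) (𝓝[>] 0) (𝓝 (-hankelResidue)) := by
  have h1 := tendsto_mul_hankel_zero.const_mul Complex.I
  have h2 : Tendsto (fun r : ℝ => Complex.exp (Complex.I * r)) (𝓝[>] 0) (𝓝 1) := by
    refine Tendsto.mono_left ?_ nhdsWithin_le_nhds
    have : Continuous fun r : ℝ => Complex.exp (Complex.I * r) := by fun_prop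
    simpa using this.tendsto 0
  have h3 := h1.sub (h2.mul tendsto_mul_hankelMoment_one)
  rw [mul_zero, one_mul, zero_sub] at h3
  refine h3.congr fun r => ?_
  simp only [hankel', hankel]; ring

end

/-! ### Coordinates on the plane and the divergence theorem in the half-plane. -/

noncomputable section

/-- The coordinate parametrization of the plane. -/
def toPlane : (ℝ × ℝ) ≃L[ℝ] Plane :=
  (ContinuousLinearEquiv.finTwoArrow ℝ ℝ).symm.trans (EuclideanSpace.equiv (Fin 2) ℝ).symm

lemma toPlane_apply (p : ℝ × ℝ) : toPlane p = !₂[p.1, p.2] := rfl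

@[simp] lemma toPlane_zero (p : ℝ × ℝ) : toPlane p 0 = p.1 := rfl

@[simp] lemma toPlane_one (p : ℝ × ℝ) : toPlane p 1 = p.2 := rfl

lemma measurePreserving_toPlane : MeasurePreserving toPlane :=
  (PiLp.volume_preserving_toLp (Fin 2)).comp (volume_preserving_finTwoArrow ℝ).symm

lemma measurableEmbedding_toPlane : MeasurableEmbedding toPlane :=
  toPlane.toHomeomorph.measurableEmbedding

/-- The first unit vector. -/
abbrev e₁ : Plane := EuclideanSpace.single 0 1

/-- The second unit vector. -/
abbrev e₂ : Plane := EuclideanSpace.single 1 1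

lemma toPlane_e₁ : toPlane (1, 0) = e₁ := by
  ext i; fin_cases i <;> simp [toPlane_apply]

lemma toPlane_e₂ : toPlane (0, 1) = e₂ := by
  ext i; fin_cases i <;> simp [toPlane_apply]

lemma eq_smul_add_smul (x : Plane) : x = x 0 • e₁ + x 1 • e₂ := by
  ext i; fin_cases i <;> simp

lemma norm_sq_plane (x : Plane) : ‖x‖ ^ 2 = x 0 ^ 2 + x 1 ^ 2 := by
  rw [EuclideanSpace.real_norm_sq_eq, Fin.sum_univ_two]

lemma abs_coord_le (x : Plane) (i : Fin 2) : |x i| ≤ ‖x‖ := PiLp.norm_apply_le x i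

lemma isOpen_upperHalf : IsOpen upperHalf :=
  isOpen_lt continuous_const (EuclideanSpace.proj (𝕜 := ℝ) (1 : Fin 2)).continuous

lemma isClosed_closedUpperHalf : IsClosed closedUpperHalf :=
  isClosed_le continuous_const (EuclideanSpace.proj (𝕜 := ℝ) (1 : Fin 2)).continuous

lemma upperHalf_subset : upperHalf ⊆ closedUpperHalf := fun x (hx : 0 < x 1) => show 0 ≤ x 1 from hx.le

lemma convex_closedUpperHalf : Convex ℝ closedUpperHalf := by
  intro x hx y hy a b ha hb _
  have hx : 0 ≤ x 1 := hx
  have hy : 0 ≤ y 1 := hy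
  change 0 ≤ (a • x + b • y) 1
  simp only [PiLp.add_apply, PiLp.smul_apply, smul_eq_mul]
  positivity

/-- Makes the derivative within the closed half-plane minus P well defined and continuous up to the
boundary. -/
lemma uniqueDiffOn_closedUpperHalf_diff {P : Set Plane} (hP : IsClosed P) :
    UniqueDiffOn ℝ (closedUpperHalf \ P) := by
  refine (uniqueDiffOn_convex convex_closedUpperHalf ?_).inter hP.isOpen_compl
  refine ⟨e₂, interior_mono upperHalf_subset ?_⟩
  rw [isOpen_upperHalf.interior_eq]
  simp [upperHalf]

lemma integrableOn_of_continuousOn {F : Plane → ℂ} (hF : ContinuousOn F closedUpperHalf)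
    {R : ℝ} (hR : ∀ x, R < ‖x‖ → F x = 0) : IntegrableOn F upperHalf := by
  have hK : IsCompact (closedUpperHalf ∩ Metric.closedBall 0 R) :=
    (isCompact_closedBall 0 R).inter_left isClosed_closedUpperHalf
  have h1 : IntegrableOn F (closedUpperHalf ∩ Metric.closedBall 0 R) :=
    (hF.mono Set.inter_subset_left).integrableOn_compact hK
  have h2 : IntegrableOn F closedUpperHalf := by
    refine h1.of_forall_sdiff_eq_zero isClosed_closedUpperHalf.measurableSet fun x hx => ?_
    refine hR x ?_
    by_contra h
    exact hx.2 ⟨hx.1, by simpa using h⟩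
  exact h2.mono_set upperHalf_subset

/-- The divergence theorem on the half-plane, for a compactly supported vector field which is
continuous up to the boundary and differentiable inside. -/
theorem integral_divergence_upperHalf {X Y : Plane → ℂ} {X' Y' : Plane → Plane →L[ℝ] ℂ} {R : ℝ}
    (hX : ContinuousOn X closedUpperHalf) (hY : ContinuousOn Y closedUpperHalf)
    (hXR : ∀ x, R < ‖x‖ → X x = 0) (hYR : ∀ x, R < ‖x‖ → Y x = 0)
    (hX' : ∀ x ∈ upperHalf, HasFDerivAt X (X' x) x)
    (hY' : ∀ x ∈ upperHalf, HasFDerivAt Y (Y' x) x)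
    (hi : IntegrableOn (fun x => X' x e₁ + Y' x e₂) upperHalf) :
    ∫ x in upperHalf, (X' x e₁ + Y' x e₂) = -∫ t : ℝ, Y !₂[t, 0] := by
  -- The box [-M, M] × [0, M] exceeds the support, so the fields vanish on three of its sides and
  -- only the bottom contributes.
  set M : ℝ := max R 0 + 1 with hM
  have hRM : R < M := (le_max_left R 0).trans_lt (lt_add_one _)
  have hM0 : 0 < M := (le_max_right R 0).trans_lt (lt_add_one _)
  have hfar : ∀ x : Plane, M ≤ |x 0| ∨ M ≤ |x 1| → R < ‖x‖ := fun x hx => by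
    rcases hx with h | h
    · exact hRM.trans_le (h.trans (abs_coord_le x 0))
    · exact hRM.trans_le (h.trans (abs_coord_le x 1))
  have hderiv0 : ∀ (Z : Plane → ℂ) (Z' : Plane → Plane →L[ℝ] ℂ),
      (∀ x, R < ‖x‖ → Z x = 0) → (∀ x ∈ upperHalf, HasFDerivAt Z (Z' x) x) →
      ∀ x ∈ upperHalf, R < ‖x‖ → Z' x = 0 := by
    intro Z Z' hZ hZ' x hx hxR
    have h0 : HasFDerivAt Z (0 : Plane →L[ℝ] ℂ) x := by
      refine (hasFDerivAt_const (0 : ℂ) x).congr_of_eventuallyEq ?_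
      filter_upwards [continuous_norm.continuousAt.eventually (lt_mem_nhds hxR)] with y hy
      exact hZ y hy
    exact (hZ' x hx).unique h0
  set h : ℝ × ℝ → ℂ := fun p => X' (toPlane p) e₁ + Y' (toPlane p) e₂ with hh
  have hpre : toPlane ⁻¹' upperHalf = {p : ℝ × ℝ | 0 < p.2} := rfl
  have hmeas : MeasurableSet {p : ℝ × ℝ | 0 < p.2} := measurableSet_lt measurable_const measurable_snd
  have hi' : IntegrableOn h {p : ℝ × ℝ | 0 < p.2} :=
    (measurePreserving_toPlane.integrableOn_comp_preimage measurableEmbedding_toPlane).2 hi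
  have hLHS : ∫ x in upperHalf, (X' x e₁ + Y' x e₂) = ∫ p in {p : ℝ × ℝ | 0 < p.2}, h p :=
    (measurePreserving_toPlane.setIntegral_preimage_emb measurableEmbedding_toPlane
      (fun x => X' x e₁ + Y' x e₂) upperHalf).symm
  set B : Set (ℝ × ℝ) := Set.Icc (-M, 0) (M, M) with hB
  have hae : (B ∩ {p : ℝ × ℝ | 0 < p.2} : Set (ℝ × ℝ)) =ᵐ[volume] B := by
    rw [ae_eq_set, Set.sdiff_eq_empty.2 Set.inter_subset_left]
    refine ⟨measure_empty, ?_⟩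
    have h0 : (volume : Measure (ℝ × ℝ)) (Set.univ ×ˢ {0}) = 0 := by
      rw [Measure.volume_eq_prod, Measure.prod_prod, Real.volume_singleton, mul_zero]
    refine measure_mono_null (fun p hp => Set.mk_mem_prod (Set.mem_univ _) ?_) h0
    have h1 : 0 ≤ p.2 := hp.1.1.2
    by_contra hne
    exact hp.2 ⟨hp.1, lt_of_le_of_ne h1 (Ne.symm hne)⟩
  have hbox : ∫ p in {p : ℝ × ℝ | 0 < p.2}, h p = ∫ p in B, h p := by
    rw [← setIntegral_congr_set hae]
    refine setIntegral_eq_of_subset_of_forall_sdiff_eq_zero hmeas Set.inter_subset_right ?_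
    intro p hp
    have hp2 : 0 < p.2 := hp.1
    have : R < ‖toPlane p‖ := by
      refine hfar _ ?_
      by_contra! hc
      simp only [toPlane_zero, toPlane_one, abs_lt] at hc
      exact hp.2 ⟨⟨⟨hc.1.1.le, hp2.le⟩, ⟨hc.1.2.le, hc.2.2.le⟩⟩, hp2⟩
    simp only [hh]
    rw [hderiv0 X X' hXR hX' _ hp2 this, hderiv0 Y Y' hYR hY' _ hp2 this]
    simp
  rw [hLHS, hbox]
  have hmaps : Set.MapsTo toPlane B closedUpperHalf := fun p hp => hp.1.2
  have key := integral_divergence_prod_Icc_of_hasFDerivAt_of_le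
    (X ∘ toPlane) (Y ∘ toPlane) (fun p => (X' (toPlane p)).comp (toPlane : ℝ × ℝ →L[ℝ] Plane))
    (fun p => (Y' (toPlane p)).comp (toPlane : ℝ × ℝ →L[ℝ] Plane)) (-M, 0) (M, M)
    ⟨by simp only; linarith, hM0.le⟩
    (hX.comp toPlane.continuous.continuousOn hmaps)
    (hY.comp toPlane.continuous.continuousOn hmaps)
    (fun p hp => (hX' _ hp.2.1).comp p toPlane.hasFDerivAt)
    (fun p hp => (hY' _ hp.2.1).comp p toPlane.hasFDerivAt)
    ?_
  · simp only [ContinuousLinearMap.comp_apply, ContinuousLinearEquiv.coe_coe, toPlane_e₁,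
      toPlane_e₂, Function.comp_apply] at key
    rw [key]
    have z1 : ∀ t : ℝ, Y (toPlane (t, M)) = 0 := fun t =>
      hYR _ (hfar _ (Or.inr (by simp [abs_of_pos hM0])))
    have z2 : ∀ t : ℝ, X (toPlane (M, t)) = 0 := fun t =>
      hXR _ (hfar _ (Or.inl (by simp [abs_of_pos hM0])))
    have z3 : ∀ t : ℝ, X (toPlane (-M, t)) = 0 := fun t =>
      hXR _ (hfar _ (Or.inl (by simp [abs_of_pos hM0])))
    simp only [z1, z2, z3, intervalIntegral.integral_zero, zero_sub, add_zero, sub_zero]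
    rw [intervalIntegral.integral_of_le (by linarith)]
    congr 1
    refine setIntegral_eq_integral_of_forall_compl_eq_zero fun t ht => ?_
    refine hYR _ (hfar _ (Or.inl ?_))
    simp only [Set.mem_Ioc, not_and_or, not_lt, not_le] at ht
    change M ≤ |t|
    rcases ht with ht | ht
    · exact le_abs.2 (Or.inr (by linarith))
    · exact le_abs.2 (Or.inl ht.le)
  · simp only [ContinuousLinearMap.comp_apply, ContinuousLinearEquiv.coe_coe, toPlane_e₁,
      toPlane_e₂]
    refine IntegrableOn.congr_set_ae (hi'.mono_set Set.inter_subset_right) hae.symm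

/-! ### Helmholtz solutions regular off a boundary set, and Green's identity. -/

/-- A solution of the Helmholtz equation in the upper half-plane which is `C¹` up to the boundary
off the set `P`, with normal derivative `g` there. -/
structure IsHelmholtzOff (κ : ℝ) (P : Set Plane) (g : ℝ → ℂ) (u : Plane → ℂ) : Prop where
  isClosed : IsClosed P
  disjoint : Disjoint P upperHalf
  contDiffOn_interior : ContDiffOn ℝ 2 u upperHalf
  contDiffOn_boundary : ContDiffOn ℝ 1 u (closedUpperHalf \ P)
  helmholtz : ∀ x ∈ upperHalf, Laplacian.laplacian u x + (κ : ℂ) ^ 2 * u x = 0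
  normal : ∀ t : ℝ, !₂[t, 0] ∉ P → HasVerticalDeriv u (g t) t 0

variable {κ : ℝ} {P Q : Set Plane} {g gu gv : ℝ → ℂ} {u v : Plane → ℂ}

lemma IsHelmholtzOff.mono (hu : IsHelmholtzOff κ P g u) (hPQ : P ⊆ Q) (hQ : IsClosed Q)
    (hd : Disjoint Q upperHalf) : IsHelmholtzOff κ Q g u where
  isClosed := hQ
  disjoint := hd
  contDiffOn_interior := hu.contDiffOn_interior
  contDiffOn_boundary := hu.contDiffOn_boundary.mono (Set.sdiff_subset_sdiff_right hPQ)
  helmholtz := hu.helmholtz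
  normal := fun t ht => hu.normal t fun h => ht (hPQ h)

/-- The derivative up to the boundary. -/
def bdryDeriv (P : Set Plane) (u : Plane → ℂ) (x : Plane) : Plane →L[ℝ] ℂ :=
  fderivWithin ℝ u (closedUpperHalf \ P) x

lemma IsHelmholtzOff.upperHalf_subset (hu : IsHelmholtzOff κ P g u) :
    upperHalf ⊆ closedUpperHalf \ P := fun _ hx =>
  ⟨OpenCavity.upperHalf_subset hx, fun h => Set.disjoint_left.1 hu.disjoint h hx⟩

lemma IsHelmholtzOff.bdryDeriv_eq (hu : IsHelmholtzOff κ P g u) {x : Plane}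
    (hx : x ∈ upperHalf) : bdryDeriv P u x = fderiv ℝ u x :=
  fderivWithin_of_mem_nhds (mem_of_superset (isOpen_upperHalf.mem_nhds hx) hu.upperHalf_subset)

lemma IsHelmholtzOff.continuousOn (hu : IsHelmholtzOff κ P g u) :
    ContinuousOn u (closedUpperHalf \ P) := hu.contDiffOn_boundary.continuousOn

lemma IsHelmholtzOff.continuousOn_bdryDeriv (hu : IsHelmholtzOff κ P g u) :
    ContinuousOn (bdryDeriv P u) (closedUpperHalf \ P) :=
  hu.contDiffOn_boundary.continuousOn_fderivWithin (uniqueDiffOn_closedUpperHalf_diff hu.isClosed)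
    le_rfl

lemma IsHelmholtzOff.differentiableAt (hu : IsHelmholtzOff κ P g u) {x : Plane}
    (hx : x ∈ upperHalf) : DifferentiableAt ℝ u x :=
  (hu.contDiffOn_interior.differentiableOn (by norm_num)).differentiableAt
    (isOpen_upperHalf.mem_nhds hx)

lemma IsHelmholtzOff.hasFDerivAt_fderiv (hu : IsHelmholtzOff κ P g u) {x : Plane}
    (hx : x ∈ upperHalf) (e : Plane) :
    HasFDerivAt (fun y => fderiv ℝ u y e) ((fderiv ℝ (fderiv ℝ u) x).flip e) x := by
  have h : ContDiffAt ℝ 2 u x := hu.contDiffOn_interior.contDiffAt (isOpen_upperHalf.mem_nhds hx)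
  have h2 : DifferentiableAt ℝ (fderiv ℝ u) x :=
    (h.fderiv_right (m := 1) (by norm_num)).differentiableAt (by norm_num)
  exact ((ContinuousLinearMap.apply ℝ ℂ e).hasFDerivAt.comp x h2.hasFDerivAt)

lemma laplacian_plane (u : Plane → ℂ) (x : Plane) :
    Laplacian.laplacian u x = fderiv ℝ (fderiv ℝ u) x e₁ e₁ + fderiv ℝ (fderiv ℝ u) x e₂ e₂ := by
  rw [InnerProductSpace.laplacian_eq_iteratedFDeriv_orthonormalBasis u
    (EuclideanSpace.basisFun (Fin 2) ℝ)]
  simp [Fin.sum_univ_two, iteratedFDeriv_two_apply]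

lemma mem_closedUpperHalf_boundary (t : ℝ) : !₂[t, 0] ∈ closedUpperHalf := by
  simp [closedUpperHalf]

/-- Both sides are one-sided derivatives of u along the same vertical ray; the ray stays off P near
the boundary point because P is closed. -/
lemma IsHelmholtzOff.bdryDeriv_normal (hu : IsHelmholtzOff κ P g u) {t : ℝ} (ht : !₂[t, 0] ∉ P) :
    bdryDeriv P u !₂[t, 0] e₂ = g t := by
  have hmem : !₂[t, 0] ∈ closedUpperHalf \ P := ⟨mem_closedUpperHalf_boundary t, ht⟩
  have h1 : HasFDerivWithinAt u (bdryDeriv P u !₂[t, 0]) (closedUpperHalf \ P) !₂[t, 0] :=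
    (hu.contDiffOn_boundary.differentiableOn (by norm_num) _ hmem).hasFDerivWithinAt
  have hline : HasDerivAt (fun s : ℝ => (!₂[t, s] : Plane)) e₂ 0 := by
    have h := (toPlane : ℝ × ℝ →L[ℝ] Plane).hasFDerivAt.comp_hasDerivAt (0 : ℝ)
      ((hasDerivAt_const (0 : ℝ) t).prodMk (hasDerivAt_id (0 : ℝ)))
    rw [← toPlane_e₂]; exact h
  have hcont : ContinuousAt (fun s : ℝ => (!₂[t, s] : Plane)) 0 := hline.continuousAt
  have hP : ∀ᶠ s in 𝓝[Set.Ici 0] (0 : ℝ), (!₂[t, s] : Plane) ∈ closedUpperHalf \ P := by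
    have h2 : ∀ᶠ s in 𝓝 (0 : ℝ), (!₂[t, s] : Plane) ∈ Pᶜ :=
      hcont.eventually (hu.isClosed.isOpen_compl.mem_nhds ht)
    filter_upwards [self_mem_nhdsWithin, h2.filter_mono nhdsWithin_le_nhds] with s hs hs'
    exact ⟨hs, hs'⟩
  set S : Set ℝ := Set.Ici 0 ∩ {s | (!₂[t, s] : Plane) ∈ closedUpperHalf \ P}
  have hS : S ∈ 𝓝[Set.Ici 0] (0 : ℝ) := inter_mem self_mem_nhdsWithin hP
  have h3 : HasDerivWithinAt (fun s : ℝ => u !₂[t, s]) (bdryDeriv P u !₂[t, 0] e₂) S 0 :=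
    h1.comp_hasDerivWithinAt 0 (hline.hasDerivWithinAt (s := S)) fun s hs => hs.2
  have h4 : HasDerivWithinAt (fun s : ℝ => u !₂[t, s]) (bdryDeriv P u !₂[t, 0] e₂) (Set.Ici 0) 0 :=
    h3.mono_of_mem_nhdsWithin hS
  exact (uniqueDiffWithinAt_Ici (0 : ℝ)).eq_deriv _ h4 (hu.normal t ht)

/-- The cutoff vanishes near P, so the product extends continuously by zero across the exceptional
points. -/
lemma continuousOn_mul_of_disjoint {f η : Plane → ℂ} (hP : IsClosed P)
    (hf : ContinuousOn f (closedUpperHalf \ P)) (hη : Continuous η)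
    (hd : Disjoint (tsupport η) P) : ContinuousOn (fun x => f x * η x) closedUpperHalf := by
  intro x hx
  by_cases hxs : x ∈ tsupport η
  · have hxP : x ∉ P := fun h => Set.disjoint_left.1 hd hxs h
    have h1 : ContinuousWithinAt f closedUpperHalf x :=
      (hf x ⟨hx, hxP⟩).mono_of_mem_nhdsWithin
        (inter_mem self_mem_nhdsWithin (mem_nhdsWithin_of_mem_nhds (hP.isOpen_compl.mem_nhds hxP)))
    exact h1.mul hη.continuousWithinAt
  · have h0 : (fun x => f x * η x) =ᶠ[𝓝 x] fun _ => 0 := by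
      filter_upwards [notMem_tsupport_iff_eventuallyEq.1 hxs] with y hy
      simp [hy]
    exact (continuousAt_const.congr h0.symm).continuousWithinAt

/-- The Wronskian field of `u` and `v` in the direction `e`. -/
def wronskian (u v : Plane → ℂ) (x e : Plane) : ℂ :=
  u x * fderiv ℝ v x e - v x * fderiv ℝ u x e

lemma HasCompactSupport.exists_bound {f : Plane → ℂ} (hf : HasCompactSupport f) :
    ∃ R : ℝ, ∀ x, R < ‖x‖ → f x = 0 := by
  obtain ⟨R, hR⟩ := hf.isCompact.isBounded.subset_closedBall 0
  refine ⟨R, fun x hx => image_eq_zero_of_notMem_tsupport fun h => ?_⟩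
  have := hR h
  rw [mem_closedBall_zero_iff] at this
  linarith

/-- The Wronskian field up to the boundary. -/
def bdryWronskian (P : Set Plane) (u v : Plane → ℂ) (x e : Plane) : ℂ :=
  u x * bdryDeriv P v x e - v x * bdryDeriv P u x e

lemma bdryWronskian_eq (hu : IsHelmholtzOff κ P gu u) (hv : IsHelmholtzOff κ P gv v) {x : Plane}
    (hx : x ∈ upperHalf) (e : Plane) : bdryWronskian P u v x e = wronskian u v x e := by
  rw [bdryWronskian, wronskian, hu.bdryDeriv_eq hx, hv.bdryDeriv_eq hx]

lemma continuousOn_bdryWronskian (hu : IsHelmholtzOff κ P gu u) (hv : IsHelmholtzOff κ P gv v)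
    {e : Plane → Plane} (he : Continuous e) :
    ContinuousOn (fun x => bdryWronskian P u v x (e x)) (closedUpperHalf \ P) :=
  (hu.continuousOn.mul (hv.continuousOn_bdryDeriv.clm_apply he.continuousOn)).sub
    (hv.continuousOn.mul (hu.continuousOn_bdryDeriv.clm_apply he.continuousOn))

/-- **Green's second identity** in the half-plane for two Helmholtz solutions, localized by a
test function vanishing near the exceptional set. -/
theorem green_identity (hu : IsHelmholtzOff κ P gu u) (hv : IsHelmholtzOff κ P gv v)
    {η : Plane → ℂ} (hη : ContDiff ℝ 1 η) (hc : HasCompactSupport η)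
    (hd : Disjoint (tsupport η) P) :
    ∫ x in upperHalf, (wronskian u v x e₁ * fderiv ℝ η x e₁ + wronskian u v x e₂ * fderiv ℝ η x e₂)
      = -∫ t : ℝ, (u !₂[t, 0] * gv t - v !₂[t, 0] * gu t) * η !₂[t, 0] := by
  have hP := hu.isClosed
  obtain ⟨R, hR⟩ := HasCompactSupport.exists_bound hc
  set X : Plane → Plane → ℂ := fun e x => bdryWronskian P u v x e * η x with hX
  have hXc : ∀ e, ContinuousOn (X e) closedUpperHalf := fun e =>
    continuousOn_mul_of_disjoint hP (continuousOn_bdryWronskian hu hv continuous_const)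
      hη.continuous hd
  have hXR : ∀ e x, R < ‖x‖ → X e x = 0 := fun e x hx => by simp [hX, hR x hx]
  set X' : Plane → Plane → Plane →L[ℝ] ℂ := fun e x =>
    wronskian u v x e • fderiv ℝ η x + η x • ((u x • (fderiv ℝ (fderiv ℝ v) x).flip e +
      fderiv ℝ v x e • fderiv ℝ u x) - (v x • (fderiv ℝ (fderiv ℝ u) x).flip e +
      fderiv ℝ u x e • fderiv ℝ v x)) with hX'def
  have hX' : ∀ e, ∀ x ∈ upperHalf, HasFDerivAt (X e) (X' e x) x := by
    intro e x hx
    have h1 := ((((hu.differentiableAt hx).hasFDerivAt.mul (hv.hasFDerivAt_fderiv hx e)).sub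
      ((hv.differentiableAt hx).hasFDerivAt.mul (hu.hasFDerivAt_fderiv hx e))).mul
      ((hη.differentiable (by norm_num)) x).hasFDerivAt)
    refine h1.congr_of_eventuallyEq ?_
    filter_upwards [isOpen_upperHalf.mem_nhds hx] with y hy
    simp only [hX, bdryWronskian_eq hu hv hy e]
    rfl
  -- The κ² terms of uΔv - vΔu cancel, which leaves only the Wronskian against ∇η. No second
  -- derivatives remain, so integrability of the divergence follows from continuity up to the
  -- boundary.
  have hsum : ∀ x ∈ upperHalf, X' e₁ x e₁ + X' e₂ x e₂ =
      wronskian u v x e₁ * fderiv ℝ η x e₁ + wronskian u v x e₂ * fderiv ℝ η x e₂ := by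
    intro x hx
    have h1 := hu.helmholtz x hx
    have h2 := hv.helmholtz x hx
    rw [laplacian_plane] at h1 h2
    simp only [hX'def, add_apply, sub_apply,
      smul_apply, ContinuousLinearMap.flip_apply, smul_eq_mul]
    linear_combination η x * u x * h2 - η x * v x * h1
  have hηe : ∀ e : Plane, Continuous fun x => fderiv ℝ η x e := fun e =>
    (hη.continuous_fderiv (by norm_num)).clm_apply continuous_const
  have hηs : ∀ e : Plane, Disjoint (tsupport fun x => fderiv ℝ η x e) P := fun e =>
    hd.mono_left (tsupport_fderiv_apply_subset ℝ e)
  have hi : IntegrableOn (fun x => X' e₁ x e₁ + X' e₂ x e₂) upperHalf := by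
    have hcont : ∀ e, ContinuousOn (fun x => bdryWronskian P u v x e * fderiv ℝ η x e)
        closedUpperHalf := fun e =>
      continuousOn_mul_of_disjoint hP (continuousOn_bdryWronskian hu hv continuous_const)
        (hηe e) (hηs e)
    have hint : ∀ e, IntegrableOn (fun x => bdryWronskian P u v x e * fderiv ℝ η x e)
        upperHalf := fun e => by
      refine integrableOn_of_continuousOn (hcont e) (R := R) fun x hx => ?_
      have h0 : η =ᶠ[𝓝 x] fun _ => 0 := by
        filter_upwards [continuous_norm.continuousAt.eventually (lt_mem_nhds hx)] with y hy
        exact hR y hy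
      rw [h0.fderiv_eq]
      simp
    refine ((hint e₁).add (hint e₂)).congr_fun (fun x hx => ?_) isOpen_upperHalf.measurableSet
    simp only [Pi.add_apply, hsum x hx, bdryWronskian_eq hu hv hx]
  rw [← setIntegral_congr_fun isOpen_upperHalf.measurableSet hsum,
    integral_divergence_upperHalf (hXc e₁) (hXc e₂) (hXR e₁) (hXR e₂) (hX' e₁) (hX' e₂) hi]
  congr 2 with t
  simp only [hX]
  by_cases ht : (!₂[t, 0] : Plane) ∈ P
  · rw [image_eq_zero_of_notMem_tsupport fun h => Set.disjoint_left.1 hd h ht]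
    simp
  · rw [bdryWronskian, hu.bdryDeriv_normal ht, hv.bdryDeriv_normal ht]

end

/-! ### Radial cutoffs and weighted fluxes. -/

noncomputable section

variable {κ : ℝ} {P : Set Plane} {g gu gv : ℝ → ℂ} {u v : Plane → ℂ}

/-- A smooth radial cutoff: one on the ball of radius `R` and zero off the ball of radius `2R`. -/
def bump (c : Plane) (R : ℝ) (x : Plane) : ℝ := Real.smoothTransition (2 - ‖x - c‖ ^ 2 / R ^ 2)

/-- The weight with `∇ bump = -weight • (x - c)`. -/
def weight (c : Plane) (R : ℝ) (x : Plane) : ℝ :=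
  2 / R ^ 2 * deriv Real.smoothTransition (2 - ‖x - c‖ ^ 2 / R ^ 2)

lemma continuous_deriv_smoothTransition : Continuous (deriv Real.smoothTransition) :=
  (Real.smoothTransition.contDiff (n := 1)).continuous_deriv (by norm_num)

lemma deriv_smoothTransition_nonneg (t : ℝ) : 0 ≤ deriv Real.smoothTransition t :=
  Real.smoothTransition.monotone.deriv_nonneg

lemma deriv_smoothTransition_of_nonpos {t : ℝ} (ht : t ≤ 0) :
    deriv Real.smoothTransition t = 0 := by
  refine IsLocalMin.deriv_eq_zero (Eventually.of_forall fun s => ?_)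
  rw [Real.smoothTransition.zero_of_nonpos ht]
  exact Real.smoothTransition.nonneg s

lemma deriv_smoothTransition_of_one_le {t : ℝ} (ht : 1 ≤ t) :
    deriv Real.smoothTransition t = 0 := by
  refine IsLocalMax.deriv_eq_zero (Eventually.of_forall fun s => ?_)
  rw [Real.smoothTransition.one_of_one_le ht]
  exact Real.smoothTransition.le_one s

/-- Needed for the positivity of `weightMass`, by which the representation formula is divided in the
end. -/
lemma exists_deriv_smoothTransition_pos : ∃ t, 0 < deriv Real.smoothTransition t := by
  by_contra! h
  have h0 : ∀ t, deriv Real.smoothTransition t = 0 := fun t =>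
    le_antisymm (h t) (deriv_smoothTransition_nonneg t)
  have hd : Differentiable ℝ Real.smoothTransition :=
    (Real.smoothTransition.contDiff (n := 1)).differentiable (by norm_num)
  have := is_const_of_deriv_eq_zero hd h0 0 1
  simp at this

lemma bump_nonneg (c : Plane) (R : ℝ) (x : Plane) : 0 ≤ bump c R x :=
  Real.smoothTransition.nonneg _

lemma bump_le_one (c : Plane) (R : ℝ) (x : Plane) : bump c R x ≤ 1 :=
  Real.smoothTransition.le_one _

lemma sq_div_sq_le_one {a R : ℝ} (hR : 0 < R) (ha : 0 ≤ a) (h : a ≤ R) : a ^ 2 / R ^ 2 ≤ 1 := by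
  rw [div_le_one (by positivity)]; gcongr

lemma two_le_sq_div_sq {a R : ℝ} (hR : 0 < R) (h : 2 * R ≤ a) : 2 ≤ a ^ 2 / R ^ 2 := by
  rw [le_div_iff₀ (by positivity)]; nlinarith

lemma bump_eq_one {c : Plane} {R : ℝ} {x : Plane} (hR : 0 < R) (hx : ‖x - c‖ ≤ R) :
    bump c R x = 1 := by
  have := sq_div_sq_le_one hR (norm_nonneg _) hx
  exact Real.smoothTransition.one_of_one_le (by linarith)

lemma bump_eq_zero {c : Plane} {R : ℝ} {x : Plane} (hR : 0 < R) (hx : 2 * R ≤ ‖x - c‖) :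
    bump c R x = 0 := by
  have := two_le_sq_div_sq hR hx
  exact Real.smoothTransition.zero_of_nonpos (by linarith)

lemma contDiff_bump (c : Plane) (R : ℝ) : ContDiff ℝ 1 (bump c R) :=
  Real.smoothTransition.contDiff.comp
    (contDiff_const.sub (((contDiff_id.sub contDiff_const).norm_sq ℝ).div_const _))

lemma contDiff_bump_complex (c : Plane) (R : ℝ) : ContDiff ℝ 1 fun x => (bump c R x : ℂ) :=
  Complex.ofRealCLM.contDiff.comp (contDiff_bump c R)

lemma weight_nonneg (c : Plane) (R : ℝ) (x : Plane) : 0 ≤ weight c R x :=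
  mul_nonneg (by positivity) (deriv_smoothTransition_nonneg _)

lemma continuous_weight (c : Plane) (R : ℝ) : Continuous (weight c R) := by
  have := continuous_deriv_smoothTransition
  unfold weight
  fun_prop

lemma weight_eq_zero_of_le {c : Plane} {R : ℝ} {x : Plane} (hR : 0 < R) (hx : ‖x - c‖ ≤ R) :
    weight c R x = 0 := by
  have := sq_div_sq_le_one hR (norm_nonneg _) hx
  rw [weight, deriv_smoothTransition_of_one_le (by linarith), mul_zero]

lemma weight_eq_zero_of_ge {c : Plane} {R : ℝ} {x : Plane} (hR : 0 < R) (hx : 2 * R ≤ ‖x - c‖) :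
    weight c R x = 0 := by
  have := two_le_sq_div_sq hR hx
  rw [weight, deriv_smoothTransition_of_nonpos (by linarith), mul_zero]

lemma fderiv_bump (c : Plane) (R : ℝ) (x e : Plane) :
    fderiv ℝ (fun x => (bump c R x : ℂ)) x e =
      -((weight c R x : ℂ) * ((inner ℝ (x - c) e : ℝ) : ℂ)) := by
  have h1 : HasFDerivAt (fun x : Plane => 2 - ‖x - c‖ ^ 2 / R ^ 2) _ x :=
    ((((hasFDerivAt_id x).sub_const c).norm_sq).mul_const (R ^ 2)⁻¹).const_sub 2
  have hd : HasDerivAt Real.smoothTransition (deriv Real.smoothTransition (2 - ‖x - c‖ ^ 2 / R ^ 2))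
      (2 - ‖x - c‖ ^ 2 / R ^ 2) :=
    ((Real.smoothTransition.contDiff (n := 1)).differentiable (by norm_num) _).hasDerivAt
  have h2 := Complex.ofRealCLM.hasFDerivAt.comp x (hd.comp_hasFDerivAt x h1)
  have h3 : fderiv ℝ (fun x => (bump c R x : ℂ)) x = _ := h2.fderiv
  rw [h3]
  simp [weight, inner_sub_left]
  ring

/-- The closed annulus carrying `weight c R`. -/
def annulus (c : Plane) (R : ℝ) : Set Plane := {x | R ≤ ‖x - c‖ ∧ ‖x - c‖ ≤ 2 * R}

lemma tsupport_weight_subset (c : Plane) {R : ℝ} (hR : 0 < R) :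
    tsupport (weight c R) ⊆ annulus c R := by
  refine closure_minimal (fun x hx => ?_) ?_
  · constructor
    · by_contra! h
      exact hx (weight_eq_zero_of_le hR h.le)
    · by_contra! h
      exact hx (weight_eq_zero_of_ge hR h.le)
  · have hc : Continuous fun x : Plane => ‖x - c‖ := by fun_prop
    exact (isClosed_le continuous_const hc).inter (isClosed_le hc continuous_const)

lemma integrableOn_weight_mul {f : Plane → ℂ} {c : Plane} {R : ℝ} (hR : 0 < R) (hP : IsClosed P)
    (hd : Disjoint (annulus c R) P) (hf : ContinuousOn f (closedUpperHalf \ P)) :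
    IntegrableOn (fun x => (weight c R x : ℂ) * f x) upperHalf := by
  have hs : tsupport (fun x => (weight c R x : ℂ)) ⊆ annulus c R := by
    refine subset_trans (closure_mono fun x hx => ?_) (tsupport_weight_subset c hR)
    intro h
    exact hx (by simp [h])
  have h := continuousOn_mul_of_disjoint hP hf
    (Complex.continuous_ofReal.comp (continuous_weight c R)) (hd.mono_left hs)
  simp only [Function.comp_apply, mul_comm (f _)] at h
  refine integrableOn_of_continuousOn h (R := ‖c‖ + 2 * R) fun x hx => ?_
  have : ‖x‖ ≤ ‖x - c‖ + ‖c‖ := by simpa using norm_add_le (x - c) c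
  rw [weight_eq_zero_of_ge hR (by linarith)]
  simp

lemma integrableOn_weight_mul_real {f : Plane → ℝ} {c : Plane} {R : ℝ} (hR : 0 < R)
    (hP : IsClosed P) (hd : Disjoint (annulus c R) P) (hf : ContinuousOn f (closedUpperHalf \ P)) :
    IntegrableOn (fun x => weight c R x * f x) upperHalf := by
  have h := integrableOn_weight_mul hR hP hd (Complex.continuous_ofReal.comp_continuousOn hf)
  refine (Integrable.re h).congr (ae_of_all _ fun x => ?_)
  simp

/-- The mass of the weight on the half-plane. -/
def weightMass : ℝ := ∫ x in upperHalf, weight 0 1 x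

lemma integrableOn_weight {c : Plane} {R : ℝ} (hR : 0 < R) :
    IntegrableOn (weight c R) upperHalf := by
  simpa using integrableOn_weight_mul_real (P := ∅) (f := fun _ => 1) hR isClosed_empty
    (Set.disjoint_empty _) continuousOn_const (c := c)

lemma weightMass_pos : 0 < weightMass := by
  rw [weightMass, setIntegral_pos_iff_support_of_nonneg_ae
    (ae_of_all _ (weight_nonneg 0 1)) (integrableOn_weight one_pos)]
  have ho : IsOpen (Function.support (weight 0 1) ∩ upperHalf) :=
    ((continuous_weight 0 1).isOpen_support).inter isOpen_upperHalf
  refine ho.measure_pos _ ?_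
  obtain ⟨t, ht⟩ := exists_deriv_smoothTransition_pos
  have ht1 : t < 1 := by
    by_contra! h
    rw [deriv_smoothTransition_of_one_le h] at ht
    exact lt_irrefl _ ht
  have h2 : 0 < 2 - t := by linarith
  refine ⟨√(2 - t) • e₂, ?_, ?_⟩
  · have hn : ‖√(2 - t) • e₂ - 0‖ ^ 2 = 2 - t := by
      rw [sub_zero, norm_smul, mul_pow, Real.norm_of_nonneg (Real.sqrt_nonneg _),
        Real.sq_sqrt h2.le]
      simp
    simp only [Function.mem_support, weight, hn]
    norm_num
    exact ht.ne'
  · simpa [upperHalf] using h2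

/-- The factor 2/R² in the weight matches the scaling of area in dimension two. The half-plane is
invariant under dilations about c because c lies on the boundary line. -/
lemma integral_weight {c : Plane} (hc : c 1 = 0) {R : ℝ} (hR : 0 < R) :
    ∫ x in upperHalf, weight c R x = weightMass := by
  rw [weightMass, ← integral_indicator isOpen_upperHalf.measurableSet,
    ← integral_indicator isOpen_upperHalf.measurableSet]
  set F : Plane → ℝ := upperHalf.indicator (weight 0 1) with hF
  have h1 : ∀ x, upperHalf.indicator (weight c R) x = R⁻¹ ^ 2 * F (R⁻¹ • (x - c)) := by
    intro x
    have hiff : R⁻¹ • (x - c) ∈ upperHalf ↔ x ∈ upperHalf := by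
      have : 0 < R⁻¹ := inv_pos.2 hR
      simp [upperHalf, hc, this]
    by_cases hx : x ∈ upperHalf
    · rw [hF, Set.indicator_of_mem hx, Set.indicator_of_mem (hiff.2 hx), weight, weight, sub_zero,
        norm_smul, mul_pow, norm_inv, Real.norm_of_nonneg hR.le]
      rw [show (2 : ℝ) - R⁻¹ ^ 2 * ‖x - c‖ ^ 2 / 1 ^ 2 = 2 - ‖x - c‖ ^ 2 / R ^ 2 by field_simp]
      field_simp
    · rw [hF, Set.indicator_of_notMem hx, Set.indicator_of_notMem (fun h => hx (hiff.1 h)), mul_zero]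
  simp_rw [h1]
  rw [integral_const_mul, integral_sub_right_eq_self (fun x => F (R⁻¹ • x)) c,
    Measure.integral_comp_smul]
  simp only [finrank_euclideanSpace, Fintype.card_fin, smul_eq_mul]
  rw [abs_of_nonneg (by positivity)]
  field_simp

/-- The weighted flux of the Wronskian field through circles about `c`. -/
def flux (c : Plane) (R : ℝ) (u v : Plane → ℂ) : ℂ :=
  ∫ x in upperHalf, (weight c R x : ℂ) * wronskian u v x (x - c)

lemma wronskian_smul (u v : Plane → ℂ) (x e : Plane) (a : ℝ) :
    wronskian u v x (a • e) = a * wronskian u v x e := by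
  simp only [wronskian, map_smul, Complex.real_smul]; ring

lemma wronskian_add (u v : Plane → ℂ) (x e f : Plane) :
    wronskian u v x (e + f) = wronskian u v x e + wronskian u v x f := by
  simp only [wronskian, map_add]; ring

lemma wronskian_eq (u v : Plane → ℂ) (x e : Plane) :
    wronskian u v x e = e 0 * wronskian u v x e₁ + e 1 * wronskian u v x e₂ := by
  conv_lhs => rw [eq_smul_add_smul e]
  rw [wronskian_add, wronskian_smul, wronskian_smul]

lemma wronskian_mul_fderiv_bump (u v : Plane → ℂ) (c : Plane) (R : ℝ) (x : Plane) :
    wronskian u v x e₁ * fderiv ℝ (fun x => (bump c R x : ℂ)) x e₁ +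
      wronskian u v x e₂ * fderiv ℝ (fun x => (bump c R x : ℂ)) x e₂ =
      -((weight c R x : ℂ) * wronskian u v x (x - c)) := by
  rw [fderiv_bump, fderiv_bump, wronskian_eq u v x (x - c)]
  simp [EuclideanSpace.inner_single_right]
  ring

lemma integrableOn_weight_mul_wronskian (hu : IsHelmholtzOff κ P gu u)
    (hv : IsHelmholtzOff κ P gv v) {c : Plane} {R : ℝ} (hR : 0 < R)
    (hd : Disjoint (annulus c R) P) :
    IntegrableOn (fun x => (weight c R x : ℂ) * wronskian u v x (x - c)) upperHalf := by
  have h := integrableOn_weight_mul hR hu.isClosed hd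
    (continuousOn_bdryWronskian hu hv (e := fun x => x - c) (by fun_prop))
  refine h.congr_fun (fun x hx => ?_) isOpen_upperHalf.measurableSet
  simp only [bdryWronskian_eq hu hv hx]

lemma hasCompactSupport_bump (c : Plane) {R : ℝ} (hR : 0 < R) :
    HasCompactSupport fun x => (bump c R x : ℂ) := by
  refine HasCompactSupport.intro (isCompact_closedBall c (2 * R)) fun x hx => ?_
  rw [Metric.mem_closedBall, dist_eq_norm, not_le] at hx
  rw [bump_eq_zero hR hx.le, Complex.ofReal_zero]

end

/-! ### Fluxes at infinity and the radiation condition. -/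

noncomputable section

variable {κ : ℝ} {P : Set Plane} {g gu gv : ℝ → ℂ} {u v : Plane → ℂ}

lemma disjoint_annulus_zero {R₀ R : ℝ} (hP : P ⊆ Metric.ball 0 R₀) (hR : R₀ ≤ R) :
    Disjoint (annulus 0 R) P := by
  refine Set.disjoint_left.2 fun x hx hxP => ?_
  have h1 := hP hxP
  have h2 : R ≤ ‖x - 0‖ := hx.1
  rw [mem_ball_zero_iff] at h1
  rw [sub_zero] at h2
  linarith

lemma norm_boundary (t : ℝ) : ‖(!₂[t, 0] : Plane)‖ = |t| := by
  rw [EuclideanSpace.norm_eq, Fin.sum_univ_two]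
  simp [Real.sqrt_sq_eq_abs]

/-- Outside a ball containing the exceptional set and the Neumann data, the flux is independent of
the radius. -/
lemma flux_eq_flux (hu : IsHelmholtzOff κ P gu u) (hv : IsHelmholtzOff κ P gv v) {R₀ R : ℝ}
    (h0 : 0 < R₀) (hR : R₀ ≤ R) (hP : P ⊆ Metric.ball 0 R₀) (hgu : ∀ t, R₀ < |t| → gu t = 0)
    (hgv : ∀ t, R₀ < |t| → gv t = 0) : flux 0 R u v = flux 0 R₀ u v := by
  have hR0 : 0 < R := h0.trans_le hR
  have hzero : ∀ x : Plane, ‖x‖ ≤ R₀ → (bump 0 R x : ℂ) - bump 0 R₀ x = 0 := fun x hx => by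
    rw [bump_eq_one hR0 (by simpa using hx.trans hR), bump_eq_one h0 (by simpa using hx), sub_self]
  -- The difference of the two cutoffs vanishes on the ball of radius R₀, which contains P. The
  -- boundary term drops out too: the cutoff vanishes where |t| ≤ R₀ and the Neumann data vanish
  -- beyond.
  have hd : Disjoint (tsupport fun x => (bump 0 R x : ℂ) - bump 0 R₀ x) P := by
    refine Disjoint.mono_right hP (Disjoint.symm ?_)
    refine Disjoint.closure_right (Set.disjoint_left.2 fun x hx hx' => ?_) Metric.isOpen_ball
    exact hx' (hzero x (mem_ball_zero_iff.1 hx).le)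
  have key := green_identity hu hv ((contDiff_bump_complex 0 R).sub (contDiff_bump_complex 0 R₀))
    ((hasCompactSupport_bump 0 hR0).sub (hasCompactSupport_bump 0 h0)) hd
  have hrhs : ∀ t : ℝ, (u !₂[t, 0] * gv t - v !₂[t, 0] * gu t) *
      ((bump 0 R !₂[t, 0] : ℂ) - bump 0 R₀ !₂[t, 0]) = 0 := by
    intro t
    rcases le_or_gt |t| R₀ with ht | ht
    · rw [hzero _ (by rwa [norm_boundary]), mul_zero]
    · simp [hgu t ht, hgv t ht]
  have hdiff : ∀ (R : ℝ) x, DifferentiableAt ℝ (fun x => (bump 0 R x : ℂ)) x := fun R x =>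
    ((contDiff_bump_complex 0 R).differentiable (by norm_num)) x
  have hlhs : ∀ x, wronskian u v x e₁ *
      fderiv ℝ (fun x => (bump 0 R x : ℂ) - (bump 0 R₀ x : ℂ)) x e₁ +
      wronskian u v x e₂ *
      fderiv ℝ (fun x => (bump 0 R x : ℂ) - (bump 0 R₀ x : ℂ)) x e₂ =
      (weight 0 R₀ x : ℂ) * wronskian u v x (x - 0) -
        (weight 0 R x : ℂ) * wronskian u v x (x - 0) := by
    intro x
    rw [fderiv_fun_sub (hdiff R x) (hdiff R₀ x)]
    simp only [sub_apply]
    linear_combination wronskian_mul_fderiv_bump u v 0 R x - wronskian_mul_fderiv_bump u v 0 R₀ x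
  simp_rw [hlhs] at key
  rw [integral_sub (integrableOn_weight_mul_wronskian hu hv h0 (disjoint_annulus_zero hP le_rfl))
    (integrableOn_weight_mul_wronskian hu hv hR0 (disjoint_annulus_zero hP hR))] at key
  simp_rw [hrhs] at key
  rw [integral_zero, neg_zero, sub_eq_zero] at key
  exact key.symm

/-- As κ is real, the conjugate solves the same equation. The Wronskian of the conjugate of u with u
is the energy flux of u. -/
lemma isHelmholtzOff_conj (hu : IsHelmholtzOff κ P g u) :
    IsHelmholtzOff κ P (fun t => starRingEnd ℂ (g t)) (fun x => starRingEnd ℂ (u x)) where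
  isClosed := hu.isClosed
  disjoint := hu.disjoint
  contDiffOn_interior := Complex.conjCLE.contDiff.comp_contDiffOn hu.contDiffOn_interior
  contDiffOn_boundary := Complex.conjCLE.contDiff.comp_contDiffOn hu.contDiffOn_boundary
  helmholtz := fun x hx => by
    have h1 := (hu.contDiffOn_interior.contDiffAt
      (isOpen_upperHalf.mem_nhds hx)).laplacian_CLM_comp_left (l := (Complex.conjCLE : ℂ →L[ℝ] ℂ))
    have h2 := congrArg (starRingEnd ℂ) (hu.helmholtz x hx)
    rw [map_add, map_mul, map_pow, Complex.conj_ofReal, map_zero] at h2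
    rw [← h2]
    congr 1
  normal := fun t ht =>
    (Complex.conjCLE : ℂ →L[ℝ] ℂ).hasFDerivAt.comp_hasDerivWithinAt 0 (hu.normal t ht)

/-- The defect in the radiation condition. -/
def radDefect (κ : ℝ) (u : Plane → ℂ) (x : Plane) : ℂ :=
  fderiv ℝ u x (‖x‖⁻¹ • x) - Complex.I * κ * u x

lemma Radiating.exists_bound (hu : Radiating κ u) {τ : ℝ} (hτ : 0 < τ) :
    ∃ R : ℝ, ∀ x ∈ upperHalf, R ≤ ‖x‖ → ‖x‖ * ‖radDefect κ u x‖ ^ 2 ≤ τ ^ 2 := by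
  have h1 := (Metric.tendsto_nhds.1 hu) τ hτ
  rw [eventually_inf_principal, eventually_comap] at h1
  obtain ⟨R, hR⟩ := eventually_atTop.1 h1
  refine ⟨R, fun x hx hxR => ?_⟩
  have h2 := hR ‖x‖ hxR x rfl hx
  rw [dist_zero_right, norm_mul, Complex.norm_real, Real.norm_of_nonneg (Real.sqrt_nonneg _)] at h2
  have h3 : (√‖x‖ * ‖radDefect κ u x‖) ^ 2 ≤ τ ^ 2 := by gcongr; exact h2.le
  rwa [mul_pow, Real.sq_sqrt (norm_nonneg x)] at h3

lemma fderiv_self_eq (κ : ℝ) (u : Plane → ℂ) {x : Plane} (hx : x ≠ 0) :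
    fderiv ℝ u x x = ‖x‖ * (Complex.I * κ * u x + radDefect κ u x) := by
  have hn : ‖x‖ ≠ 0 := norm_ne_zero_iff.2 hx
  have hnc : (‖x‖ : ℂ) ≠ 0 := by exact_mod_cast hn
  rw [radDefect, map_smul, Complex.real_smul, Complex.ofReal_inv]
  field_simp
  ring

lemma ne_zero_of_mem_upperHalf {x : Plane} (hx : x ∈ upperHalf) : x ≠ 0 := by
  rintro rfl
  exact lt_irrefl _ (show (0 : ℝ) < (0 : Plane) 1 from hx)

/-- A radiating solution has bounded mean square on large circles. -/
lemma exists_bound_weight_norm_sq (hκ : 0 < κ) (hu : IsHelmholtzOff κ P g u) {R₀ : ℝ}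
    (h0 : 0 < R₀) (hP : P ⊆ Metric.ball 0 R₀) (hg : ∀ t, R₀ < |t| → g t = 0)
    (hrad : Radiating κ u) :
    ∃ B : ℝ, 0 ≤ B ∧ ∃ R₁ : ℝ, ∀ R, R₁ ≤ R →
      ∫ x in upperHalf, weight 0 R x * (‖x‖ * ‖u x‖ ^ 2) ≤ B := by
  have hcu := isHelmholtzOff_conj hu
  obtain ⟨R₂, hR₂⟩ := hrad.exists_bound one_pos
  set E := flux 0 R₀ (fun x => starRingEnd ℂ (u x)) u
  refine ⟨κ⁻¹ * (‖E‖ + κ⁻¹ * weightMass), ?_, max R₀ R₂, fun R hR => ?_⟩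
  · have := weightMass_pos
    positivity
  have hRR₀ : R₀ ≤ R := (le_max_left _ _).trans hR
  have hRR₂ : R₂ ≤ R := (le_max_right _ _).trans hR
  have hR0 : 0 < R := h0.trans_le hRR₀
  have hdis := disjoint_annulus_zero hP hRR₀
  have hflux : flux 0 R (fun x => starRingEnd ℂ (u x)) u = E :=
    flux_eq_flux hcu hu h0 hRR₀ hP (fun t ht => by simp [hg t ht]) hg
  have hi1 := integrableOn_weight_mul_wronskian hcu hu hR0 hdis
  have hi2 : IntegrableOn (fun x => weight 0 R x * (‖x‖ * ‖u x‖ ^ 2)) upperHalf :=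
    integrableOn_weight_mul_real hR0 hu.isClosed hdis
      (continuous_norm.continuousOn.mul (hu.continuousOn.norm.pow 2))
  have hpt : ∀ x ∈ upperHalf, κ * (weight 0 R x * (‖x‖ * ‖u x‖ ^ 2)) ≤
      ((weight 0 R x : ℂ) * wronskian (fun x => starRingEnd ℂ (u x)) u x (x - 0)).im +
        κ⁻¹ * weight 0 R x := by
    intro x hx
    have hw := weight_nonneg 0 R x
    rcases le_or_gt ‖x‖ R with hxR | hxR
    · simp [weight_eq_zero_of_le hR0 (by simpa using hxR : ‖x - 0‖ ≤ R)]
    have hdef := hR₂ x hx (hRR₂.trans hxR.le)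
    have hfc : fderiv ℝ (fun x => starRingEnd ℂ (u x)) x x = starRingEnd ℂ (fderiv ℝ u x x) := by
      have := ((Complex.conjCLE : ℂ →L[ℝ] ℂ).hasFDerivAt.comp x
        (hu.differentiableAt hx).hasFDerivAt).fderiv
      exact congrArg (fun L => L x) this
    -- Up to the radiation defect, the energy flux density is 2κ|x||u|². The total flux does not
    -- depend on R, so it controls the mean square of u.
    have him : ((weight 0 R x : ℂ) * wronskian (fun x => starRingEnd ℂ (u x)) u x (x - 0)).im =
        weight 0 R x * (‖x‖ * (2 * κ * ‖u x‖ ^ 2 +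
          2 * (starRingEnd ℂ (u x) * radDefect κ u x).im)) := by
      rw [sub_zero, wronskian, hfc, fderiv_self_eq κ u (ne_zero_of_mem_upperHalf hx),
        Complex.im_ofReal_mul, ← Complex.normSq_eq_norm_sq, Complex.normSq_apply]
      congr 1
      simp
      ring
    rw [him]
    have h1 : |(starRingEnd ℂ (u x) * radDefect κ u x).im| ≤ ‖u x‖ * ‖radDefect κ u x‖ := by
      refine (Complex.abs_im_le_norm _).trans_eq ?_
      rw [norm_mul, RCLike.norm_conj]
    have h2 := (abs_le.1 h1).1
    set a := ‖u x‖
    set b := ‖radDefect κ u x‖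
    -- Weighted so that the cross term consumes only half of 2κ|u|².
    have h3 : 2 * (a * b) ≤ κ * a ^ 2 + κ⁻¹ * b ^ 2 := by
      have h4 : 0 ≤ κ⁻¹ * (κ * a - b) ^ 2 := by positivity
      have h5 : κ⁻¹ * (κ * a - b) ^ 2 = κ * a ^ 2 + κ⁻¹ * b ^ 2 - 2 * (a * b) := by
        field_simp; ring
      linarith
    have h6 : ‖x‖ * (κ * a ^ 2) ≤ ‖x‖ * (2 * κ * a ^ 2 +
        2 * (starRingEnd ℂ (u x) * radDefect κ u x).im) + κ⁻¹ * (‖x‖ * b ^ 2) := by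
      have h7 : κ * a ^ 2 ≤ (2 * κ * a ^ 2 +
        2 * (starRingEnd ℂ (u x) * radDefect κ u x).im) + κ⁻¹ * b ^ 2 := by linarith
      have := mul_le_mul_of_nonneg_left h7 (norm_nonneg x)
      linarith
    have h8 : κ⁻¹ * (‖x‖ * b ^ 2) ≤ κ⁻¹ * 1 := by
      have : 0 < κ⁻¹ := inv_pos.2 hκ
      gcongr
      linarith
    have h9 := mul_le_mul_of_nonneg_left (h6.trans (add_le_add_right h8 _)) hw
    linarith
  have hint := setIntegral_mono_on (hi2.const_mul κ)
    ((Integrable.im hi1).add ((integrableOn_weight (c := 0) hR0).const_mul κ⁻¹))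
    isOpen_upperHalf.measurableSet hpt
  simp only [Pi.add_apply] at hint
  rw [integral_const_mul, integral_add (Integrable.im hi1)
    ((integrableOn_weight (c := 0) hR0).const_mul κ⁻¹), integral_const_mul,
    integral_weight (by simp) hR0] at hint
  have him : ∫ x in upperHalf, RCLike.im ((weight 0 R x : ℂ) *
      wronskian (fun x => starRingEnd ℂ (u x)) u x (x - 0)) = E.im := by
    rw [integral_im hi1, ← hflux]; rfl
  rw [him] at hint
  have hE : E.im ≤ ‖E‖ := (le_abs_self _).trans (Complex.abs_im_le_norm E)
  rw [le_inv_mul_iff₀ hκ]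
  linarith

/-- The flux between two radiating solutions vanishes at infinity. -/
theorem tendsto_flux_radiating (hκ : 0 < κ) (hu : IsHelmholtzOff κ P gu u)
    (hv : IsHelmholtzOff κ P gv v) {R₀ : ℝ} (h0 : 0 < R₀) (hP : P ⊆ Metric.ball 0 R₀)
    (hgu : ∀ t, R₀ < |t| → gu t = 0) (hgv : ∀ t, R₀ < |t| → gv t = 0)
    (hru : Radiating κ u) (hrv : Radiating κ v) :
    Tendsto (fun R => flux 0 R u v) atTop (𝓝 0) := by
  obtain ⟨B₁, hB₁, R₁, hR₁⟩ := exists_bound_weight_norm_sq hκ hu h0 hP hgu hru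
  obtain ⟨B₂, hB₂, R₂, hR₂⟩ := exists_bound_weight_norm_sq hκ hv h0 hP hgv hrv
  have hm := weightMass_pos
  rw [Metric.tendsto_nhds]
  intro δ hδ
  -- Chosen so that the final bound, at most τ(B₁ + B₂ + `weightMass`), equals δ/2.
  set τ : ℝ := δ / (2 * (B₁ + B₂ + weightMass)) with hτdef
  have hden : 0 < B₁ + B₂ + weightMass := by positivity
  have hτ : 0 < τ := by positivity
  obtain ⟨R₃, hR₃⟩ := hru.exists_bound hτ
  obtain ⟨R₄, hR₄⟩ := hrv.exists_bound hτ
  filter_upwards [eventually_ge_atTop R₀, eventually_ge_atTop R₁, eventually_ge_atTop R₂,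
    eventually_ge_atTop R₃, eventually_ge_atTop R₄] with R hRR₀ hRR₁ hRR₂ hRR₃ hRR₄
  have hR0 : 0 < R := h0.trans_le hRR₀
  have hdis := disjoint_annulus_zero hP hRR₀
  have hi : ∀ {g : ℝ → ℂ} {u : Plane → ℂ}, IsHelmholtzOff κ P g u →
      IntegrableOn (fun x => weight 0 R x * (‖x‖ * ‖u x‖ ^ 2)) upperHalf := fun hu =>
    integrableOn_weight_mul_real hR0 hu.isClosed hdis
      (continuous_norm.continuousOn.mul (hu.continuousOn.norm.pow 2))
  have hpt : ∀ x ∈ upperHalf, ‖(weight 0 R x : ℂ) * wronskian u v x (x - 0)‖ ≤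
      τ / 2 * (weight 0 R x * (‖x‖ * ‖u x‖ ^ 2)) + τ / 2 * (weight 0 R x * (‖x‖ * ‖v x‖ ^ 2)) +
        τ * weight 0 R x := by
    intro x hx
    have hw := weight_nonneg 0 R x
    rcases le_or_gt ‖x‖ R with hxR | hxR
    · simp [weight_eq_zero_of_le hR0 (by simpa using hxR : ‖x - 0‖ ≤ R)]
    have hx0 := ne_zero_of_mem_upperHalf hx
    have h1 := hR₃ x hx (hRR₃.trans hxR.le)
    have h2 := hR₄ x hx (hRR₄.trans hxR.le)
    -- The leading terms iκuv cancel, so every remaining term carries a radiation defect.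
    have hW : wronskian u v x (x - 0) =
        ‖x‖ * (u x * radDefect κ v x - v x * radDefect κ u x) := by
      rw [sub_zero, wronskian, fderiv_self_eq κ u hx0, fderiv_self_eq κ v hx0]; ring
    have amgm : ∀ a b : ℝ, ‖x‖ * b ^ 2 ≤ τ ^ 2 →
        ‖x‖ * (a * b) ≤ τ / 2 * (‖x‖ * a ^ 2) + τ / 2 := by
      intro a b hb
      have h4 : 0 ≤ ‖x‖ * (τ * a - b) ^ 2 := by positivity
      have h5 : τ * (‖x‖ * (a * b)) ≤ τ * (τ / 2 * (‖x‖ * a ^ 2) + τ / 2) := by nlinarith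
      exact le_of_mul_le_mul_left h5 hτ
    have h3 := amgm ‖u x‖ _ h2
    have h4 := amgm ‖v x‖ _ h1
    rw [hW, norm_mul, norm_mul, Complex.norm_real, Complex.norm_real, Real.norm_of_nonneg hw,
      Real.norm_of_nonneg (norm_nonneg x)]
    calc _ ≤ weight 0 R x * (‖x‖ * (‖u x‖ * ‖radDefect κ v x‖ + ‖v x‖ * ‖radDefect κ u x‖)) := by
          gcongr
          refine (norm_sub_le _ _).trans_eq ?_
          rw [norm_mul, norm_mul]
      _ ≤ weight 0 R x * ((τ / 2 * (‖x‖ * ‖u x‖ ^ 2) + τ / 2) +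
            (τ / 2 * (‖x‖ * ‖v x‖ ^ 2) + τ / 2)) := by
          gcongr; rw [mul_add]; exact add_le_add h3 h4
      _ = _ := by ring
  have hiw := integrableOn_weight (c := 0) hR0
  have hint := norm_integral_le_of_norm_le
    ((((hi hu).const_mul (τ / 2)).add ((hi hv).const_mul (τ / 2))).add (hiw.const_mul τ))
    ((ae_restrict_iff' isOpen_upperHalf.measurableSet).2 (ae_of_all _ hpt))
  have hsum : ∫ x in upperHalf, (τ / 2 * (weight 0 R x * (‖x‖ * ‖u x‖ ^ 2)) +
      τ / 2 * (weight 0 R x * (‖x‖ * ‖v x‖ ^ 2)) + τ * weight 0 R x) =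
      τ / 2 * (∫ x in upperHalf, weight 0 R x * (‖x‖ * ‖u x‖ ^ 2)) +
      τ / 2 * (∫ x in upperHalf, weight 0 R x * (‖x‖ * ‖v x‖ ^ 2)) + τ * weightMass := by
    rw [integral_add (by exact ((hi hu).const_mul (τ / 2)).add ((hi hv).const_mul (τ / 2)))
      (hiw.const_mul τ), integral_add ((hi hu).const_mul (τ / 2)) ((hi hv).const_mul (τ / 2)),
      integral_const_mul, integral_const_mul, integral_const_mul, integral_weight (by simp) hR0]
  simp only [Pi.add_apply] at hint
  rw [hsum] at hint
  have hb1 := mul_le_mul_of_nonneg_left (hR₁ R hRR₁) (half_pos hτ).le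
  have hb2 := mul_le_mul_of_nonneg_left (hR₂ R hRR₂) (half_pos hτ).le
  rw [dist_zero_right]
  have hfin : τ * (B₁ + B₂ + weightMass) = δ / 2 := by rw [hτdef]; field_simp
  have hB1' : 0 ≤ τ * B₁ := by positivity
  have hB2' : 0 ≤ τ * B₂ := by positivity
  refine (hint.trans (by linarith : _ ≤ δ / 2)).trans_lt (half_lt_self hδ)

end

/-! ### The point source with its pole on the boundary. -/

noncomputable section

variable {κ : ℝ} {P : Set Plane} {g gu gv : ℝ → ℂ} {u v : Plane → ℂ}

/-- The Laplacian computed from explicit first and second derivatives. -/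
lemma laplacian_eq_of_hasFDerivAt {x : Plane} (hu : ContDiffAt ℝ 2 u x) {D : Plane → Plane → ℂ}
    {D' : Plane → Plane →L[ℝ] ℂ} (hD : ∀ e, ∀ᶠ y in 𝓝 x, fderiv ℝ u y e = D e y)
    (hD' : ∀ e, HasFDerivAt (D e) (D' e) x) :
    Laplacian.laplacian u x = D' e₁ e₁ + D' e₂ e₂ := by
  have h2 : DifferentiableAt ℝ (fderiv ℝ u) x :=
    (hu.fderiv_right (m := 1) (by norm_num)).differentiableAt (by norm_num)
  have h3 : ∀ e, fderiv ℝ (fderiv ℝ u) x e e = D' e e := fun e => by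
    have h4 : HasFDerivAt (fun y => fderiv ℝ u y e) ((fderiv ℝ (fderiv ℝ u) x).flip e) x :=
      (ContinuousLinearMap.apply ℝ ℂ e).hasFDerivAt.comp x h2.hasFDerivAt
    have h5 := h4.unique ((hD' e).congr_of_eventuallyEq (hD e))
    rw [← h5, ContinuousLinearMap.flip_apply]
  rw [laplacian_plane, h3, h3]

/-- The radial fundamental solution as a function of the squared distance. -/
def radialSq (κ q : ℝ) : ℂ := hankel (κ * √q)

/-- The derivative of `radialSq`. -/
def radialSq' (κ q : ℝ) : ℂ := hankel' (κ * √q) * (κ / (2 * √q) : ℝ)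

lemma hasDerivAt_const_mul_sqrt (κ : ℝ) {q : ℝ} (hq : 0 < q) :
    HasDerivAt (fun q => κ * √q) (κ / (2 * √q)) q := by
  refine ((Real.hasDerivAt_sqrt hq.ne').const_mul κ).congr_deriv ?_
  ring

lemma hasDerivAt_radialSq (hκ : 0 < κ) {q : ℝ} (hq : 0 < q) :
    HasDerivAt (radialSq κ) (radialSq' κ q) q := by
  have hr : 0 < κ * √q := mul_pos hκ (Real.sqrt_pos.2 hq)
  refine ((hasDerivAt_hankel hr).scomp q (hasDerivAt_const_mul_sqrt κ hq)).congr_deriv ?_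
  rw [radialSq', Complex.real_smul, mul_comm]

/-- Bessel's equation in the variable q = r². In the plane the Laplacian of f(|x|²) is 4qf'' + 4f',
so this is the radial Helmholtz equation, without derivatives of the norm. -/
lemma hasDerivAt_radialSq' (hκ : 0 < κ) {q : ℝ} (hq : 0 < q) :
    HasDerivAt (radialSq' κ) (-(radialSq' κ q / q) - κ ^ 2 * radialSq κ q / (4 * q)) q := by
  have hs : 0 < √q := Real.sqrt_pos.2 hq
  have hr : 0 < κ * √q := mul_pos hκ hs
  have h1 := (hasDerivAt_hankel' hr).scomp q (hasDerivAt_const_mul_sqrt κ hq)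
  have h2 : HasDerivAt (fun q => κ / (2 * √q)) (-(κ * (2 * (1 / (2 * √q)))) / (2 * √q) ^ 2) q := by
    have := (hasDerivAt_const q κ).div ((Real.hasDerivAt_sqrt hq.ne').const_mul 2) (by positivity)
    exact this.congr_deriv (by simp)
  refine (h1.mul h2.ofReal_comp).congr_deriv ?_
  have hqq : ((√q : ℝ) : ℂ) ^ 2 = q := by exact_mod_cast Real.sq_sqrt hq.le
  have hκc : (κ : ℂ) ≠ 0 := by exact_mod_cast hκ.ne'
  have hsc : ((√q : ℝ) : ℂ) ≠ 0 := by exact_mod_cast hs.ne'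
  simp only [Complex.real_smul, radialSq', radialSq, Function.comp_apply]
  rw [← hqq]
  push_cast
  field_simp
  ring

lemma contDiffOn_radialSq (hκ : 0 < κ) : ContDiffOn ℝ 2 (radialSq κ) (Set.Ioi 0) := by
  have h1 : ContDiffOn ℝ 1 (radialSq' κ) (Set.Ioi 0) := by
    rw [show (1 : WithTop ℕ∞) = 0 + 1 by norm_num, contDiffOn_succ_iff_deriv_of_isOpen isOpen_Ioi]
    refine ⟨fun q hq => (hasDerivAt_radialSq' hκ hq).differentiableAt.differentiableWithinAt,
      by simp, contDiffOn_zero.2 ?_⟩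
    have hc : ContinuousOn (fun q : ℝ => -(radialSq' κ q / q) - κ ^ 2 * radialSq κ q / (4 * q))
        (Set.Ioi 0) := by
      intro q hq
      have hq0 : (q : ℂ) ≠ 0 := by exact_mod_cast (ne_of_gt hq)
      have hq4 : (4 * q : ℂ) ≠ 0 := mul_ne_zero (by norm_num) hq0
      have hA := (hasDerivAt_radialSq' hκ hq).continuousAt
      have hB := (hasDerivAt_radialSq hκ hq).continuousAt
      have hid : ContinuousAt (fun q : ℝ => (q : ℂ)) q := by fun_prop
      exact (((hA.div hid hq0).neg).sub ((continuousAt_const.mul hB).div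
        (continuousAt_const.mul hid) hq4)).continuousWithinAt
    exact hc.congr fun q hq => (hasDerivAt_radialSq' hκ hq).deriv
  rw [show (2 : WithTop ℕ∞) = 1 + 1 by norm_num, contDiffOn_succ_iff_deriv_of_isOpen isOpen_Ioi]
  refine ⟨fun q hq => (hasDerivAt_radialSq hκ hq).differentiableAt.differentiableWithinAt,
    by simp, h1.congr fun q hq => (hasDerivAt_radialSq hκ hq).deriv⟩

/-- The point source solution with pole `p`. -/
def pointSource (κ : ℝ) (p x : Plane) : ℂ := radialSq κ (‖x - p‖ ^ 2)

lemma pointSource_eq (κ : ℝ) (p x : Plane) : pointSource κ p x = hankel (κ * ‖x - p‖) := by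
  rw [pointSource, radialSq, Real.sqrt_sq (norm_nonneg _)]

lemma norm_sub_sq_pos {x p : Plane} (h : x ≠ p) : 0 < ‖x - p‖ ^ 2 :=
  pow_pos (norm_pos_iff.2 (sub_ne_zero.2 h)) 2

lemma hasFDerivAt_norm_sub_sq (p x : Plane) :
    HasFDerivAt (fun x : Plane => ‖x - p‖ ^ 2) ((2 : ℝ) • innerSL ℝ (x - p)) x := by
  have := ((hasFDerivAt_id x).sub_const p).norm_sq
  refine this.congr_fderiv ?_
  ext e
  simp [two_smul]

lemma contDiffOn_pointSource (hκ : 0 < κ) (p : Plane) : ContDiffOn ℝ 2 (pointSource κ p) {p}ᶜ :=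
  (contDiffOn_radialSq hκ).comp ((contDiff_id.sub contDiff_const).norm_sq ℝ).contDiffOn
    fun _ hx => norm_sub_sq_pos hx

lemma fderiv_pointSource (hκ : 0 < κ) {p x : Plane} (hx : x ≠ p) (e : Plane) :
    fderiv ℝ (pointSource κ p) x e =
      radialSq' κ (‖x - p‖ ^ 2) * ((2 * inner ℝ (x - p) e : ℝ) : ℂ) := by
  have h := (hasDerivAt_radialSq hκ (norm_sub_sq_pos hx)).hasFDerivAt.comp x
    (hasFDerivAt_norm_sub_sq p x)
  have h' : fderiv ℝ (pointSource κ p) x = _ := h.fderiv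
  rw [h']
  simp [inner_sub_left]
  ring

lemma fderiv_pointSource' (hκ : 0 < κ) {p x : Plane} (hx : x ≠ p) (e : Plane) :
    fderiv ℝ (pointSource κ p) x e =
      κ * hankel' (κ * ‖x - p‖) * ((inner ℝ (x - p) e / ‖x - p‖ : ℝ) : ℂ) := by
  have hn : ‖x - p‖ ≠ 0 := norm_ne_zero_iff.2 (sub_ne_zero.2 hx)
  have hnc : (‖x - p‖ : ℂ) ≠ 0 := by exact_mod_cast hn
  rw [fderiv_pointSource hκ hx, radialSq', Real.sqrt_sq (norm_nonneg _)]
  push_cast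
  field_simp

lemma helmholtz_pointSource (hκ : 0 < κ) {p x : Plane} (hx : x ≠ p) :
    Laplacian.laplacian (pointSource κ p) x + (κ : ℂ) ^ 2 * pointSource κ p x = 0 := by
  have hq := norm_sub_sq_pos hx
  have hcd : ContDiffAt ℝ 2 (pointSource κ p) x :=
    (contDiffOn_pointSource hκ p).contDiffAt (isOpen_compl_singleton.mem_nhds hx)
  have hinner : ∀ e : Plane, HasFDerivAt (fun y : Plane => (2 * inner ℝ (y - p) e : ℝ))
      ((2 : ℝ) • innerSL ℝ e) x := fun e => by
    have h1 := ((innerSL ℝ e).hasFDerivAt (x := x - p)).comp x ((hasFDerivAt_id x).sub_const p)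
    have h2 := h1.const_mul 2
    refine (h2.congr_of_eventuallyEq (Eventually.of_forall fun y => ?_)).congr_fderiv ?_
    · simp [real_inner_comm e]
    · ext z; simp
  have hD' := fun e => ((hasDerivAt_radialSq' hκ hq).hasFDerivAt.comp x
    (hasFDerivAt_norm_sub_sq p x)).mul (Complex.ofRealCLM.hasFDerivAt.comp x (hinner e))
  rw [laplacian_eq_of_hasFDerivAt hcd
    (D := fun e y => radialSq' κ (‖y - p‖ ^ 2) * ((2 * inner ℝ (y - p) e : ℝ) : ℂ))
    (fun e => by
      filter_upwards [isOpen_compl_singleton.mem_nhds hx] with y hy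
      exact fderiv_pointSource hκ hy e) hD']
  have hns : ((‖x - p‖ : ℝ) : ℂ) ^ 2 = ((x 0 - p 0 : ℝ) : ℂ) ^ 2 + ((x 1 - p 1 : ℝ) : ℂ) ^ 2 := by
    have := norm_sq_plane (x - p)
    simp only [PiLp.sub_apply] at this
    exact_mod_cast this
  have hqc : ((‖x - p‖ : ℝ) : ℂ) ≠ 0 := by
    exact_mod_cast norm_ne_zero_iff.2 (sub_ne_zero.2 hx)
  simp [EuclideanSpace.inner_single_right, pointSource]
  field_simp
  push_cast at hns
  linear_combination (4 * (4 * radialSq' κ (‖x - p‖ ^ 2) + κ ^ 2 * radialSq κ (‖x - p‖ ^ 2))) * hns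

/-- The boundary point with abscissa `y`. -/
abbrev bdryPt (y : ℝ) : Plane := !₂[y, 0]

lemma bdryPt_notMem_upperHalf (y : ℝ) : bdryPt y ∉ upperHalf := by simp [upperHalf]

lemma isHelmholtzOff_pointSource (hκ : 0 < κ) (y : ℝ) :
    IsHelmholtzOff κ {bdryPt y} 0 (pointSource κ (bdryPt y)) where
  isClosed := isClosed_singleton
  disjoint := Set.disjoint_singleton_left.2 (bdryPt_notMem_upperHalf y)
  contDiffOn_interior := (contDiffOn_pointSource hκ _).mono fun x hx h =>
    bdryPt_notMem_upperHalf y (by rw [Set.mem_singleton_iff.1 h] at hx; exact hx)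
  contDiffOn_boundary := ((contDiffOn_pointSource hκ _).of_le (by norm_num)).mono fun x hx => hx.2
  helmholtz := fun x hx => helmholtz_pointSource hκ fun h =>
    bdryPt_notMem_upperHalf y (by rw [h] at hx; exact hx)
  -- The pole lies on the boundary line, so the source is even in x₂: the derivative of (t - y)² +
  -- s² vanishes at s = 0.
  normal := fun t ht => by
    have hne : t - y ≠ 0 := fun h => ht (by rw [sub_eq_zero.1 h]; rfl)
    have hq : 0 < (t - y) ^ 2 + (0 : ℝ) ^ 2 := by positivity
    have h1 : HasDerivAt (fun s : ℝ => (t - y) ^ 2 + s ^ 2) 0 0 := by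
      simpa using (hasDerivAt_pow 2 (0 : ℝ)).const_add ((t - y) ^ 2)
    have h2 := (hasDerivAt_radialSq hκ hq).scomp 0 h1
    rw [zero_smul] at h2
    refine (h2.congr_of_eventuallyEq (Eventually.of_forall fun s => ?_)).hasDerivWithinAt
    simp only [pointSource, Function.comp_apply, norm_sq_plane]
    simp

lemma radiating_pointSource (hκ : 0 < κ) (y : ℝ) : Radiating κ (pointSource κ (bdryPt y)) := by
  set p := bdryPt y with hp
  set C₁ := √Real.pi
  set C₂ := 2 * √(2 * Real.pi)
  set K := √2 * κ * (C₂ / (κ * √κ) + C₁ / √κ * ‖p‖ ^ 2)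
  have hlim : Tendsto (fun x : Plane => 2 * K * ‖x‖⁻¹) (comap norm atTop ⊓ 𝓟 upperHalf) (𝓝 0) := by
    have h1 : Tendsto (fun x : Plane => ‖x‖⁻¹) (comap norm atTop) (𝓝 0) :=
      tendsto_inv_atTop_zero.comp tendsto_comap
    simpa using (h1.mono_left inf_le_left).const_mul (2 * K)
  refine squeeze_zero_norm' ?_ hlim
  have hev : ∀ᶠ x : Plane in comap norm atTop ⊓ 𝓟 upperHalf, max 1 (2 * ‖p‖) ≤ ‖x‖ :=
    (tendsto_comap.eventually (eventually_ge_atTop _)).filter_mono inf_le_left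
  have hup : ∀ᶠ x : Plane in comap norm atTop ⊓ 𝓟 upperHalf, x ∈ upperHalf :=
    mem_inf_of_right (mem_principal_self _)
  filter_upwards [hev, hup] with x hx hxu
  have hx1 : 1 ≤ ‖x‖ := (le_max_left _ _).trans hx
  have hxp : 2 * ‖p‖ ≤ ‖x‖ := (le_max_right _ _).trans hx
  have hxne : x ≠ p := fun h => bdryPt_notMem_upperHalf y (by rw [← hp, ← h]; exact hxu)
  set r := ‖x - p‖ with hr
  have hr0 : 0 < r := norm_pos_iff.2 (sub_ne_zero.2 hxne)
  have hx0 : 0 < ‖x‖ := by linarith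
  have hrx : ‖x‖ ≤ 2 * r := by
    have := norm_sub_norm_le x p
    linarith
  have hinner : 2 * inner ℝ (x - p) x = r ^ 2 + ‖x‖ ^ 2 - ‖p‖ ^ 2 := by
    have h1 := norm_sub_sq_real x p
    rw [inner_sub_left, real_inner_self_eq_norm_sq, hr, h1, real_inner_comm p x]
    ring
  set c : ℝ := inner ℝ (x - p) (‖x‖⁻¹ • x) / r with hc
  have hceq : c = inner ℝ (x - p) x / (r * ‖x‖) := by
    rw [hc, inner_smul_right]; field_simp
  have hc1 : |c| ≤ 1 := by
    rw [hceq, abs_div, abs_of_pos (mul_pos hr0 hx0)]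
    exact div_le_one_of_le₀ (abs_real_inner_le_norm _ _) (by positivity)
  -- Here c is the cosine of the angle between x - p and x. The identity 2(r|x| - ⟨x - p, x⟩) = |p|²
  -- - (r - |x|)² shows that radial directions from p and from the origin agree to second order at
  -- infinity.
  have hc2 : |1 - c| ≤ ‖p‖ ^ 2 / (r * ‖x‖) := by
    rw [abs_of_nonneg (by linarith [(abs_le.1 hc1).2]), hceq,
      show 1 - inner ℝ (x - p) x / (r * ‖x‖) = (r * ‖x‖ - inner ℝ (x - p) x) / (r * ‖x‖) by
        field_simp]
    gcongr
    nlinarith [sq_nonneg (r - ‖x‖), sq_nonneg ‖p‖]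
  have hκr : 0 < κ * r := mul_pos hκ hr0
  have hdef : fderiv ℝ (pointSource κ p) x (‖x‖⁻¹ • x) - Complex.I * κ * pointSource κ p x =
      κ * ((hankel' (κ * r) - Complex.I * hankel (κ * r)) * c -
        Complex.I * hankel (κ * r) * ((1 - c : ℝ) : ℂ)) := by
    rw [fderiv_pointSource' hκ hxne, pointSource_eq, ← hr, ← hc]
    push_cast; ring
  have hnorm : ‖fderiv ℝ (pointSource κ p) x (‖x‖⁻¹ • x) - Complex.I * κ * pointSource κ p x‖ ≤
      κ * (C₂ / (κ * r * √(κ * r)) + C₁ / √(κ * r) * (‖p‖ ^ 2 / (r * ‖x‖))) := by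
    rw [hdef, norm_mul, Complex.norm_real, Real.norm_of_nonneg hκ.le]
    gcongr
    refine (norm_sub_le _ _).trans (add_le_add ?_ ?_)
    · rw [norm_mul, Complex.norm_real, Real.norm_eq_abs]
      calc _ ≤ C₂ / (κ * r * √(κ * r)) * 1 := by
            gcongr
            exact norm_hankel'_sub_le hκr
        _ = _ := mul_one _
    · rw [norm_mul, norm_mul, Complex.norm_I, one_mul, Complex.norm_real, Real.norm_eq_abs]
      gcongr
      exact norm_hankel_le hκr
  rw [norm_mul, Complex.norm_real, Real.norm_of_nonneg (Real.sqrt_nonneg _)]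
  have hsq : √‖x‖ ≤ √2 * √r := by
    rw [← Real.sqrt_mul (by norm_num)]; exact Real.sqrt_le_sqrt hrx
  have hsκ : 0 < √κ := Real.sqrt_pos.2 hκ
  have hsr : 0 < √r := Real.sqrt_pos.2 hr0
  calc _ ≤ (√2 * √r) * (κ * (C₂ / (κ * r * √(κ * r)) + C₁ / √(κ * r) * (‖p‖ ^ 2 / (r * ‖x‖)))) := by
        gcongr
    _ ≤ (√2 * √r) * (κ * (C₂ / (κ * r * √(κ * r)) + C₁ / √(κ * r) * (‖p‖ ^ 2 / (r * 1)))) := by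
        gcongr
    _ = K * r⁻¹ := by
        rw [Real.sqrt_mul hκ.le]
        simp only [K]
        field_simp
    _ ≤ K * (2 * ‖x‖⁻¹) := by
        have hK : 0 ≤ K := by positivity
        gcongr
        rw [inv_le_iff_one_le_mul₀ hr0]
        field_simp
        linarith
    _ = _ := by ring

lemma tendsto_norm_sub_nhdsGT (p : Plane) :
    Tendsto (fun x : Plane => ‖x - p‖) (𝓝[≠] p) (𝓝[>] 0) := by
  refine tendsto_nhdsWithin_iff.2 ⟨?_, ?_⟩
  · have : Continuous fun x : Plane => ‖x - p‖ := by fun_prop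
    simpa using (this.tendsto p).mono_left nhdsWithin_le_nhds
  · filter_upwards [self_mem_nhdsWithin] with x hx
    exact norm_pos_iff.2 (sub_ne_zero.2 hx)

lemma tendsto_const_mul_nhdsGT (hκ : 0 < κ) : Tendsto (fun r => κ * r) (𝓝[>] 0) (𝓝[>] 0) := by
  refine tendsto_nhdsWithin_iff.2 ⟨?_, ?_⟩
  · have : Continuous fun r => κ * r := by fun_prop
    simpa using (this.tendsto 0).mono_left nhdsWithin_le_nhds
  · filter_upwards [self_mem_nhdsWithin] with r hr
    exact mul_pos hκ hr

/-- The derivative along x - p is κr times `hankel'` at κr, with r = |x - p|, so the limit is that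
of `tendsto_mul_hankel'`. -/
lemma tendsto_fderiv_pointSource (hκ : 0 < κ) (p : Plane) :
    Tendsto (fun x => fderiv ℝ (pointSource κ p) x (x - p)) (𝓝[≠] p) (𝓝 (-hankelResidue)) := by
  refine (tendsto_mul_hankel'.comp ((tendsto_const_mul_nhdsGT hκ).comp
    (tendsto_norm_sub_nhdsGT p))).congr' ?_
  filter_upwards [self_mem_nhdsWithin] with x hx
  have hn : ‖x - p‖ ≠ 0 := norm_ne_zero_iff.2 (sub_ne_zero.2 hx)
  rw [fderiv_pointSource' hκ hx, real_inner_self_eq_norm_sq, sq, mul_self_div_self]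
  simp only [Function.comp_apply]
  push_cast; ring

lemma tendsto_norm_mul_pointSource (hκ : 0 < κ) (p : Plane) :
    Tendsto (fun x => (‖x - p‖ : ℂ) * pointSource κ p x) (𝓝[≠] p) (𝓝 0) := by
  have h := (tendsto_mul_hankel_zero.comp ((tendsto_const_mul_nhdsGT hκ).comp
    (tendsto_norm_sub_nhdsGT p))).const_mul ((κ : ℂ)⁻¹)
  rw [mul_zero] at h
  refine h.congr fun x => ?_
  have hκc : (κ : ℂ) ≠ 0 := by exact_mod_cast hκ.ne'
  simp only [Function.comp_apply, pointSource_eq]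
  push_cast
  field_simp

lemma norm_pointSource_bdryPt_le (hκ : 0 < κ) {y t : ℝ} (h : t ≠ y) :
    ‖pointSource κ (bdryPt y) (bdryPt t)‖ ≤ √Real.pi / √κ * |t - y| ^ (-(1 / 2) : ℝ) := by
  have hn : ‖bdryPt t - bdryPt y‖ = |t - y| := by
    rw [← norm_boundary]; congr 1; ext i; fin_cases i <;> simp
  have hpos : 0 < |t - y| := abs_pos.2 (sub_ne_zero.2 h)
  rw [pointSource_eq, hn]
  refine (norm_hankel_le (mul_pos hκ hpos)).trans_eq ?_
  rw [Real.sqrt_mul hκ.le, Real.rpow_neg hpos.le, ← Real.sqrt_eq_rpow]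
  field_simp

end

/-! ### Limits of fluxes at boundary points. -/

noncomputable section

variable {κ : ℝ} {P : Set Plane} {g gu gv : ℝ → ℂ} {u v w : Plane → ℂ}

/-- The weights concentrate at their centre. -/
lemma tendsto_integral_weight_mul {p : Plane} (hp : p 1 = 0) {B : Plane → ℂ} {b : ℂ}
    (hB : Tendsto B (𝓝[upperHalf] p) (𝓝 b))
    (hi : ∀ᶠ ρ in 𝓝[>] (0 : ℝ), IntegrableOn (fun x => (weight p ρ x : ℂ) * B x) upperHalf) :
    Tendsto (fun ρ => ∫ x in upperHalf, (weight p ρ x : ℂ) * B x) (𝓝[>] 0)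
      (𝓝 (weightMass * b)) := by
  have hm := weightMass_pos
  rw [Metric.tendsto_nhds]
  intro δ hδ
  set τ := δ / (2 * weightMass)
  have hτ : 0 < τ := by positivity
  have h1 := (Metric.tendsto_nhds.1 hB) τ hτ
  rw [eventually_nhdsWithin_iff, Metric.eventually_nhds_iff] at h1
  obtain ⟨s, hs, hsB⟩ := h1
  have h2 : ∀ᶠ ρ in 𝓝[>] (0 : ℝ), ρ < s / 2 :=
    (eventually_lt_nhds (half_pos hs)).filter_mono nhdsWithin_le_nhds
  filter_upwards [hi, h2, self_mem_nhdsWithin] with ρ hiρ hρs hρ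
  have hρ : 0 < ρ := hρ
  have hiw : IntegrableOn (fun x => (weight p ρ x : ℂ) * b) upperHalf :=
    ((integrableOn_weight (c := p) hρ).ofReal (𝕜 := ℂ)).mul_const b
  have hconst : ∫ x in upperHalf, (weight p ρ x : ℂ) * b = weightMass * b := by
    rw [integral_mul_const, integral_complex_ofReal, integral_weight hp hρ]
  rw [← hconst, dist_eq_norm, ← integral_sub hiρ hiw]
  have hpt : ∀ x ∈ upperHalf, ‖(weight p ρ x : ℂ) * B x - (weight p ρ x : ℂ) * b‖ ≤
      τ * weight p ρ x := by
    intro x hx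
    have hw := weight_nonneg p ρ x
    rw [← mul_sub, norm_mul, Complex.norm_real, Real.norm_of_nonneg hw, mul_comm]
    rcases le_or_gt (2 * ρ) ‖x - p‖ with h | h
    · simp [weight_eq_zero_of_ge hρ h]
    · gcongr
      rw [← dist_eq_norm]
      exact (hsB (by rw [dist_eq_norm]; linarith) hx).le
  have hfin := norm_integral_le_of_norm_le ((integrableOn_weight (c := p) hρ).const_mul τ)
    ((ae_restrict_iff' isOpen_upperHalf.measurableSet).2 (ae_of_all _ hpt))
  rw [integral_const_mul, integral_weight hp hρ] at hfin
  refine hfin.trans_lt ?_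
  have : τ * weightMass = δ / 2 := by simp only [τ]; field_simp
  linarith

lemma IsHelmholtzOff.tendsto_upperHalf (hu : IsHelmholtzOff κ P g u) {x : Plane}
    (hx : x ∈ closedUpperHalf \ P) : Tendsto u (𝓝[upperHalf] x) (𝓝 (u x)) :=
  (hu.continuousOn x hx).mono_left (nhdsWithin_mono _ hu.upperHalf_subset)

lemma IsHelmholtzOff.tendsto_fderiv_upperHalf (hu : IsHelmholtzOff κ P g u) {x : Plane}
    (hx : x ∈ closedUpperHalf \ P) :
    Tendsto (fderiv ℝ u) (𝓝[upperHalf] x) (𝓝 (bdryDeriv P u x)) := by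
  refine ((hu.continuousOn_bdryDeriv x hx).mono_left
    (nhdsWithin_mono _ hu.upperHalf_subset)).congr' ?_
  filter_upwards [self_mem_nhdsWithin] with z hz
  exact hu.bdryDeriv_eq hz

lemma annulus_disjoint_of_small {p : Plane} (hp : p ∉ P \ {p})
    (hPp : IsClosed (P \ {p})) :
    ∀ᶠ ρ in 𝓝[>] (0 : ℝ), Disjoint (annulus p ρ) P := by
  obtain ⟨s, hs, hsP⟩ := Metric.isOpen_iff.1 hPp.isOpen_compl p hp
  have h2 : ∀ᶠ ρ in 𝓝[>] (0 : ℝ), ρ < s / 2 :=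
    (eventually_lt_nhds (half_pos hs)).filter_mono nhdsWithin_le_nhds
  filter_upwards [h2, self_mem_nhdsWithin] with ρ hρs hρ
  have hρ : 0 < ρ := hρ
  refine Set.disjoint_left.2 fun x hx hxP => ?_
  have hxb : x ∈ Metric.ball p s := by
    rw [Metric.mem_ball, dist_eq_norm]
    exact hx.2.trans_lt (by linarith)
  refine hsP hxb ⟨hxP, ?_⟩
  rintro rfl
  have := hx.1
  simp only [sub_self, norm_zero] at this
  linarith

/-- The flux around the pole of a point source picks out the value at the pole. -/
theorem tendsto_flux_pole (hκ : 0 < κ) (hw : IsHelmholtzOff κ P g w) {y : ℝ}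
    (hy : bdryPt y ∉ P) :
    Tendsto (fun ρ => flux (bdryPt y) ρ w (pointSource κ (bdryPt y))) (𝓝[>] 0)
      (𝓝 (weightMass * (w (bdryPt y) * -hankelResidue))) := by
  set p := bdryPt y with hpdef
  have hG := isHelmholtzOff_pointSource hκ y
  have hmem : p ∈ closedUpperHalf \ P := ⟨mem_closedUpperHalf_boundary y, hy⟩
  have hle : 𝓝[upperHalf] p ≤ 𝓝[≠] p :=
    nhdsWithin_mono _ fun x hx h => bdryPt_notMem_upperHalf y (by
      rw [Set.mem_singleton_iff.1 h] at hx; exact hx)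
  refine tendsto_integral_weight_mul (by simp [p]) ?_ ?_
  · have h1 := (hw.tendsto_upperHalf hmem).mul ((tendsto_fderiv_pointSource hκ p).mono_left hle)
    -- The other half of the Wronskian is negligible: ∇w is bounded near the pole and |x - p| times
    -- the source tends to zero.
    have h2 : Tendsto (fun x => pointSource κ p x * fderiv ℝ w x (x - p)) (𝓝[upperHalf] p)
        (𝓝 0) := by
      have h3 := (hw.tendsto_fderiv_upperHalf hmem).norm.mul
        ((tendsto_norm_mul_pointSource hκ p).mono_left hle).norm
      rw [norm_zero, mul_zero] at h3
      refine squeeze_zero_norm (fun x => ?_) h3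
      rw [norm_mul, norm_mul, Complex.norm_real, norm_norm]
      calc _ ≤ ‖pointSource κ p x‖ * (‖fderiv ℝ w x‖ * ‖x - p‖) := by
            gcongr; exact ContinuousLinearMap.le_opNorm _ _
        _ = _ := by ring
    have h3 := h1.sub h2
    rw [sub_zero] at h3
    exact h3
  · have hcl : IsClosed (P ∪ {p}) := hw.isClosed.union isClosed_singleton
    have hdisj : Disjoint (P ∪ {p}) upperHalf := hw.disjoint.union_left hG.disjoint
    have hw' := hw.mono Set.subset_union_left hcl hdisj
    have hG' := hG.mono Set.subset_union_right hcl hdisj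
    have hPeq : (P ∪ {p}) \ {p} = P := by
      rw [Set.union_sdiff_right, Set.sdiff_singleton_eq_self hy]
    filter_upwards [annulus_disjoint_of_small (p := p) (by rwa [hPeq])
      (by rw [hPeq]; exact hw.isClosed), self_mem_nhdsWithin] with ρ hρ hρ0
    exact integrableOn_weight_mul_wronskian hw' hG' hρ0 hρ

lemma fderiv_apply_le_grad (u : Plane → ℂ) (x e : Plane) :
    ‖fderiv ℝ u x e‖ ≤ 2 * (‖grad u x‖ * ‖e‖) := by
  have h : fderiv ℝ u x e = e 0 * grad u x 0 + e 1 * grad u x 1 := by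
    conv_lhs => rw [eq_smul_add_smul e]
    rw [map_add, map_smul, map_smul, Complex.real_smul, Complex.real_smul]
    rfl
  have hj : ∀ j : Fin 2, ‖(e j : ℂ) * grad u x j‖ ≤ ‖grad u x‖ * ‖e‖ := fun j => by
    rw [norm_mul, Complex.norm_real, mul_comm]
    gcongr
    · exact PiLp.norm_apply_le _ j
    · exact PiLp.norm_apply_le _ j
  rw [h, two_mul]
  exact (norm_add_le _ _).trans (add_le_add (hj 0) (hj 1))

/-- The derivative of the transition function is continuous with compact support; the factor ρ²
cancels the scaling of the weight, so K serves all centres and radii. -/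
lemma exists_weight_bound : ∃ K : ℝ, 0 < K ∧ ∀ c ρ x, 0 < ρ → ρ ^ 2 * weight c ρ x ≤ K := by
  have hcs : HasCompactSupport (deriv Real.smoothTransition) := by
    refine HasCompactSupport.intro (isCompact_Icc (a := (0 : ℝ)) (b := 1)) fun t ht => ?_
    rw [Set.mem_Icc, not_and_or, not_le, not_le] at ht
    rcases ht with ht | ht
    · exact deriv_smoothTransition_of_nonpos ht.le
    · exact deriv_smoothTransition_of_one_le ht.le
  obtain ⟨C, hC⟩ := hcs.exists_bound_of_continuous continuous_deriv_smoothTransition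
  refine ⟨2 * |C| + 1, by positivity, fun c ρ x hρ => ?_⟩
  have h1 := (le_abs_self _).trans ((hC (2 - ‖x - c‖ ^ 2 / ρ ^ 2)).trans (le_abs_self C))
  rw [weight]
  have : ρ ^ 2 * (2 / ρ ^ 2 * deriv Real.smoothTransition (2 - ‖x - c‖ ^ 2 / ρ ^ 2)) =
    2 * deriv Real.smoothTransition (2 - ‖x - c‖ ^ 2 / ρ ^ 2) := by field_simp
  linarith

/-- The flux around a boundary point near which `w` has finite energy and `v` is regular vanishes
in the limit. -/
theorem tendsto_flux_corner {c : Plane} (hc : c 1 = 0)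
    (hw : ∀ R : ℝ, MemLp w 2 (volume.restrict (upperHalf ∩ Metric.ball 0 R)))
    (hgw : ∀ R : ℝ, MemLp (grad w) 2 (volume.restrict (upperHalf ∩ Metric.ball 0 R)))
    (hv : IsHelmholtzOff κ P g v) (hcP : c ∉ P) :
    Tendsto (fun ρ => flux c ρ w v) (𝓝[>] 0) (𝓝 0) := by
  have hmem : c ∈ closedUpperHalf \ P := ⟨by simp [closedUpperHalf, hc], hcP⟩
  have hm := weightMass_pos
  obtain ⟨K, hK, hKw⟩ := exists_weight_bound
  set h : Plane → ℝ := fun x => ‖w x‖ + ‖grad w x‖ with hh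
  have hL2 : IntegrableOn (fun x => h x ^ 2) (upperHalf ∩ Metric.ball 0 (‖c‖ + 1)) :=
    ((hw _).norm.add (hgw _).norm).integrable_sq
  obtain ⟨M, hM0, hM⟩ : ∃ M : ℝ, 0 < M ∧ ∀ᶠ x in 𝓝[upperHalf] c, ‖v x‖ ≤ M ∧
      ‖fderiv ℝ v x‖ ≤ M := by
    refine ⟨max (‖v c‖) ‖bdryDeriv P v c‖ + 1, by positivity, ?_⟩
    filter_upwards [(hv.tendsto_upperHalf hmem).norm.eventually (gt_mem_nhds (lt_add_one _)),
      (hv.tendsto_fderiv_upperHalf hmem).norm.eventually (gt_mem_nhds (lt_add_one _))] with x h1 h2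
    exact ⟨h1.le.trans (by gcongr; exact le_max_left _ _),
      h2.le.trans (by gcongr; exact le_max_right _ _)⟩
  rw [eventually_nhdsWithin_iff, Metric.eventually_nhds_iff] at hM
  obtain ⟨s, hs, hsM⟩ := hM
  -- Absolute continuity of the energy integral: finite energy near the corner makes the energy in
  -- shrinking balls vanish.
  have hsmall : Tendsto (fun ρ : ℝ => ∫ x in Metric.ball c (3 * ρ),
      h x ^ 2 ∂(volume.restrict (upperHalf ∩ Metric.ball 0 (‖c‖ + 1)))) (𝓝[>] 0) (𝓝 0) := by
    refine hL2.tendsto_setIntegral_nhds_zero ?_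
    have h1 : Tendsto (fun ρ : ℝ => volume (Metric.ball c (3 * ρ))) (𝓝[>] 0) (𝓝 0) := by
      have h2 : Tendsto (fun ρ : ℝ => ENNReal.ofReal ((3 * ρ) ^ 2) *
          volume (Metric.ball (0 : Plane) 1)) (𝓝[>] 0) (𝓝 0) := by
        have h3 : Tendsto (fun ρ : ℝ => ENNReal.ofReal ((3 * ρ) ^ 2)) (𝓝[>] 0) (𝓝 0) := by
          have : Continuous fun ρ : ℝ => ENNReal.ofReal ((3 * ρ) ^ 2) :=
            ENNReal.continuous_ofReal.comp (by fun_prop)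
          simpa using (this.tendsto 0).mono_left nhdsWithin_le_nhds
        have h4 := ENNReal.Tendsto.mul_const (b := volume (Metric.ball (0 : Plane) 1)) h3
          (Or.inr measure_ball_lt_top.ne)
        rwa [zero_mul] at h4
      refine h2.congr' ?_
      filter_upwards [self_mem_nhdsWithin] with ρ hρ
      have hρ : 0 < ρ := hρ
      rw [Measure.addHaar_ball_of_pos volume c (by positivity)]
      simp
    exact tendsto_of_tendsto_of_tendsto_of_le_of_le tendsto_const_nhds h1 (fun _ => bot_le)
      fun ρ => Measure.restrict_apply_le _ _
  rw [Metric.tendsto_nhds]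
  intro δ hδ
  -- Makes the first term 2Ma·`weightMass` of the final bound equal to δ/2. With a fixed, ρ is then
  -- taken so small that the energy term is below δ/4.
  set a : ℝ := δ / (4 * M * weightMass) with ha
  have ha0 : 0 < a := by positivity
  have hb0 : 0 < δ / 4 / (2 * M * K / a) := by positivity
  have hsm := (Metric.tendsto_nhds.1 hsmall) _ hb0
  have h2 : ∀ᶠ ρ in 𝓝[>] (0 : ℝ), ρ < min (s / 2) (1 / 3) :=
    (eventually_lt_nhds (by positivity)).filter_mono nhdsWithin_le_nhds
  filter_upwards [hsm, h2, self_mem_nhdsWithin] with ρ hρ1 hρ2 hρ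
  have hρ : 0 < ρ := hρ
  have hρs : ρ < s / 2 := hρ2.trans_le (min_le_left _ _)
  have hρ3 : ρ < 1 / 3 := hρ2.trans_le (min_le_right _ _)
  have hsub : Metric.ball c (3 * ρ) ⊆ Metric.ball 0 (‖c‖ + 1) := by
    refine Metric.ball_subset_ball' ?_
    rw [dist_zero_right]; linarith
  set S : Set Plane := Metric.ball c (3 * ρ)
  have hrestr : (volume.restrict (upperHalf ∩ Metric.ball 0 (‖c‖ + 1))).restrict S =
      (volume.restrict upperHalf).restrict S := by
    rw [Measure.restrict_restrict measurableSet_ball, Measure.restrict_restrict measurableSet_ball]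
    congr 1
    ext x
    constructor
    · rintro ⟨h1, h2, -⟩; exact ⟨h1, h2⟩
    · rintro ⟨h1, h2⟩; exact ⟨h1, h2, hsub h1⟩
  have hiS : Integrable (S.indicator fun x => h x ^ 2) (volume.restrict upperHalf) := by
    rw [integrable_indicator_iff measurableSet_ball, IntegrableOn, ← hrestr]
    exact hL2.integrableOn
  have hIS : ∫ x in upperHalf, S.indicator (fun x => h x ^ 2) x < δ / 4 / (2 * M * K / a) := by
    rw [integral_indicator measurableSet_ball, ← hrestr]
    rw [dist_zero_right] at hρ1
    exact (le_abs_self _).trans_lt hρ1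
  have hpt : ∀ x ∈ upperHalf, ‖(weight c ρ x : ℂ) * wronskian w v x (x - c)‖ ≤
      2 * M * a * weight c ρ x + 2 * M * K / a * S.indicator (fun x => h x ^ 2) x := by
    intro x hx
    have hwt := weight_nonneg c ρ x
    rcases le_or_gt (2 * ρ) ‖x - c‖ with hxc | hxc
    · rw [weight_eq_zero_of_ge hρ hxc]
      have : 0 ≤ S.indicator (fun x => h x ^ 2) x := Set.indicator_nonneg (fun _ _ => sq_nonneg _) x
      simp only [Complex.ofReal_zero, zero_mul, norm_zero, mul_zero, zero_add]
      positivity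
    have hxS : x ∈ S := by
      rw [Metric.mem_ball, dist_eq_norm]; linarith
    rw [Set.indicator_of_mem hxS]
    obtain ⟨hv1, hv2⟩ := hsM (y := x) (by rw [dist_eq_norm]; linarith) hx
    have hW : ‖wronskian w v x (x - c)‖ ≤ 2 * M * (‖x - c‖ * h x) := by
      refine (norm_sub_le _ _).trans ?_
      rw [norm_mul, norm_mul]
      have h1 : ‖fderiv ℝ v x (x - c)‖ ≤ M * ‖x - c‖ :=
        (ContinuousLinearMap.le_opNorm _ _).trans (by gcongr)
      have h2 := fderiv_apply_le_grad w x (x - c)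
      calc _ ≤ ‖w x‖ * (M * ‖x - c‖) + M * (2 * (‖grad w x‖ * ‖x - c‖)) := by gcongr
        _ ≤ ‖w x‖ * (M * ‖x - c‖) + M * (2 * (‖grad w x‖ * ‖x - c‖)) +
            ‖w x‖ * (M * ‖x - c‖) := le_add_of_nonneg_right (by positivity)
        _ = _ := by simp only [hh]; ring
    rw [norm_mul, Complex.norm_real, Real.norm_of_nonneg hwt]
    have hh0 : 0 ≤ h x := by positivity
    -- Young's inequality, turning the bound linear in the energy density's square root h into one
    -- in h². The factor ρ² is then paid for by the weight.
    have h3 : ‖x - c‖ * h x ≤ a + ρ ^ 2 * h x ^ 2 / a := by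
      have h4 : 0 ≤ (a - ρ * h x) ^ 2 / a := by positivity
      have h5 : (a - ρ * h x) ^ 2 / a = a + ρ ^ 2 * h x ^ 2 / a - 2 * ρ * h x := by
        field_simp; ring
      have h6 : ‖x - c‖ * h x ≤ 2 * ρ * h x := by gcongr
      linarith
    calc _ ≤ weight c ρ x * (2 * M * (a + ρ ^ 2 * h x ^ 2 / a)) := by
          gcongr; exact hW.trans (by gcongr)
      _ = 2 * M * a * weight c ρ x + 2 * M * (ρ ^ 2 * weight c ρ x) / a * h x ^ 2 := by ring
      _ ≤ _ := by
          gcongr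
          exact hKw c ρ x hρ
  have hiw := integrableOn_weight (c := c) hρ
  have hfin := norm_integral_le_of_norm_le ((hiw.const_mul (2 * M * a)).add
    (hiS.const_mul (2 * M * K / a)))
    ((ae_restrict_iff' isOpen_upperHalf.measurableSet).2 (ae_of_all _ hpt))
  simp only [Pi.add_apply] at hfin
  rw [integral_add (hiw.const_mul (2 * M * a)) (hiS.const_mul (2 * M * K / a)),
    integral_const_mul, integral_const_mul, integral_weight hc hρ] at hfin
  rw [dist_zero_right]
  refine hfin.trans_lt ?_
  have e1 : 2 * M * a * weightMass = δ / 2 := by rw [ha]; field_simp; ring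
  have e2 := mul_lt_mul_of_pos_left hIS (by positivity : 0 < 2 * M * K / a)
  rw [mul_div_cancel₀ _ (by positivity)] at e2
  linarith

end

/-! ### Green's representation and the bound on the aperture. -/

noncomputable section

variable {κ : ℝ} {P : Set Plane} {g gu gv : ℝ → ℂ} {u v w : Plane → ℂ}

/-- Splitting at y gives the exact value 2√y + 2√(ε - y), whence a bound uniform in the position of
the pole. -/
lemma rpow_neg_half_integral {y ε : ℝ} (hy : 0 < y) (hyε : y < ε) :
    IntervalIntegrable (fun t => |t - y| ^ (-(1 / 2) : ℝ)) volume 0 ε ∧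
      ∫ t in (0 : ℝ)..ε, |t - y| ^ (-(1 / 2) : ℝ) ≤ 4 * √ε := by
  have hbase : ∀ a b : ℝ, IntervalIntegrable (fun s : ℝ => s ^ (-(1 / 2) : ℝ)) volume a b :=
    fun a b => intervalIntegral.intervalIntegrable_rpow' (by norm_num)
  have hval : ∀ b : ℝ, ∫ s in (0 : ℝ)..b, s ^ (-(1 / 2) : ℝ) = 2 * b ^ (1 / 2 : ℝ) := fun b => by
    rw [integral_rpow (Or.inl (by norm_num))]
    norm_num
    ring
  have e1 : Set.EqOn (fun t : ℝ => (y - t) ^ (-(1 / 2) : ℝ)) (fun t => |t - y| ^ (-(1 / 2) : ℝ))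
      (Set.uIcc 0 y) := fun t ht => by
    rw [Set.uIcc_of_le hy.le] at ht
    simp only
    rw [abs_sub_comm, abs_of_nonneg (sub_nonneg.2 ht.2)]
  have e2 : Set.EqOn (fun t : ℝ => (t - y) ^ (-(1 / 2) : ℝ)) (fun t => |t - y| ^ (-(1 / 2) : ℝ))
      (Set.uIcc y ε) := fun t ht => by
    rw [Set.uIcc_of_le hyε.le] at ht
    simp only
    rw [abs_of_nonneg (sub_nonneg.2 ht.1)]
  have i1 : IntervalIntegrable (fun t => |t - y| ^ (-(1 / 2) : ℝ)) volume 0 y := by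
    have h := (hbase y 0).comp_sub_left y
    simp only [sub_self, sub_zero] at h
    exact h.congr fun t ht => e1 (Set.uIoc_subset_uIcc ht)
  have i2 : IntervalIntegrable (fun t => |t - y| ^ (-(1 / 2) : ℝ)) volume y ε := by
    have h := (hbase 0 (ε - y)).comp_sub_right y
    simp only [zero_add, sub_add_cancel] at h
    exact h.congr fun t ht => e2 (Set.uIoc_subset_uIcc ht)
  refine ⟨i1.trans i2, ?_⟩
  rw [← intervalIntegral.integral_add_adjacent_intervals i1 i2,
    ← intervalIntegral.integral_congr e1, ← intervalIntegral.integral_congr e2,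
    intervalIntegral.integral_comp_sub_left (fun s => s ^ (-(1 / 2) : ℝ)),
    intervalIntegral.integral_comp_sub_right (fun s => s ^ (-(1 / 2) : ℝ)), sub_self, sub_zero,
    hval, hval, ← Real.sqrt_eq_rpow, ← Real.sqrt_eq_rpow]
  have h1 : √y ≤ √ε := Real.sqrt_le_sqrt hyε.le
  have h2 : √(ε - y) ≤ √ε := Real.sqrt_le_sqrt (by linarith)
  linarith

/-- The Neumann datum equal to `g₀` on the aperture and to zero elsewhere. -/
def apertureDatum (ε : ℝ) (g₀ : ℂ) : ℝ → ℂ := (Set.Ioo 0 ε).indicator fun _ => g₀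

lemma corners_eq (ε : ℝ) : corners ε = {bdryPt 0, bdryPt ε} := rfl

lemma bdryPt_injective {s t : ℝ} (h : bdryPt s = bdryPt t) : s = t := congrArg (fun x => x 0) h

lemma norm_bdryPt_sub (s t : ℝ) : ‖bdryPt s - bdryPt t‖ = |s - t| := by
  rw [← norm_boundary]; congr 1; ext i; fin_cases i <;> simp

lemma isClosed_range_bdryPt {ι : Type*} [Finite ι] (q : ι → ℝ) :
    IsClosed (Set.range fun i => bdryPt (q i)) := (Set.finite_range _).isClosed

lemma disjoint_range_bdryPt {ι : Type*} (q : ι → ℝ) :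
    Disjoint (Set.range fun i => bdryPt (q i)) upperHalf := by
  refine Set.disjoint_left.2 ?_
  rintro _ ⟨i, rfl⟩
  exact bdryPt_notMem_upperHalf _

/-- **Green's identity with punctures**: the fluxes around finitely many boundary points and the
flux at a large radius are balanced by the boundary data. -/
theorem flux_balance {ι : Type*} [Fintype ι] {q : ι → ℝ}
    (hu : IsHelmholtzOff κ (Set.range fun i => bdryPt (q i)) gu u)
    (hv : IsHelmholtzOff κ (Set.range fun i => bdryPt (q i)) gv v)
    {ρ R : ℝ} (hρ : 0 < ρ) (hR : 0 < R) (hsep : ∀ i j, i ≠ j → 3 * ρ ≤ |q i - q j|)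
    (hfar : ∀ i, |q i| + ρ ≤ R) :
    ∑ i, flux (bdryPt (q i)) ρ u v - flux 0 R u v =
      -∫ t : ℝ, (u !₂[t, 0] * gv t - v !₂[t, 0] * gu t) *
        ((bump 0 R !₂[t, 0] : ℂ) - ∑ i, (bump (bdryPt (q i)) ρ !₂[t, 0] : ℂ)) := by
  classical
  set P := Set.range fun i => bdryPt (q i)
  have hPR : P ⊆ Metric.ball 0 R := by
    rintro _ ⟨i, rfl⟩
    rw [mem_ball_zero_iff, norm_boundary]
    linarith [hfar i]
  have hann : ∀ i, Disjoint (annulus (bdryPt (q i)) ρ) P := fun i => by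
    refine Set.disjoint_left.2 ?_
    rintro _ hx ⟨j, rfl⟩
    have h1 := hx.1
    have h2 := hx.2
    rw [norm_bdryPt_sub] at h1 h2
    rcases eq_or_ne j i with rfl | hij
    · simp only [sub_self, abs_zero] at h1; linarith
    · linarith [hsep j i hij]
  set η : Plane → ℂ := fun x => (bump 0 R x : ℂ) - ∑ i, (bump (bdryPt (q i)) ρ x : ℂ) with hηdef
  have hη : ContDiff ℝ 1 η :=
    (contDiff_bump_complex 0 R).sub (ContDiff.sum fun i _ => contDiff_bump_complex _ ρ)
  have hsupp : HasCompactSupport η := by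
    refine HasCompactSupport.intro (isCompact_closedBall 0 (2 * R)) fun x hx => ?_
    rw [mem_closedBall_zero_iff, not_le] at hx
    simp only [hηdef]
    rw [bump_eq_zero hR (by simpa using hx.le), Finset.sum_eq_zero fun i _ => ?_]
    · simp
    rw [bump_eq_zero hρ, Complex.ofReal_zero]
    have h1 : ‖x‖ ≤ ‖x - bdryPt (q i)‖ + ‖bdryPt (q i)‖ := by
      simpa using norm_add_le (x - bdryPt (q i)) (bdryPt (q i))
    rw [norm_boundary] at h1
    have := hfar i
    have := abs_nonneg (q i)
    linarith
  -- Near each puncture exactly one small bump is 1 and cancels the large one. The separation 3ρ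
  -- keeps the other bumps, supported within 2ρ of their centres, away from this ball.
  have hzero : ∀ i, ∀ x ∈ Metric.ball (bdryPt (q i)) ρ, η x = 0 := by
    intro i x hx
    rw [Metric.mem_ball, dist_eq_norm] at hx
    simp only [hηdef]
    rw [bump_eq_one hR, Finset.sum_eq_single i, bump_eq_one hρ hx.le, sub_self]
    · intro j _ hji
      rw [bump_eq_zero hρ, Complex.ofReal_zero]
      have h1 : ‖bdryPt (q i) - bdryPt (q j)‖ ≤ ‖x - bdryPt (q j)‖ + ‖x - bdryPt (q i)‖ := by
        have := norm_sub_le (x - bdryPt (q j)) (x - bdryPt (q i))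
        rwa [sub_sub_sub_cancel_left] at this
      rw [norm_bdryPt_sub] at h1
      linarith [hsep i j hji.symm]
    · simp
    · have h1 : ‖x‖ ≤ ‖x - bdryPt (q i)‖ + ‖bdryPt (q i)‖ := by
        simpa using norm_add_le (x - bdryPt (q i)) (bdryPt (q i))
      rw [norm_boundary] at h1
      rw [sub_zero]
      linarith [hfar i]
  have hd : Disjoint (tsupport η) P := by
    refine Set.disjoint_right.2 ?_
    rintro _ ⟨i, rfl⟩ hx
    refine notMem_tsupport_iff_eventuallyEq.2 ?_ hx
    filter_upwards [Metric.ball_mem_nhds _ hρ] with x hx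
    exact hzero i x hx
  have key := green_identity hu hv hη hsupp hd
  have hdiff : ∀ (c : Plane) (R : ℝ) x, DifferentiableAt ℝ (fun x => (bump c R x : ℂ)) x :=
    fun c R x => ((contDiff_bump_complex c R).differentiable (by norm_num)) x
  have hlhs : ∀ x, wronskian u v x e₁ * fderiv ℝ η x e₁ + wronskian u v x e₂ * fderiv ℝ η x e₂ =
      ∑ i, (weight (bdryPt (q i)) ρ x : ℂ) * wronskian u v x (x - bdryPt (q i)) -
        (weight 0 R x : ℂ) * wronskian u v x (x - 0) := by
    intro x
    have hfd : ∀ e, fderiv ℝ η x e = fderiv ℝ (fun x => (bump 0 R x : ℂ)) x e -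
        ∑ i, fderiv ℝ (fun x => (bump (bdryPt (q i)) ρ x : ℂ)) x e := by
      intro e
      rw [hηdef, fderiv_fun_sub (hdiff 0 R x) (DifferentiableAt.fun_sum fun i _ => hdiff _ ρ x),
        fderiv_fun_sum fun i _ => hdiff _ ρ x]
      simp
    have h0 := wronskian_mul_fderiv_bump u v 0 R x
    have hs : ∑ i, (weight (bdryPt (q i)) ρ x : ℂ) * wronskian u v x (x - bdryPt (q i)) =
        -(wronskian u v x e₁ * ∑ i, fderiv ℝ (fun x => (bump (bdryPt (q i)) ρ x : ℂ)) x e₁ +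
        wronskian u v x e₂ * ∑ i, fderiv ℝ (fun x => (bump (bdryPt (q i)) ρ x : ℂ)) x e₂) := by
      rw [Finset.mul_sum, Finset.mul_sum, ← Finset.sum_add_distrib, ← Finset.sum_neg_distrib]
      refine Finset.sum_congr rfl fun i _ => ?_
      rw [wronskian_mul_fderiv_bump, neg_neg]
    rw [hfd, hfd, hs]
    linear_combination h0
  simp_rw [hlhs] at key
  rw [integral_sub (integrable_finsetSum _ fun i _ =>
      integrableOn_weight_mul_wronskian hu hv hρ (hann i))
    (integrableOn_weight_mul_wronskian hu hv hR (disjoint_annulus_zero hPR le_rfl)),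
    integral_finsetSum _ fun i _ =>
      integrableOn_weight_mul_wronskian hu hv hρ (hann i)] at key
  exact key

/-- The bound for a radiating solution of finite energy on the aperture carrying its Neumann
datum. -/
theorem exists_aperture_bound : ∃ C : ℝ, 0 < C ∧ ∀ {κ ε : ℝ} {g₀ : ℂ} {w : Plane → ℂ}, 0 < κ →
    IsHelmholtzOff κ (corners ε) (apertureDatum ε g₀) w → Radiating κ w →
    (∀ R : ℝ, MemLp w 2 (volume.restrict (upperHalf ∩ Metric.ball 0 R))) →
    (∀ R : ℝ, MemLp (grad w) 2 (volume.restrict (upperHalf ∩ Metric.ball 0 R))) →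
    ∀ y, 0 < y → y < ε → ‖w (bdryPt y)‖ ≤ C * ‖g₀‖ * (√ε / √κ) := by
  have hres := norm_pos_iff.2 hankelResidue_ne_zero
  have hm := weightMass_pos
  refine ⟨16 * √Real.pi / (weightMass * ‖hankelResidue‖), by positivity, ?_⟩
  intro κ ε g₀ w hκ hw hrad hL2 hgL2 y hy hyε
  have hε : 0 < ε := hy.trans hyε
  -- The punctures are the pole of the source and the two corners.
  set q : Fin 3 → ℝ := ![y, 0, ε] with hq
  set G := pointSource κ (bdryPt y) with hGdef
  set P := Set.range fun i => bdryPt (q i) with hPdef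
  have hPc : IsClosed P := isClosed_range_bdryPt q
  have hPd : Disjoint P upperHalf := disjoint_range_bdryPt q
  have hw' : IsHelmholtzOff κ P (apertureDatum ε g₀) w := hw.mono (by
    rw [corners_eq]
    rintro x (rfl | rfl)
    · exact ⟨1, rfl⟩
    · exact ⟨2, rfl⟩) hPc hPd
  have hG0 := isHelmholtzOff_pointSource hκ y
  have hG' : IsHelmholtzOff κ P 0 G := hG0.mono (by
    rintro x rfl
    exact ⟨0, rfl⟩) hPc hPd
  have hyc : bdryPt y ∉ corners ε := by
    rw [corners_eq]
    rintro (h | h)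
    · exact hy.ne' (bdryPt_injective h)
    · exact hyε.ne (bdryPt_injective h)
  have h0p : bdryPt 0 ∉ ({bdryPt y} : Set Plane) := fun h => hy.ne (bdryPt_injective h)
  have hεp : bdryPt ε ∉ ({bdryPt y} : Set Plane) := fun h => hyε.ne' (bdryPt_injective h)
  -- 16 = 4 · 4: the cutoff, one large bump minus three small ones, is bounded by 4, and the
  -- integral of |t - y|^{-1/2} by 4√ε.
  set b : ℝ := 16 * √Real.pi * ‖g₀‖ * (√ε / √κ) with hb
  obtain ⟨hint, hintle⟩ := rpow_neg_half_integral hy hyε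
  have hflux0 := tendsto_flux_radiating hκ hw' hG' (R₀ := 2 * ε) (by positivity) (by
    rintro _ ⟨i, rfl⟩
    rw [mem_ball_zero_iff, norm_boundary]
    fin_cases i
    · simp [hq, abs_of_pos hy]; linarith
    · simp [hq, hε]
    · simp [hq, abs_of_pos hε, hε])
    (fun t ht => Set.indicator_of_notMem (fun h => by
      rw [abs_of_pos h.1] at ht; linarith [h.2]) _) (fun _ _ => rfl) hrad
    (radiating_pointSource hκ y)
  -- At fixed ρ the large radius is sent to infinity first. The boundary integral is only bounded,
  -- uniformly in ρ and R; its limit is not needed.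
  have hbal : ∀ᶠ ρ in 𝓝[>] (0 : ℝ), ‖∑ i, flux (bdryPt (q i)) ρ w G‖ ≤ b := by
    have hsmall : ∀ᶠ ρ in 𝓝[>] (0 : ℝ), ρ < min (y / 3) ((ε - y) / 3) :=
      (eventually_lt_nhds (lt_min (by linarith) (by linarith))).filter_mono nhdsWithin_le_nhds
    filter_upwards [hsmall, self_mem_nhdsWithin] with ρ hρs hρ
    have hρ : 0 < ρ := hρ
    have hρ1 : ρ < y / 3 := hρs.trans_le (min_le_left _ _)
    have hρ2 : ρ < (ε - y) / 3 := hρs.trans_le (min_le_right _ _)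
    have hlim : Tendsto (fun R => ‖∑ i, flux (bdryPt (q i)) ρ w G - flux 0 R w G‖) atTop
        (𝓝 ‖∑ i, flux (bdryPt (q i)) ρ w G - 0‖) := (tendsto_const_nhds.sub hflux0).norm
    rw [sub_zero] at hlim
    refine le_of_tendsto hlim ?_
    filter_upwards [eventually_ge_atTop (2 * ε)] with R hR
    rw [flux_balance hw' hG' hρ (by linarith) (by
      intro i j hij
      fin_cases i <;> fin_cases j <;> first | exact absurd rfl hij | skip
      all_goals simp [hq]
      all_goals first
        | (refine le_abs.2 (Or.inl ?_); linarith)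
        | (refine le_abs.2 (Or.inr ?_); linarith)) (by
      intro i
      fin_cases i <;> (simp [hq, abs_of_pos, hy, hε]; linarith)), norm_neg]
    have hηle : ∀ x, ‖(bump 0 R x : ℂ) - ∑ i, (bump (bdryPt (q i)) ρ x : ℂ)‖ ≤ 4 := by
      intro x
      have h1 : ∀ c R, ‖(bump c R x : ℂ)‖ ≤ 1 := fun c R => by
        rw [Complex.norm_real, Real.norm_of_nonneg (bump_nonneg c R x)]
        exact bump_le_one c R x
      refine (norm_sub_le _ _).trans ?_
      have h2 : ‖∑ i, (bump (bdryPt (q i)) ρ x : ℂ)‖ ≤ ∑ i : Fin 3, (1 : ℝ) :=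
        norm_sum_le_of_le _ fun i _ => h1 _ _
      have h3 := h1 0 R
      simp only [Finset.sum_const, Finset.card_univ, Fintype.card_fin, nsmul_eq_mul, mul_one] at h2
      norm_num at h2
      linarith
    set bound : ℝ → ℝ := (Set.Ioc 0 ε).indicator fun t =>
      4 * ‖g₀‖ * (√Real.pi / √κ) * |t - y| ^ (-(1 / 2) : ℝ) with hbound
    have hbi : Integrable bound := by
      rw [hbound, integrable_indicator_iff measurableSet_Ioc]
      exact (((intervalIntegrable_iff_integrableOn_Ioc_of_le hε.le).1 hint).const_mul _)
    have hne : ∀ᵐ t : ℝ, t ≠ y := by simp [ae_iff, measure_singleton]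
    have hle := norm_integral_le_of_norm_le hbi (f := fun t : ℝ => (w !₂[t, 0] * (0 : ℝ → ℂ) t -
      G !₂[t, 0] * apertureDatum ε g₀ t) * ((bump 0 R !₂[t, 0] : ℂ) -
        ∑ i, (bump (bdryPt (q i)) ρ !₂[t, 0] : ℂ))) (by
      filter_upwards [hne] with t ht
      simp only [Pi.zero_apply, mul_zero, zero_sub, norm_mul, norm_neg]
      by_cases hmem : t ∈ Set.Ioo 0 ε
      · rw [apertureDatum, Set.indicator_of_mem hmem, hbound,
          Set.indicator_of_mem (Set.Ioo_subset_Ioc_self hmem)]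
        calc _ ≤ (√Real.pi / √κ * |t - y| ^ (-(1 / 2) : ℝ)) * ‖g₀‖ * 4 := by
              gcongr
              · exact norm_pointSource_bdryPt_le hκ ht
              · exact hηle _
          _ = _ := by ring
      · rw [apertureDatum, Set.indicator_of_notMem hmem]
        simp only [norm_zero, mul_zero, zero_mul]
        exact Set.indicator_nonneg (fun _ _ => by positivity) _)
    refine hle.trans ?_
    rw [hbound, integral_indicator measurableSet_Ioc, ← intervalIntegral.integral_of_le hε.le,
      intervalIntegral.integral_const_mul]
    calc _ ≤ 4 * ‖g₀‖ * (√Real.pi / √κ) * (4 * √ε) := by gcongr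
      _ = b := by rw [hb]; ring
  have hlim : Tendsto (fun ρ => ∑ i, flux (bdryPt (q i)) ρ w G) (𝓝[>] 0)
      (𝓝 (weightMass * (w (bdryPt y) * -hankelResidue))) := by
    have h1 := tendsto_flux_pole hκ hw hyc
    have h2 := tendsto_flux_corner (c := bdryPt 0) (by simp) hL2 hgL2 hG0 h0p
    have h3 := tendsto_flux_corner (c := bdryPt ε) (by simp) hL2 hgL2 hG0 hεp
    have h4 := (h1.add h2).add h3
    rw [add_zero, add_zero] at h4
    refine h4.congr fun ρ => ?_
    rw [Fin.sum_univ_three]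
    rfl
  have hfin := le_of_tendsto hlim.norm hbal
  rw [norm_mul, norm_mul, norm_neg, Complex.norm_real, Real.norm_of_nonneg hm.le] at hfin
  rw [div_mul_eq_mul_div, div_mul_eq_mul_div, le_div_iff₀ (by positivity)]
  calc _ = weightMass * (‖w (bdryPt y)‖ * ‖hankelResidue‖) := by ring
    _ ≤ b := hfin

end

/-! ### Plane waves, the scattered field and the aperture coefficient. -/

noncomputable section

variable {κ θ ε d : ℝ} {v : Plane → ℂ}

/-- The plane wave with direction `(a, b)`. -/
def planeWave (κ a b : ℝ) (x : Plane) : ℂ :=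
  Complex.exp (Complex.I * κ * ((x 0 * a + x 1 * b : ℝ) : ℂ))

lemma uInc_eq (κ θ : ℝ) : uInc κ θ = planeWave κ (Real.sin θ) (-Real.cos θ) := by
  ext x
  simp only [uInc, planeWave, mul_neg, sub_eq_add_neg]

lemma uRef_eq (κ θ : ℝ) : uRef κ θ = planeWave κ (Real.sin θ) (Real.cos θ) := rfl

lemma hasFDerivAt_planeWave (κ a b : ℝ) (x : Plane) :
    HasFDerivAt (planeWave κ a b) (planeWave κ a b x • ((Complex.I * κ) •
      (Complex.ofRealCLM.comp (a • EuclideanSpace.proj (𝕜 := ℝ) (0 : Fin 2) +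
        b • EuclideanSpace.proj (𝕜 := ℝ) (1 : Fin 2) : Plane →L[ℝ] ℝ)))) x := by
  have h0 : HasFDerivAt (fun x : Plane => x 0 * a + x 1 * b)
      (a • EuclideanSpace.proj (𝕜 := ℝ) (0 : Fin 2) +
        b • EuclideanSpace.proj (𝕜 := ℝ) (1 : Fin 2) : Plane →L[ℝ] ℝ) x :=
    (((EuclideanSpace.proj (𝕜 := ℝ) (0 : Fin 2)).hasFDerivAt (x := x)).mul_const a).add
      (((EuclideanSpace.proj (𝕜 := ℝ) (1 : Fin 2)).hasFDerivAt (x := x)).mul_const b)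
  exact ((Complex.ofRealCLM.hasFDerivAt.comp x h0).const_mul (Complex.I * κ)).cexp

lemma fderiv_planeWave (κ a b : ℝ) (x e : Plane) :
    fderiv ℝ (planeWave κ a b) x e =
      Complex.I * κ * ((e 0 * a + e 1 * b : ℝ) : ℂ) * planeWave κ a b x := by
  rw [(hasFDerivAt_planeWave κ a b x).fderiv]
  simp
  ring

lemma contDiff_planeWave (κ a b : ℝ) {n : WithTop ℕ∞} : ContDiff ℝ n (planeWave κ a b) := by
  have h0 : ∀ i : Fin 2, ContDiff ℝ n fun x : Plane => x i := fun i =>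
    (EuclideanSpace.proj (𝕜 := ℝ) i).contDiff
  exact (contDiff_const.mul (Complex.ofRealCLM.contDiff.comp
    (((h0 0).mul contDiff_const).add ((h0 1).mul contDiff_const)))).cexp

lemma helmholtz_planeWave (κ : ℝ) {a b : ℝ} (hab : a ^ 2 + b ^ 2 = 1) (x : Plane) :
    Laplacian.laplacian (planeWave κ a b) x + (κ : ℂ) ^ 2 * planeWave κ a b x = 0 := by
  rw [laplacian_eq_of_hasFDerivAt (contDiff_planeWave κ a b).contDiffAt
    (D := fun e y => Complex.I * κ * ((e 0 * a + e 1 * b : ℝ) : ℂ) * planeWave κ a b y)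
    (fun e => Eventually.of_forall fun y => fderiv_planeWave κ a b y e)
    (fun e => (hasFDerivAt_planeWave κ a b x).const_mul _)]
  have hc : (a : ℂ) ^ 2 + (b : ℂ) ^ 2 = 1 := by exact_mod_cast hab
  simp
  linear_combination (Complex.I ^ 2 * κ ^ 2 * planeWave κ a b x) * hc +
    κ ^ 2 * planeWave κ a b x * Complex.I_sq

/-- The sum of the incident and the reflected wave. -/
def uSum (κ θ : ℝ) (x : Plane) : ℂ := uInc κ θ x + uRef κ θ x

lemma uSum_eq (κ θ : ℝ) : uSum κ θ =
    planeWave κ (Real.sin θ) (-Real.cos θ) + planeWave κ (Real.sin θ) (Real.cos θ) := by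
  ext x
  simp only [uSum, uInc_eq, uRef_eq, Pi.add_apply]

lemma contDiff_uSum (κ θ : ℝ) {n : WithTop ℕ∞} : ContDiff ℝ n (uSum κ θ) := by
  have h := (contDiff_planeWave κ (Real.sin θ) (-Real.cos θ) (n := n)).add
    (contDiff_planeWave κ (Real.sin θ) (Real.cos θ))
  rw [uSum_eq]
  exact h

lemma helmholtz_uSum (κ θ : ℝ) (x : Plane) :
    Laplacian.laplacian (uSum κ θ) x + (κ : ℂ) ^ 2 * uSum κ θ x = 0 := by
  have h1 := helmholtz_planeWave κ (a := Real.sin θ) (b := -Real.cos θ)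
    (by rw [neg_sq]; exact Real.sin_sq_add_cos_sq θ) x
  have h2 := helmholtz_planeWave κ (Real.sin_sq_add_cos_sq θ) x
  rw [uSum_eq, ContDiffAt.laplacian_add
    (contDiff_planeWave κ (Real.sin θ) (-Real.cos θ)).contDiffAt
    (contDiff_planeWave κ (Real.sin θ) (Real.cos θ)).contDiffAt, Pi.add_apply]
  linear_combination h1 + h2

lemma hasVerticalDeriv_uSum (κ θ t : ℝ) : HasVerticalDeriv (uSum κ θ) 0 t 0 := by
  have hw : ∀ b : ℝ, HasDerivAt (fun s : ℝ => planeWave κ (Real.sin θ) b !₂[t, s])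
      (planeWave κ (Real.sin θ) b !₂[t, 0] * (Complex.I * κ * b)) 0 := by
    intro b
    have h1 : HasDerivAt (fun s : ℝ => t * Real.sin θ + s * b) b 0 := by
      simpa using ((hasDerivAt_id (0 : ℝ)).mul_const b).const_add (t * Real.sin θ)
    exact (h1.ofReal_comp.const_mul (Complex.I * κ)).cexp
  have h := (hw (-Real.cos θ)).add (hw (Real.cos θ))
  have h0 : planeWave κ (Real.sin θ) (-Real.cos θ) !₂[t, 0] * (Complex.I * κ * (-Real.cos θ : ℝ)) +
      planeWave κ (Real.sin θ) (Real.cos θ) !₂[t, 0] * (Complex.I * κ * (Real.cos θ : ℝ)) = 0 := by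
    simp only [planeWave]
    simp
  rw [h0] at h
  have hfun : (fun s : ℝ => uSum κ θ !₂[t, s]) =
      (fun s : ℝ => planeWave κ (Real.sin θ) (-Real.cos θ) !₂[t, s]) +
        fun s : ℝ => planeWave κ (Real.sin θ) (Real.cos θ) !₂[t, s] := by
    ext s
    simp only [uSum, uInc_eq, uRef_eq, Pi.add_apply]
  rw [HasVerticalDeriv, hfun]
  exact h.hasDerivWithinAt

lemma scattered_eq (κ θ : ℝ) (v : Plane → ℂ) : scattered κ θ v = v - uSum κ θ := rfl

lemma isClosed_corners (ε : ℝ) : IsClosed (corners ε) :=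
  ((Set.finite_singleton _).insert _).isClosed

lemma disjoint_corners (ε : ℝ) : Disjoint (corners ε) upperHalf := by
  rw [corners_eq]
  refine Set.disjoint_left.2 ?_
  rintro x (rfl | rfl) <;> exact bdryPt_notMem_upperHalf _

/-- The sum of incident and reflected waves has zero normal derivative on the boundary line, so
subtracting it leaves the Neumann datum of v unchanged. -/
lemma isHelmholtzOff_scattered (hv : IsHalfPlaneSolution κ θ ε d v) :
    IsHelmholtzOff κ (corners ε) (apertureDatum ε (dtn0 κ ε d v)) (scattered κ θ v) where
  isClosed := isClosed_corners ε
  disjoint := disjoint_corners ε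
  contDiffOn_interior := hv.contDiffOn_interior.sub (contDiff_uSum κ θ).contDiffOn
  contDiffOn_boundary := hv.contDiffOn_boundary.sub (contDiff_uSum κ θ).contDiffOn
  helmholtz := fun x hx => by
    have h1 := hv.helmholtz x hx
    have h2 := helmholtz_uSum κ θ x
    rw [scattered_eq, (hv.contDiffOn_interior.contDiffAt
      (isOpen_upperHalf.mem_nhds hx)).laplacian_sub (contDiff_uSum κ θ).contDiffAt, Pi.sub_apply]
    linear_combination h1 - h2
  normal := fun t ht => by
    have hvt : HasVerticalDeriv v (apertureDatum ε (dtn0 κ ε d v) t) t 0 := by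
      rw [apertureDatum]
      by_cases hmem : t ∈ Set.Ioo 0 ε
      · rw [Set.indicator_of_mem hmem]
        exact hv.aperture t hmem.1 hmem.2
      · rw [Set.indicator_of_notMem hmem]
        refine hv.neumann t ?_
        by_contra! hc
        refine ht ?_
        rw [corners_eq]
        rcases hc.1.eq_or_lt with h0 | h0
        · left; rw [← h0]
        · rcases hc.2.eq_or_lt with h1 | h1
          · right; rw [h1]; rfl
          · exact absurd ⟨h0, h1⟩ hmem
    have h := HasDerivWithinAt.sub hvt (hasVerticalDeriv_uSum κ θ t)
    rw [sub_zero] at h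
    exact h

lemma memLp_restrict_of_continuous {F : Type*} [NormedAddCommGroup F] {f : Plane → F}
    (hf : Continuous f) (R : ℝ) : MemLp f 2 (volume.restrict (upperHalf ∩ Metric.ball 0 R)) := by
  obtain ⟨C, hC⟩ := (isCompact_closedBall (0 : Plane) R).exists_bound_of_continuousOn
    hf.continuousOn
  have hfin : IsFiniteMeasure (volume.restrict (upperHalf ∩ Metric.ball (0 : Plane) R)) :=
    ⟨by
      rw [Measure.restrict_apply_univ]
      exact (measure_mono Set.inter_subset_right).trans_lt measure_ball_lt_top⟩
  refine MemLp.of_bound hf.aestronglyMeasurable C ?_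
  refine (ae_restrict_iff' (isOpen_upperHalf.inter Metric.isOpen_ball).measurableSet).2
    (ae_of_all _ fun x hx => hC x (Metric.ball_subset_closedBall hx.2))

lemma continuous_grad {f : Plane → ℂ} (hf : ContDiff ℝ 1 f) : Continuous (grad f) := by
  refine (PiLp.continuous_toLp 2 _).comp (continuous_pi fun j => ?_)
  exact (hf.continuous_fderiv (by norm_num)).clm_apply continuous_const

lemma memLp_scattered (hv : IsHalfPlaneSolution κ θ ε d v) (R : ℝ) :
    MemLp (scattered κ θ v) 2 (volume.restrict (upperHalf ∩ Metric.ball 0 R)) :=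
  (hv.memLp_local R).sub (memLp_restrict_of_continuous (contDiff_uSum κ θ (n := 1)).continuous R)

lemma memLp_grad_scattered (hv : IsHalfPlaneSolution κ θ ε d v) (R : ℝ) :
    MemLp (grad (scattered κ θ v)) 2 (volume.restrict (upperHalf ∩ Metric.ball 0 R)) := by
  refine MemLp.ae_eq ?_ ((hv.memLp_grad_local R).sub
    (memLp_restrict_of_continuous (continuous_grad (contDiff_uSum κ θ)) R))
  refine (ae_restrict_iff' (isOpen_upperHalf.inter Metric.isOpen_ball).measurableSet).2
    (ae_of_all _ fun x hx => ?_)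
  have hd : DifferentiableAt ℝ v x :=
    (hv.contDiffOn_interior.differentiableOn (by norm_num)).differentiableAt
      (isOpen_upperHalf.mem_nhds hx.1)
  ext j
  simp only [Pi.sub_apply, grad, PiLp.sub_apply, scattered_eq]
  rw [fderiv_sub hd ((contDiff_uSum κ θ (n := 1)).differentiable (by norm_num) x)]
  rfl

lemma norm_phi0 (ε : ℝ) : ‖phi0 ε‖ = (√ε)⁻¹ := by
  rw [phi0, Complex.norm_real, Real.norm_of_nonneg (by positivity), one_div]

lemma half_le_cos {x : ℝ} (h0 : 0 ≤ x) (h1 : x ≤ 1) : 1 / 2 ≤ Real.cos x := by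
  have := Real.one_sub_sq_div_two_le_cos (x := x)
  nlinarith

lemma cexp_add_cexp_neg (κ d : ℝ) : Complex.exp (Complex.I * κ * d) +
    Complex.exp (-(Complex.I * κ * d)) = ((2 * Real.cos (κ * d) : ℝ) : ℂ) := by
  push_cast
  rw [Complex.two_cos, add_comm]
  ring_nf

/-- The quotient of exponentials is i tan κd, with |sin κd| ≤ κd and cos κd ≥ 1/2. The small factor
κd closes the absorption argument. -/
lemma norm_dtn0_le (hκ : 0 < κ) (hd : 0 < d) (hκd : κ * d ≤ 1) (v : Plane → ℂ) :
    ‖dtn0 κ ε d v‖ ≤ κ * (2 * (κ * d)) * ‖coeff0 ε 0 v‖ * (√ε)⁻¹ := by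
  have hx : 0 < κ * d := mul_pos hκ hd
  have hcos := half_le_cos hx.le hκd
  have hs : ‖Complex.exp (Complex.I * κ * d) - Complex.exp (-(Complex.I * κ * d))‖ ≤
      2 * (κ * d) := by
    have h1 : Complex.exp (Complex.I * κ * d) - Complex.exp (-(Complex.I * κ * d)) =
        Complex.I * ((2 * Real.sin (κ * d) : ℝ) : ℂ) := by
      push_cast
      rw [Complex.two_sin, mul_left_comm, Complex.I_mul_I]
      ring_nf
    rw [h1, norm_mul, Complex.norm_I, one_mul, Complex.norm_real, Real.norm_eq_abs, abs_mul,
      abs_of_pos (two_pos : (0 : ℝ) < 2)]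
    gcongr
    exact (Real.abs_sin_le_abs).trans_eq (abs_of_pos hx)
  have hc : ‖Complex.exp (Complex.I * κ * d) + Complex.exp (-(Complex.I * κ * d))‖ =
      2 * Real.cos (κ * d) := by
    rw [cexp_add_cexp_neg, Complex.norm_real, Real.norm_of_nonneg (by linarith)]
  rw [dtn0, norm_mul, norm_mul, norm_mul, norm_mul, norm_div, hc, norm_phi0, Complex.norm_I,
    one_mul, Complex.norm_real, Real.norm_of_nonneg hκ.le]
  gcongr
  rw [div_le_iff₀ (by linarith)]
  nlinarith

lemma norm_uSum_bdryPt_sub_two_le (hκ : 0 < κ) {t : ℝ} (ht : 0 < t) :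
    ‖uSum κ θ (bdryPt t) - 2‖ ≤ 2 * (κ * t) := by
  have h1 : uSum κ θ (bdryPt t) - 2 =
      2 * (Complex.exp (Complex.I * ((κ * (t * Real.sin θ) : ℝ) : ℂ)) - 1) := by
    simp only [uSum, uInc, uRef]
    simp
    ring_nf
  rw [h1, norm_mul, Complex.norm_ofNat]
  gcongr
  refine (Real.norm_exp_I_mul_ofReal_sub_one_le).trans ?_
  rw [Real.norm_eq_abs, abs_mul, abs_mul, abs_of_pos hκ, abs_of_pos ht]
  calc _ ≤ κ * (t * 1) := by gcongr; exact Real.abs_sin_le_one θ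
    _ = _ := by ring

/-- The size of the zeroth aperture coefficient of a solution in the half-plane. -/
theorem exists_coeff0_bounds : ∃ δ : ℝ, 0 < δ ∧ δ ≤ 1 ∧ ∀ {κ θ ε d : ℝ} {v : Plane → ℂ}, 0 < κ →
    0 < ε → 0 < d → ε ≤ d → κ * d ≤ δ → IsHalfPlaneSolution κ θ ε d v →
    √ε / 2 ≤ ‖coeff0 ε 0 v‖ ∧ ‖coeff0 ε 0 v‖ ≤ 6 * √ε := by
  obtain ⟨C, hC, hbound⟩ := exists_aperture_bound
  -- The first entry gives κε ≤ 1/2, so that the incident plus reflected wave differs from 2 by at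
  -- most 1 on the aperture; the second gives 2Cκd ≤ 1/2.
  refine ⟨min (1 / 2) (1 / (4 * C)), by positivity, (min_le_left _ _).trans (by norm_num), ?_⟩
  intro κ θ ε d v hκ hε hd hεd hδ hv
  have hδ1 : κ * d ≤ 1 / 2 := hδ.trans (min_le_left _ _)
  have hδ2 : κ * d ≤ 1 / (4 * C) := hδ.trans (min_le_right _ _)
  have hx : 0 < κ * d := mul_pos hκ hd
  have hκε : κ * ε ≤ 1 / 2 := (mul_le_mul_of_nonneg_left hεd hκ.le).trans hδ1
  have hw := isHelmholtzOff_scattered hv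
  set c := coeff0 ε 0 v with hc
  set s : ℝ := C * (κ * (2 * (κ * d)) * ‖c‖ * (√ε)⁻¹) * (√ε / √κ) with hs
  have hsε : 0 < √ε := Real.sqrt_pos.2 hε
  have hsκ : 0 < √κ := Real.sqrt_pos.2 hκ
  have hwle : ∀ t, 0 < t → t < ε → ‖scattered κ θ v (bdryPt t)‖ ≤ s := fun t h0 h1 => by
    refine (hbound hκ hw hv.radiation (memLp_scattered hv) (memLp_grad_scattered hv) t h0 h1).trans
      ?_
    rw [hs]
    gcongr
    exact norm_dtn0_le hκ hd (by linarith) v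
  -- The scattered field is driven by c itself, so its contribution to c is absorbed rather than
  -- estimated absolutely.
  have hss : s * √ε ≤ ‖c‖ / 2 := by
    have h1 : s * √ε = (2 * C * (κ * d)) * ‖c‖ * (√κ * √ε) := by
      rw [hs]
      have : κ = √κ * √κ := (Real.mul_self_sqrt hκ.le).symm
      nth_rewrite 1 [this]
      field_simp
    have h2 : √κ * √ε ≤ 1 := by
      rw [← Real.sqrt_mul hκ.le]
      exact Real.sqrt_le_one.2 (by linarith)
    have h3 : 2 * C * (κ * d) ≤ 1 / 2 := by
      calc 2 * C * (κ * d) ≤ 2 * C * (1 / (4 * C)) := by gcongr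
        _ = 1 / 2 := by field_simp; norm_num
    rw [h1]
    calc _ ≤ 1 / 2 * ‖c‖ * 1 := by gcongr
      _ = _ := by ring
  have hpt : ∀ t ∈ Set.Ioo 0 ε, ‖v (bdryPt t) - 2‖ ≤ 1 + s := fun t ht => by
    have h1 : v (bdryPt t) - 2 = (uSum κ θ (bdryPt t) - 2) + scattered κ θ v (bdryPt t) := by
      simp only [scattered, uSum]; ring
    rw [h1]
    refine (norm_add_le _ _).trans (add_le_add ?_ (hwle t ht.1 ht.2))
    refine (norm_uSum_bdryPt_sub_two_le hκ ht.1).trans ?_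
    have : κ * t ≤ κ * ε := mul_le_mul_of_nonneg_left ht.2.le hκ.le
    linarith
  have hcont : ContinuousOn (fun t : ℝ => v (bdryPt t)) (Set.Ioo 0 ε) := by
    refine hv.contDiffOn_boundary.continuousOn.comp ?_ fun t ht =>
      ⟨mem_closedUpperHalf_boundary t, ?_⟩
    · have : Continuous fun t : ℝ => toPlane (t, 0) := by fun_prop
      exact this.continuousOn
    · rw [corners_eq]
      rintro (h | h)
      · exact ht.1.ne' (bdryPt_injective h)
      · exact ht.2.ne (bdryPt_injective h)
  have hi : IntervalIntegrable (fun t : ℝ => v (bdryPt t)) volume 0 ε := by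
    rw [intervalIntegrable_iff_integrableOn_Ioo_of_le hε.le]
    refine IntegrableOn.of_bound (by simp) (hcont.aestronglyMeasurable measurableSet_Ioo)
      (2 + (1 + s)) ((ae_restrict_iff' measurableSet_Ioo).2 (ae_of_all _ fun t ht => ?_))
    have h1 := norm_add_le (v (bdryPt t) - 2) 2
    rw [sub_add_cancel, Complex.norm_ofNat] at h1
    linarith [hpt t ht]
  have hcsub : c - 2 * ε * phi0 ε = ∫ t in (0 : ℝ)..ε, (v (bdryPt t) - 2) * phi0 ε := by
    rw [intervalIntegral.integral_mul_const, intervalIntegral.integral_sub hi (by simp), hc,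
      coeff0, intervalIntegral.integral_mul_const, intervalIntegral.integral_const]
    simp
    ring
  have hnorm : ‖c - 2 * ε * phi0 ε‖ ≤ √ε + ‖c‖ / 2 := by
    have h1 : ‖∫ t in (0 : ℝ)..ε, (v (bdryPt t) - 2) * phi0 ε‖ ≤ (1 + s) * (√ε)⁻¹ * |ε - 0| := by
      refine intervalIntegral.norm_integral_le_of_norm_le_const_ae ?_
      have hne : ∀ᵐ t : ℝ, t ≠ ε := by simp [ae_iff, measure_singleton]
      filter_upwards [hne] with t ht hmem
      rw [Set.uIoc_of_le hε.le] at hmem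
      rw [norm_mul, norm_phi0]
      gcongr
      exact hpt t ⟨hmem.1, lt_of_le_of_ne hmem.2 ht⟩
    rw [← hcsub, sub_zero, abs_of_pos hε] at h1
    have h2 : (1 + s) * (√ε)⁻¹ * ε = √ε + s * √ε := by
      have : ε = √ε * √ε := (Real.mul_self_sqrt hε.le).symm
      nth_rewrite 2 [this]
      field_simp
    linarith
  have hmain : ‖(2 * ε * phi0 ε : ℂ)‖ = 2 * √ε := by
    rw [norm_mul, norm_mul, norm_phi0, Complex.norm_ofNat, Complex.norm_real,
      Real.norm_of_nonneg hε.le, mul_assoc]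
    congr 1
    rw [← div_eq_mul_inv, Real.div_sqrt]
  have h1 := norm_sub_norm_le (2 * ε * phi0 ε : ℂ) c
  have h2 := norm_sub_norm_le c (2 * ε * phi0 ε : ℂ)
  rw [norm_sub_rev] at h1
  -- From |c - 2εφ₀| ≤ √ε + |c|/2 and |2εφ₀| = 2√ε.
  constructor <;> linarith

end

/-! ### The single-mode field in the cavity. -/

noncomputable section

variable {κ θ ε d : ℝ} {v : Plane → ℂ}

lemma phi0_ne_zero (hε : 0 < ε) : phi0 ε ≠ 0 := by
  rw [← norm_ne_zero_iff, norm_phi0]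
  exact inv_ne_zero (Real.sqrt_pos.2 hε).ne'

/-- The Neumann condition on the bottom couples the two modes. -/
lemma alphaPlus_mul_exp (hκ : 0 < κ) (hε : 0 < ε) (hd : 0 < d)
    (hv : IsSingleModeInCavity κ ε d v) :
    alphaPlus κ ε d v * Complex.exp (Complex.I * κ * d) = alphaMinus κ ε d v := by
  have hκc : (κ : ℂ) ≠ 0 := by exact_mod_cast hκ.ne'
  set a := alphaPlus κ ε d v
  set b := alphaMinus κ ε d v
  have h1 : HasDerivAt (fun t : ℝ => Complex.exp (-(Complex.I * κ * t)))
      (Complex.exp (-(Complex.I * κ * (-d : ℝ))) * -(Complex.I * κ)) (-d) := by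
    have := (((hasDerivAt_id (-d)).ofReal_comp.const_mul (Complex.I * κ)).neg).cexp
    simpa using this
  have h2 : HasDerivAt (fun t : ℝ => Complex.exp (Complex.I * κ * (t + d)))
      (Complex.exp (Complex.I * κ * ((-d : ℝ) + d)) * (Complex.I * κ)) (-d) := by
    have := (((hasDerivAt_id (-d)).ofReal_comp.add_const (d : ℂ)).const_mul (Complex.I * κ)).cexp
    simpa using this
  have h3 := (((h1.const_mul a).add (h2.const_mul b)).mul_const (phi0 ε)).hasDerivWithinAt
    (s := Set.Ici (-d))
  have hb := hv.bottom (ε / 2) (by linarith) (by linarith)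
  have heq : (fun t : ℝ => v !₂[ε / 2, t]) =ᶠ[𝓝[Set.Ici (-d)] (-d)] fun t : ℝ =>
      (a * Complex.exp (-(Complex.I * κ * t)) + b * Complex.exp (Complex.I * κ * (t + d))) *
        phi0 ε := by
    have hlt : ∀ᶠ t in 𝓝[Set.Ici (-d)] (-d), t < 0 :=
      (eventually_lt_nhds (neg_lt_zero.2 hd)).filter_mono nhdsWithin_le_nhds
    filter_upwards [self_mem_nhdsWithin, hlt] with t ht ht0
    exact hv.single_mode (ε / 2) t (by linarith) (by linarith) ht ht0
  have h4 : HasDerivWithinAt (fun t : ℝ => v !₂[ε / 2, t]) _ (Set.Ici (-d)) (-d) :=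
    h3.congr_of_eventuallyEq_of_mem heq Set.self_mem_Ici
  have h5 := (uniqueDiffWithinAt_Ici (-d)).eq_deriv _ h4 hb
  have h6 : (Complex.I * κ * phi0 ε) * (b - a * Complex.exp (Complex.I * κ * d)) = 0 := by
    rw [← h5]
    simp
    ring
  rcases mul_eq_zero.1 h6 with h | h
  · exact absurd h (mul_ne_zero (mul_ne_zero Complex.I_ne_zero hκc) (phi0_ne_zero hε))
  · exact (sub_eq_zero.1 h).symm

/-- The zeroth aperture coefficient in terms of the amplitude of the cavity field. -/
lemma coeff0_eq_alphaMinus (hκ : 0 < κ) (hε : 0 < ε) (hd : 0 < d) (hκd : κ * d ≤ 1)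
    (hv : IsSingleModeInCavity κ ε d v) :
    coeff0 ε 0 v = alphaMinus κ ε d v * ((2 * Real.cos (κ * d) : ℝ) : ℂ) := by
  have hab := alphaPlus_mul_exp hκ hε hd hv
  set E := Complex.exp (Complex.I * κ * d) with hE
  have hE0 : E ≠ 0 := Complex.exp_ne_zero _
  have hE2 : Complex.exp (2 * Complex.I * κ * d) = E ^ 2 := by
    rw [hE, ← Complex.exp_nat_mul]; congr 1; push_cast; ring
  -- The denominator in the definitions of α± does not vanish because 0 < 2κd < π.
  have hne : E ^ 2 - 1 ≠ 0 := by
    intro h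
    have h1 : Complex.exp (((2 * (κ * d) : ℝ) : ℂ) * Complex.I) = 1 := by
      rw [← sub_eq_zero, ← h, ← hE2]; congr 2; push_cast; ring
    have h2 := congrArg Complex.im h1
    rw [Complex.exp_ofReal_mul_I_im, Complex.one_im] at h2
    have hpi := Real.pi_gt_three
    exact (Real.sin_pos_of_pos_of_lt_pi (by positivity) (by linarith)).ne' h2
  have ha : alphaPlus κ ε d v * (E ^ 2 - 1) = E * coeff0 ε (-d) v - coeff0 ε 0 v := by
    rw [alphaPlus, hE2, div_mul_cancel₀ _ hne]
  have hb : alphaMinus κ ε d v * (E ^ 2 - 1) = E * coeff0 ε 0 v - coeff0 ε (-d) v := by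
    rw [alphaMinus, hE2, div_mul_cancel₀ _ hne]
  -- Pure algebra from the definitions of α±, so no continuity of v across the aperture enters.
  have hc : coeff0 ε 0 v = E * alphaMinus κ ε d v + alphaPlus κ ε d v := by
    refine mul_right_cancel₀ hne ?_
    linear_combination -E * hb - ha
  rw [← cexp_add_cexp_neg, ← hE, Complex.exp_neg, ← hE, hc]
  field_simp
  linear_combination hab

/-- The gradient of the cavity field. -/
lemma norm_grad_cavity (hκ : 0 < κ) (hε : 0 < ε) (hd : 0 < d) (hv : IsSingleModeInCavity κ ε d v)
    {x : Plane} (hx : x ∈ cavity ε d) :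
    ‖grad v x‖ = 2 * ‖alphaMinus κ ε d v‖ * (√ε)⁻¹ * κ * |Real.sin (κ * (x 1 + d))| := by
  have hab := alphaPlus_mul_exp hκ hε hd hv
  set A : ℂ := 2 * alphaMinus κ ε d v * phi0 ε with hA
  have hproj : ∀ i : Fin 2, Continuous fun x : Plane => x i := fun i =>
    (EuclideanSpace.proj (𝕜 := ℝ) i).continuous
  have hopen : IsOpen (cavity ε d) :=
    (isOpen_lt continuous_const (hproj 0)).inter ((isOpen_lt (hproj 0) continuous_const).inter
      ((isOpen_lt continuous_const (hproj 1)).inter (isOpen_lt (hproj 1) continuous_const)))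
  -- With α⁺ = α⁻ e^{-iκd} the two exponentials combine to 2α⁻ cos(κ(y₂ + d)).
  have hveq : v =ᶠ[𝓝 x] fun y => A * ((Real.cos (κ * (y 1 + d)) : ℝ) : ℂ) := by
    filter_upwards [hopen.mem_nhds hx] with y hy
    have h1 := hv.single_mode (y 0) (y 1) hy.1 hy.2.1 hy.2.2.1.le hy.2.2.2
    have hy' : (!₂[y 0, y 1] : Plane) = y := by
      ext i; fin_cases i <;> simp
    rw [hy'] at h1
    have h2 : alphaPlus κ ε d v = alphaMinus κ ε d v * Complex.exp (-(Complex.I * κ * d)) := by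
      rw [← hab, mul_assoc, ← Complex.exp_add]; simp
    have h3 := cexp_add_cexp_neg κ (y 1 + d)
    have h4 : Complex.exp (-(Complex.I * κ * ((y 1 + d : ℝ) : ℂ))) =
        Complex.exp (-(Complex.I * κ * d)) * Complex.exp (-(Complex.I * κ * y 1)) := by
      rw [← Complex.exp_add]; congr 1; push_cast; ring
    rw [h4] at h3
    push_cast at h3 ⊢
    rw [h1, h2, hA]
    linear_combination (alphaMinus κ ε d v * phi0 ε) * h3
  have hd0 : HasFDerivAt (fun y : Plane => κ * (y 1 + d))
      (κ • EuclideanSpace.proj (𝕜 := ℝ) (1 : Fin 2) : Plane →L[ℝ] ℝ) x :=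
    (((EuclideanSpace.proj (𝕜 := ℝ) (1 : Fin 2)).hasFDerivAt (x := x)).add_const d).const_mul κ
  have hd1 := (Complex.ofRealCLM.hasFDerivAt.comp x hd0.cos).const_mul A
  have hfd : fderiv ℝ v x = _ := hveq.fderiv_eq.trans hd1.fderiv
  have hg : ∀ j, grad v x j = if j = 1 then -(A * ((Real.sin (κ * (x 1 + d)) * κ : ℝ) : ℂ)) else 0 := by
    intro j
    simp only [grad, hfd]
    fin_cases j <;> simp
  rw [EuclideanSpace.norm_eq, Fin.sum_univ_two, hg, hg]
  simp only [zero_ne_one, if_false, if_true, norm_zero, ne_eq, OfNat.ofNat_ne_zero,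
    not_false_eq_true, zero_pow, zero_add, norm_neg]
  rw [Real.sqrt_sq (norm_nonneg _), norm_mul, hA, norm_mul, norm_mul, norm_phi0,
    Complex.norm_ofNat, Complex.norm_real, Real.norm_eq_abs, abs_mul, abs_of_pos hκ]
  ring

lemma volume_rectangle {a b₀ b₁ : ℝ} :
    volume {x : Plane | 0 < x 0 ∧ x 0 < a ∧ b₀ < x 1 ∧ x 1 < b₁} =
      ENNReal.ofReal a * ENNReal.ofReal (b₁ - b₀) := by
  rw [← measurePreserving_toPlane.measure_preimage_emb measurableEmbedding_toPlane]
  have : toPlane ⁻¹' {x : Plane | 0 < x 0 ∧ x 0 < a ∧ b₀ < x 1 ∧ x 1 < b₁} =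
      Set.Ioo 0 a ×ˢ Set.Ioo b₀ b₁ := by
    ext p
    simp [and_assoc]
  rw [this, Measure.volume_eq_prod, Measure.prod_prod, Real.volume_Ioo, Real.volume_Ioo, sub_zero]

lemma measurableSet_cavity (ε d : ℝ) : MeasurableSet (cavity ε d) := by
  have hproj : ∀ i : Fin 2, Measurable fun x : Plane => x i := fun i =>
    (EuclideanSpace.proj (𝕜 := ℝ) i).continuous.measurable
  exact (measurableSet_lt measurable_const (hproj 0)).inter
    ((measurableSet_lt (hproj 0) measurable_const).inter
      ((measurableSet_lt measurable_const (hproj 1)).inter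
        (measurableSet_lt (hproj 1) measurable_const)))

lemma ofReal_mul_ofReal_rpow_half {a b : ℝ} (ha : 0 ≤ a) (hb : 0 ≤ b) :
    (ENNReal.ofReal a * ENNReal.ofReal b) ^ (1 / 2 : ℝ) = ENNReal.ofReal (√a * √b) := by
  rw [← ENNReal.ofReal_mul ha, ENNReal.ofReal_rpow_of_nonneg (by positivity) (by norm_num),
    ← Real.sqrt_eq_rpow, Real.sqrt_mul ha]

lemma rpow_three_half (hd : 0 < d) : d ^ (3 / 2 : ℝ) = d * √d := by
  rw [show (3 / 2 : ℝ) = 1 + 1 / 2 by norm_num, Real.rpow_add hd, Real.rpow_one,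
    Real.sqrt_eq_rpow]

end

end OpenCavity

/-! ### Assembly of the two-sided estimate. -/

theorem theorem4p2 :
    ∃ δ C₁ C₂ : ℝ, 0 < δ ∧ 0 < C₁ ∧ 0 < C₂ ∧
      ∀ κ θ ε d : ℝ, 0 < κ → -(Real.pi / 2) < θ → θ < Real.pi / 2 → 0 < ε → 0 < d →
        ε ≤ δ * d → d ≤ δ * OpenCavity.wavelength κ →
        ∀ v : OpenCavity.Plane → ℂ,
          OpenCavity.IsHalfPlaneSolution κ θ ε d v →
          OpenCavity.IsSingleModeInCavity κ ε d v →
          ENNReal.ofReal (C₁ * κ ^ 2 * Real.sqrt ε * d ^ (3 / 2 : ℝ)) ≤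
              eLpNorm (OpenCavity.grad v) 2 (volume.restrict (OpenCavity.cavity ε d)) ∧
            eLpNorm (OpenCavity.grad v) 2 (volume.restrict (OpenCavity.cavity ε d)) ≤
              ENNReal.ofReal (C₂ * κ ^ 2 * Real.sqrt ε * d ^ (3 / 2 : ℝ)) := by
  obtain ⟨δ₀, hδ₀, hδ₁, hcoeff⟩ := OpenCavity.exists_coeff0_bounds
  -- With λ = 2π/κ, d ≤ (δ₀/8)λ gives κd ≤ δ₀π/4 ≤ δ₀. The constant 1/16 is the lower gradient bound
  -- κ²d/8 times the 1/2 from √(d/2) ≥ √d/2; 12 comes from 2|α⁻| ≤ 12√ε.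
  refine ⟨δ₀ / 8, 1 / 16, 12, by positivity, by norm_num, by norm_num, ?_⟩
  intro κ θ ε d hκ _ _ hε hd hεd hdw v hv hcav
  have hκd : κ * d ≤ δ₀ := by
    have h1 : κ * d ≤ κ * (δ₀ / 8 * OpenCavity.wavelength κ) :=
      mul_le_mul_of_nonneg_left hdw hκ.le
    have h2 : κ * (δ₀ / 8 * OpenCavity.wavelength κ) = δ₀ * (Real.pi / 4) := by
      rw [OpenCavity.wavelength]; field_simp; norm_num
    have h3 : δ₀ * (Real.pi / 4) ≤ δ₀ * 1 := by
      gcongr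
      linarith [Real.pi_le_four]
    linarith
  have hκd1 : κ * d ≤ 1 := hκd.trans hδ₁
  have hx : 0 < κ * d := mul_pos hκ hd
  have hεd' : ε ≤ d := by
    have : δ₀ / 8 * d ≤ 1 * d := by gcongr; linarith
    linarith
  obtain ⟨hlow, hupp⟩ := hcoeff hκ hε hd hεd' hκd hv
  have hc := OpenCavity.coeff0_eq_alphaMinus hκ hε hd hκd1 hcav
  set A := ‖OpenCavity.alphaMinus κ ε d v‖ with hA
  have hA0 : 0 ≤ A := norm_nonneg _
  have hcos := OpenCavity.half_le_cos hx.le hκd1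
  have hcA : ‖OpenCavity.coeff0 ε 0 v‖ = A * (2 * Real.cos (κ * d)) := by
    rw [hc, norm_mul, Complex.norm_real, Real.norm_of_nonneg (by linarith)]
  rw [hcA] at hlow hupp
  have hA1 : √ε / 2 ≤ 2 * A := by
    have := mul_le_mul_of_nonneg_left (Real.cos_le_one (κ * d)) hA0
    linarith
  have hA2 : 2 * A ≤ 12 * √ε := by
    have := mul_le_mul_of_nonneg_left hcos hA0
    linarith
  have hsε : 0 < √ε := Real.sqrt_pos.2 hε
  have hinv : √ε * (√ε)⁻¹ = 1 := mul_inv_cancel₀ hsε.ne'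
  rw [OpenCavity.rpow_three_half hd]
  constructor
  -- The gradient vanishes at the bottom, so the lower bound uses the upper half of the cavity,
  -- where κ(x₂ + d) ≥ κd/2 and sin t ≥ 2t/π ≥ t/2.
  · set S : Set OpenCavity.Plane := OpenCavity.cavity ε (d / 2) with hS
    have hsub : S ⊆ OpenCavity.cavity ε d := fun x hx =>
      ⟨hx.1, hx.2.1, by linarith [hx.2.2.1], hx.2.2.2⟩
    have hvol : volume S = ENNReal.ofReal ε * ENNReal.ofReal (d / 2) := by
      rw [hS, OpenCavity.cavity, OpenCavity.volume_rectangle]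
      congr 2; ring
    have hpt : ∀ x ∈ S, κ ^ 2 * d / 8 ≤ ‖OpenCavity.grad v x‖ := by
      intro x hxS
      rw [OpenCavity.norm_grad_cavity hκ hε hd hcav (hsub hxS)]
      have hy1 : κ * d / 2 ≤ κ * (x 1 + d) := by
        have : κ * (d / 2) ≤ κ * (x 1 + d) :=
          mul_le_mul_of_nonneg_left (by linarith [hxS.2.2.1]) hκ.le
        linarith
      have hy2 : κ * (x 1 + d) ≤ κ * d :=
        mul_le_mul_of_nonneg_left (by linarith [hxS.2.2.2]) hκ.le
      have hpi := Real.pi_gt_three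
      have hsin := Real.mul_le_sin (x := κ * (x 1 + d)) (by linarith) (by linarith)
      have hpi2 : 1 / 2 ≤ 2 / Real.pi := by
        rw [div_le_div_iff₀ two_pos Real.pi_pos]; linarith [Real.pi_le_four]
      have hsin' : κ * d / 4 ≤ |Real.sin (κ * (x 1 + d))| := by
        refine le_trans ?_ ((hsin).trans (le_abs_self _))
        calc κ * d / 4 = 1 / 2 * (κ * d / 2) := by ring
          _ ≤ _ := by gcongr
      calc κ ^ 2 * d / 8 = (√ε / 2) * (√ε)⁻¹ * κ * (κ * d / 4) := by
            linear_combination (-(κ ^ 2 * d / 8)) * hinv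
        _ ≤ _ := by gcongr
    have hle : eLpNorm (fun _ : OpenCavity.Plane => κ ^ 2 * d / 8) 2 (volume.restrict S) ≤
        eLpNorm (OpenCavity.grad v) 2 (volume.restrict (OpenCavity.cavity ε d)) := by
      refine le_trans ?_ (eLpNorm_mono_measure _ (Measure.restrict_mono hsub le_rfl))
      refine eLpNorm_mono_ae ((ae_restrict_iff' (OpenCavity.measurableSet_cavity ε _)).2
        (ae_of_all _ fun x hx => ?_))
      rw [Real.norm_of_nonneg (by positivity)]
      exact hpt x hx
    refine le_trans ?_ hle
    rw [eLpNorm_const' _ two_ne_zero ENNReal.ofNat_ne_top, Measure.restrict_apply_univ, hvol,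
      ENNReal.toReal_ofNat, OpenCavity.ofReal_mul_ofReal_rpow_half hε.le (by linarith),
      Real.enorm_eq_ofReal (by positivity), ← ENNReal.ofReal_mul (by positivity)]
    refine ENNReal.ofReal_le_ofReal ?_
    have hs2 : √d / 2 ≤ √(d / 2) := by
      refine Real.le_sqrt_of_sq_le ?_
      rw [div_pow, Real.sq_sqrt hd.le]
      linarith
    calc 1 / 16 * κ ^ 2 * √ε * (d * √d) = κ ^ 2 * d / 8 * (√ε * (√d / 2)) := by ring
      _ ≤ _ := by gcongr
  · have hvol : volume (OpenCavity.cavity ε d) = ENNReal.ofReal ε * ENNReal.ofReal d := by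
      rw [OpenCavity.cavity, OpenCavity.volume_rectangle]
      congr 2; ring
    have hpt : ∀ x ∈ OpenCavity.cavity ε d, ‖OpenCavity.grad v x‖ ≤ 12 * κ ^ 2 * d := by
      intro x hxS
      rw [OpenCavity.norm_grad_cavity hκ hε hd hcav hxS]
      have hy1 : 0 ≤ κ * (x 1 + d) := mul_nonneg hκ.le (by linarith [hxS.2.2.1])
      have hy2 : κ * (x 1 + d) ≤ κ * d :=
        mul_le_mul_of_nonneg_left (by linarith [hxS.2.2.2]) hκ.le
      have hsin : |Real.sin (κ * (x 1 + d))| ≤ κ * d :=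
        Real.abs_sin_le_abs.trans (by rwa [abs_of_nonneg hy1])
      calc _ ≤ (12 * √ε) * (√ε)⁻¹ * κ * (κ * d) := by gcongr
        _ = 12 * κ ^ 2 * d := by linear_combination (12 * κ ^ 2 * d) * hinv
    have hle := eLpNorm_le_of_ae_bound (p := 2)
      ((ae_restrict_iff' (OpenCavity.measurableSet_cavity ε d)).2 (ae_of_all volume hpt))
    refine hle.trans ?_
    rw [Measure.restrict_apply_univ, hvol, ENNReal.toReal_ofNat, ← one_div,
      OpenCavity.ofReal_mul_ofReal_rpow_half hε.le hd.le, ← ENNReal.ofReal_mul (by positivity)]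
    refine ENNReal.ofReal_le_ofReal (le_of_eq ?_)
    ring
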